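/- Let $\Omega\subseteq\mathbb{R}^2$ be a simply connected, bounded, polygonal Lipschitz domain and let $\mathcal{T}$ be a regular triangulation of $\Omega$, i.e. a finite set of nondegenerate closed triangles with $\overline\Omega=\bigcup\mathcal{T}$ such that any two distinct triangles are disjoint or share exactly one common vertex or exactly one common edge. Let $P_k(\mathcal{T};X)$ denote the $X$-valued functions which on each $T\in\mathcal{T}$ are componentwise polynomials of total degree at most $k$, $P_k(\mathcal{T}):=P_k(\mathcal{T};\mathbb{R})$ (no condition is imposed on the null set of edges, and such functions are identified if they agree in the interior of every triangle). Set $Y:=\{v\in H^1(\Omega):\int_\Omega v\,dx=0\}$, $\operatorname{Curl}\beta:=(\partial\beta/\partial x_2,-\partial\beta/\partial x_1)$, and let $\nabla_{NC}$ denote the piecewise gradient, $(\nabla_{NC}v)|_T:=\nabla(v|_T)$ for $T\in\mathcal{T}$. Let $$\mathrm{CR}^1_0(\mathcal{T}):=\{v\in P_1(\mathcal{T}) : v \text{ is continuous at midpoints of interior edges and vanishes at midpoints of boundary edges}\},$$ $$\mathrm{RT}_0(\mathcal{T}):=\{q\in H(\operatorname{div},\Omega) : \forall T\in\mathcal{T}\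 \exists a_T\in\mathbb{R}^2,\ b_T\in\mathbb{R}\ \text{ with } q(x)=a_T+b_Tx \text{ on } T\},$$ where an edge is a boundary edge if it is contained in $\partial\Omega$ and an interior edge otherwise. Let $f\in P_0(\mathcal{T})$ and let $\varphi\in\mathrm{RT}_0(\mathcal{T})$ satisfy $-\operatorname{div}\varphi=f$ in $\Omega$ (weakly). Then the following hold. 1. There is a unique pair $(p_h,\alpha_h)\in P_0(\mathcal{T};\mathbb{R}^2)\times(P_1(\mathcal{T})\cap Y)$ with $$(p_h,q_h)_{L^2(\Omega)}+(q_h,\operatorname{Curl}\alpha_h)_{L^2(\Omega)}=(\varphi,q_h)_{L^2(\Omega)}\quad\text{for all } q_h\in P_0(\mathcal{T};\mathbb{R}^2),$$ $$(p_h,\operatorname{Curl}\beta_h)_{L^2(\Omega)}=0\quad\text{for all }\beta_h\in P_1(\mathcal{T})\cap Y.$$ 2. There is a unique $u_{CR}\in\mathrm{CR}^1_0(\mathcal{T})$ with $$(\nabla_{NC}u_{CR},\nabla_{NC}v_{CR})_{L^2(\Omega)}=(f,v_{CR})_{L^2(\Omega)}\quad\text{for all }v_{CR}\in\mathrm{CR}^1_0(\mathcal{T}).$$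 3. These solutions satisfy $$p_h=\nabla_{NC}u_{CR}.$$ -/

import Mathlib

open MeasureTheory Set Filter Topology
open scoped ContDiff InnerProductSpace

namespace CRFEM

/-- The Euclidean plane `ℝ²`. -/
abbrev Plane : Type := EuclideanSpace ℝ (Fin 2)

/-! ### Domains -/

/-- `Ω` is a Lipschitz set: near each boundary point, after a rigid motion, `Ω` is the set of
points strictly above the graph of a Lipschitz function. -/
def HasLipschitzBoundary (Ω : Set Plane) : Prop :=
  ∀ x ∈ frontier Ω, ∃ r : ℝ, 0 < r ∧ ∃ (R : Plane ≃ₗᵢ[ℝ] Plane) (K : NNReal) (g : ℝ → ℝ),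
    LipschitzWith K g ∧ ∀ y ∈ Metric.ball x r, (y ∈ Ω ↔ g (R y 0) < R y 1)

/-- `Ω` is a bounded polygonal Lipschitz domain: a bounded, connected (and nonempty), open set
with Lipschitz boundary whose boundary is a finite union of line segments. -/
structure IsPolygonalLipschitzDomain (Ω : Set Plane) : Prop where
  isOpen : IsOpen Ω
  isConnected : IsConnected Ω
  isBounded : Bornology.IsBounded Ω
  lipschitz : HasLipschitzBoundary Ω
  polygonal : ∃ S : Finset (Plane × Plane), frontier Ω = ⋃ s ∈ S, segment ℝ s.1 s.2

/-! ### Triangulations -/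

/-- The closed triangle (as a set of points) spanned by three affinely independent vertices. -/
def closedTriangle (T : Affine.Triangle ℝ Plane) : Set Plane :=
  convexHull ℝ (range T.points)

/-- `𝒯` is a regular triangulation of `Ω`: a finite set of nondegenerate closed triangles that
cover the closure of `Ω`, any two distinct ones being disjoint or sharing exactly one common
vertex or exactly one common edge. (Two enumerations of the vertices of the same triangle cannot
both belong to `𝒯`.) -/
structure IsRegularTriangulation (𝒯 : Finset (Affine.Triangle ℝ Plane)) (Ω : Set Plane) :
    Prop where
  cover : closure Ω = ⋃ T ∈ 𝒯, closedTriangle T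
  regular : ∀ T ∈ 𝒯, ∀ T' ∈ 𝒯, T ≠ T' →
    closedTriangle T ∩ closedTriangle T' = ∅ ∨
    (∃ i j : Fin 3, T.points i = T'.points j ∧
      closedTriangle T ∩ closedTriangle T' = {T.points i}) ∨
    (∃ i i' j j' : Fin 3, i ≠ i' ∧ T.points i = T'.points j ∧ T.points i' = T'.points j' ∧
      closedTriangle T ∩ closedTriangle T' = segment ℝ (T.points i) (T.points i'))

/-- The union of the open triangles. Its complement in `Ω` (the edges and vertices) is a null set;
piecewise functions, which are elements of `L²(Ω)`, matter only on this set. -/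
def openPieces (𝒯 : Finset (Affine.Triangle ℝ Plane)) : Set Plane :=
  ⋃ T ∈ 𝒯, interior (closedTriangle T)

/-! ### Piecewise polynomials -/

/-- `P_k(𝒯)`: functions which on each triangle are polynomials of total degree at most `k`. No
condition is imposed on the null set of edges, where the two one-sided values may differ. -/
def PiecewisePoly (k : ℕ) (𝒯 : Finset (Affine.Triangle ℝ Plane)) : Set (Plane → ℝ) :=
  {v | ∀ T ∈ 𝒯, ∃ P : MvPolynomial (Fin 2) ℝ, P.totalDegree ≤ k ∧
    ∀ x ∈ interior (closedTriangle T), v x = MvPolynomial.eval (fun i => x i) P}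

/-- `P_k(𝒯; ℝ²)`: each component is in `P_k(𝒯)`. -/
def PiecewisePolyVec (k : ℕ) (𝒯 : Finset (Affine.Triangle ℝ Plane)) : Set (Plane → Plane) :=
  {q | ∀ i : Fin 2, (fun x => q x i) ∈ PiecewisePoly k 𝒯}

/-- The piecewise gradient `∇_NC v`: on each open triangle it is the classical gradient of `v`
(and it is `0` on the null set outside the open triangles). -/
noncomputable def gradNC (𝒯 : Finset (Affine.Triangle ℝ Plane)) (v : Plane → ℝ) : Plane → Plane :=
  (openPieces 𝒯).indicator (gradient v)

/-! ### Weak derivatives and Sobolev spaces -/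

/-- `C_c^∞(Ω)`. -/
def TestFunctions (Ω : Set Plane) : Set (Plane → ℝ) :=
  {ψ | ContDiff ℝ ∞ ψ ∧ HasCompactSupport ψ ∧ tsupport ψ ⊆ Ω}

/-- `g ∈ L²(Ω; ℝ²)` is the weak gradient of `v` on `Ω`. -/
def IsWeakGradient (Ω : Set Plane) (v : Plane → ℝ) (g : Plane → Plane) : Prop :=
  MemLp g 2 (volume.restrict Ω) ∧ ∀ ψ ∈ TestFunctions Ω, ∀ i : Fin 2,
    ∫ x in Ω, v x * gradient ψ x i = - ∫ x in Ω, g x i * ψ x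

/-- `H¹(Ω)`. -/
def H1 (Ω : Set Plane) : Set (Plane → ℝ) :=
  {v | MemLp v 2 (volume.restrict Ω) ∧ ∃ g, IsWeakGradient Ω v g}

open Classical in
/-- The weak gradient of `v ∈ H¹(Ω)` (unique almost everywhere in `Ω`). -/
noncomputable def weakGradient (Ω : Set Plane) (v : Plane → ℝ) : Plane → Plane :=
  if h : ∃ g, IsWeakGradient Ω v g then h.choose else 0

/-- `Curl β = (∂β/∂x₂, -∂β/∂x₁)` for `β ∈ H¹(Ω)`. -/
noncomputable def curl (Ω : Set Plane) (β : Plane → ℝ) : Plane → Plane :=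
  fun x => !₂[weakGradient Ω β x 1, - weakGradient Ω β x 0]

/-- `d ∈ L²(Ω)` is the weak divergence of `q` on `Ω`. -/
def IsWeakDivergence (Ω : Set Plane) (q : Plane → Plane) (d : Plane → ℝ) : Prop :=
  MemLp d 2 (volume.restrict Ω) ∧ ∀ ψ ∈ TestFunctions Ω,
    ∫ x in Ω, ⟪q x, gradient ψ x⟫_ℝ = - ∫ x in Ω, d x * ψ x

/-- `H(div, Ω)`. -/
def Hdiv (Ω : Set Plane) : Set (Plane → Plane) :=
  {q | MemLp q 2 (volume.restrict Ω) ∧ ∃ d, IsWeakDivergence Ω q d}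

/-- `Y = H¹(Ω) ∩ L²₀(Ω)`: functions in `H¹(Ω)` with vanishing integral mean. -/
def Y (Ω : Set Plane) : Set (Plane → ℝ) :=
  {v | v ∈ H1 Ω ∧ ∫ x in Ω, v x = 0}

/-! ### The mixed discretization -/

/-- `Y_h(𝒯) = P_{k+1}(𝒯) ∩ Y`. -/
def Yh (k : ℕ) (𝒯 : Finset (Affine.Triangle ℝ Plane)) (Ω : Set Plane) : Set (Plane → ℝ) :=
  PiecewisePoly (k + 1) 𝒯 ∩ Y Ω

/-- `(p, α) ∈ P_k(𝒯; ℝ²) × Y_h(𝒯)` solves the discrete mixed problem of degree `k` with datum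
`φ`. -/
structure IsMixedSolution (k : ℕ) (𝒯 : Finset (Affine.Triangle ℝ Plane)) (Ω : Set Plane)
    (φ p : Plane → Plane) (α : Plane → ℝ) : Prop where
  p_mem : p ∈ PiecewisePolyVec k 𝒯
  α_mem : α ∈ Yh k 𝒯 Ω
  eq_a : ∀ q ∈ PiecewisePolyVec k 𝒯,
    (∫ x in Ω, ⟪p x, q x⟫_ℝ) + (∫ x in Ω, ⟪q x, curl Ω α x⟫_ℝ) = ∫ x in Ω, ⟪φ x, q x⟫_ℝ
  eq_b : ∀ β ∈ Yh k 𝒯 Ω, ∫ x in Ω, ⟪p x, curl Ω β x⟫_ℝ = 0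

/-! ### Crouzeix–Raviart and Raviart–Thomas functions -/

/-- `CR¹₀(𝒯)`: piecewise affine functions that are continuous at the midpoints of interior edges
(the one-sided values from the triangles containing the midpoint agree) and vanish at the midpoints
of boundary edges. -/
def CR10 (𝒯 : Finset (Affine.Triangle ℝ Plane)) (Ω : Set Plane) : Set (Plane → ℝ) :=
  {v | v ∈ PiecewisePoly 1 𝒯 ∧ ∀ T ∈ 𝒯, ∀ i j : Fin 3, i ≠ j →
    (¬ segment ℝ (T.points i) (T.points j) ⊆ frontier Ω →
      ∃ c : ℝ, Tendsto v (𝓝[openPieces 𝒯] midpoint ℝ (T.points i) (T.points j)) (𝓝 c)) ∧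
    (segment ℝ (T.points i) (T.points j) ⊆ frontier Ω →
      Tendsto v (𝓝[openPieces 𝒯] midpoint ℝ (T.points i) (T.points j)) (𝓝 0))}

/-- `u ∈ CR¹₀(𝒯)` solves the Crouzeix–Raviart discretization of `-Δu = f`, `u = 0` on `∂Ω`. -/
structure IsCRSolution (𝒯 : Finset (Affine.Triangle ℝ Plane)) (Ω : Set Plane)
    (f u : Plane → ℝ) : Prop where
  mem : u ∈ CR10 𝒯 Ω
  eq : ∀ v ∈ CR10 𝒯 Ω, ∫ x in Ω, ⟪gradNC 𝒯 u x, gradNC 𝒯 v x⟫_ℝ = ∫ x in Ω, f x * v x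

/-- `RT₀(𝒯)`: functions in `H(div, Ω)` of the form `a_T + b_T x` on each triangle `T`. -/
def RT0 (𝒯 : Finset (Affine.Triangle ℝ Plane)) (Ω : Set Plane) : Set (Plane → Plane) :=
  {q | q ∈ Hdiv Ω ∧ ∀ T ∈ 𝒯, ∃ (a : Plane) (b : ℝ),
    ∀ x ∈ interior (closedTriangle T), q x = a + b • x}

end CRFEM

/-!
Everything is reduced to finite sums over the triangles. A function in `P_k(𝒯)` with `k ≤ 1` is
given by coefficients on each triangle, affine functions are integrated exactly by the barycentre
rule (`integral_piecewise_affine`), and distributional facts become conditions at edge midpoints: a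
piecewise Raviart–Thomas field with a weak divergence has matching normal components at the midpoint
of every interior edge (`IsWeakDivergence.jump_eq_zero`, by testing with a small bump function).

The link between the two discretizations is the discrete Helmholtz decomposition
`P₀(𝒯; ℝ²) = ∇_NC CR¹₀ ⊕ Curl (P₁(𝒯) ∩ Y)`.

* Orthogonality: for a Raviart–Thomas field and a Crouzeix–Raviart function, integration by parts
  triangle by triangle leaves no edge terms, since the normal component is constant along each edge
  and the jumps and the boundary values of the function vanish at edge midpoints
  (`sum_inner_eq_neg_sum_div`). A `Curl` is divergence free, so it is orthogonal to
  `∇_NC CR¹₀` (`sum_inner_rot_eq_zero`).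
* Completeness: a piecewise constant field orthogonal to the Crouzeix–Raviart basis function of each
  interior edge has no normal jumps, so rotated by a right angle it has no tangential jumps
  (`tangentiallyContinuous_of_orthogonal`). Such a field is locally a gradient; its local potentials
  form a covering space of `Ω`, which has a section because `Ω` is simply connected
  (`exists_potential`). The section is a continuous piecewise affine function, and products of it
  with test functions are Lipschitz, which yields its weak gradient (`exists_mem_Yh`).

With `p = ∇_NC u_CR`, the residual of the projection of `φ` is orthogonal to `∇_NC CR¹₀`, by the
integration by parts formula, `-div φ = f` and the Crouzeix–Raviart equation. Hence it is
`Curl α` for some `α`, and `(p, α)` solves the mixed problem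
(`IsCRSolution.exists_isMixedSolution`). Existence for the mixed problem and the identity
`p_h = ∇_NC u_CR` both follow from this and uniqueness (`IsMixedSolution.eqOn`).

Uniqueness needs that a function which is constant on each triangle and satisfies suitable edge
conditions is constant: triangles are connected through interior edges
(`IsRegularTriangulation.eq_const_of_edgeMatch`), because removing the finitely many vertices does
not disconnect small discs. For `CR¹₀` the constant vanishes since there is a boundary edge
(`IsRegularTriangulation.exists_boundary_edge`), for `Y` because of the mean value condition. An
edge shared by two triangles is not contained in the boundary (`not_edge_subset_frontier`), because a
Lipschitz domain is the interior of its closure.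
-/

namespace CRFEM

/-! ### Barycentric coordinates of a triangle -/

/-- The two-dimensional cross product `u₀ w₁ - u₁ w₀`. -/
def cross (u w : Plane) : ℝ := u 0 * w 1 - u 1 * w 0

theorem inner_plane (u w : Plane) : ⟪u, w⟫_ℝ = u 0 * w 0 + u 1 * w 1 := by
  simp [PiLp.inner_apply, Fin.sum_univ_two, mul_comm]

/-- The vertices of a triangle as an affine basis of the plane. -/
noncomputable def triBasis (T : Affine.Triangle ℝ Plane) : AffineBasis (Fin 3) ℝ Plane :=
  ⟨T.points, T.independent, by
    rw [T.independent.affineSpan_eq_top_iff_card_eq_finrank_add_one]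
    simp⟩

/-- Twice the signed area of a triangle. -/
noncomputable def triDet (T : Affine.Triangle ℝ Plane) : ℝ :=
  cross (T.points 1 - T.points 0) (T.points 2 - T.points 0)

/-- The barycentric coordinate of the vertex `k`. -/
noncomputable def lam (T : Affine.Triangle ℝ Plane) (k : Fin 3) : Plane →ᵃ[ℝ] ℝ :=
  (triBasis T).coord k

theorem lam_points (T : Affine.Triangle ℝ Plane) (k j : Fin 3) :
    lam T k (T.points j) = if k = j then 1 else 0 :=
  (triBasis T).coord_apply k j

theorem sum_lam (T : Affine.Triangle ℝ Plane) (x : Plane) :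
    lam T 0 x + lam T 1 x + lam T 2 x = 1 := by
  have := (triBasis T).sum_coord_apply_eq_one x
  rwa [Fin.sum_univ_three] at this

theorem lam_combination (T : Affine.Triangle ℝ Plane) (x : Plane) :
    lam T 0 x • T.points 0 + lam T 1 x • T.points 1 + lam T 2 x • T.points 2 = x := by
  have := (triBasis T).linear_combination_coord_eq_self x
  rwa [Fin.sum_univ_three] at this

theorem lam_combination_apply (T : Affine.Triangle ℝ Plane) (x : Plane) (i : Fin 2) :
    lam T 0 x * T.points 0 i + lam T 1 x * T.points 1 i + lam T 2 x * T.points 2 i = x i := by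
  have := congrArg (fun y : Plane => y i) (lam_combination T x)
  simpa using this

theorem triDet_ne_zero (T : Affine.Triangle ℝ Plane) : triDet T ≠ 0 := by
  intro h
  -- If the edge vectors were parallel, `lam T 1` and `lam T 2` would be dependent.
  have key : ∀ d : Plane, ∀ k, lam T k (d + T.points 0) =
      (lam T k).linear d + lam T k (T.points 0) := by
    intro d k
    simpa using (lam T k).map_vadd (T.points 0) d
  set u := T.points 1 - T.points 0 with hu
  set w := T.points 2 - T.points 0 with hw
  have e1 : (lam T 1).linear u = 1 := by
    have := key u 1
    simp [hu, lam_points] at this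
    simpa [hu] using this.symm
  have e2 : (lam T 1).linear w = 0 := by
    have := key w 1
    simp [hw, lam_points] at this
    simpa [hw] using this.symm
  have e3 : (lam T 2).linear w = 1 := by
    have := key w 2
    simp [hw, lam_points] at this
    simpa [hw] using this.symm
  have hcr : u 0 * w 1 - u 1 * w 0 = 0 := h
  have h0 : w 0 • u = u 0 • w := by
    ext i; fin_cases i <;> simp <;> linarith
  have h1 : w 1 • u = u 1 • w := by
    ext i; fin_cases i <;> simp <;> linarith
  have h0' := congrArg (lam T 1).linear h0
  have h1' := congrArg (lam T 1).linear h1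
  simp only [map_smul, e1, e2, smul_eq_mul, mul_one, mul_zero] at h0' h1'
  have : w = 0 := by ext i; fin_cases i <;> simp [h0', h1']
  rw [this] at e3
  simp at e3

/-- The barycentric coordinate `k` in terms of cross products. -/
theorem triDet_mul_lam (T : Affine.Triangle ℝ Plane) (k : Fin 3) (x : Plane) :
    triDet T * lam T k x = cross (T.points (k + 1) - x) (T.points (k + 2) - x) := by
  have hs := sum_lam T x
  have h0 := lam_combination_apply T x 0
  have h1 := lam_combination_apply T x 1
  have e0 : lam T 0 x = 1 - lam T 1 x - lam T 2 x := by linarith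
  rw [e0] at h0 h1
  fin_cases k <;> simp [triDet, cross] <;> rw [← h0, ← h1] <;> (try rw [e0]) <;> ring

/-- The gradient of the barycentric coordinate of the vertex `k`. -/
noncomputable def gradLam (T : Affine.Triangle ℝ Plane) (k : Fin 3) : Plane :=
  (triDet T)⁻¹ • !₂[-(T.points (k + 2) - T.points (k + 1)) 1,
    (T.points (k + 2) - T.points (k + 1)) 0]

theorem inner_gradLam (T : Affine.Triangle ℝ Plane) (k : Fin 3) (d : Plane) :
    ⟪gradLam T k, d⟫_ℝ = - cross d (T.points (k + 2) - T.points (k + 1)) / triDet T := by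
  rw [inner_plane]
  simp [gradLam, cross]
  ring

theorem lam_sub (T : Affine.Triangle ℝ Plane) (k : Fin 3) (x y : Plane) :
    lam T k x - lam T k y = ⟪gradLam T k, x - y⟫_ℝ := by
  have h := triDet_ne_zero T
  have hx := triDet_mul_lam T k x
  have hy := triDet_mul_lam T k y
  rw [inner_gradLam, eq_div_iff h, sub_mul, mul_comm, hx, mul_comm, hy]
  simp [cross]
  ring

theorem lam_eq (T : Affine.Triangle ℝ Plane) (k : Fin 3) (x : Plane) :
    lam T k x = ⟪gradLam T k, x⟫_ℝ + lam T k 0 := by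
  have := lam_sub T k x 0
  rw [sub_zero] at this
  linarith

theorem continuous_lam (T : Affine.Triangle ℝ Plane) (k : Fin 3) : Continuous (lam T k) := by
  have : (lam T k : Plane → ℝ) = fun x => ⟪gradLam T k, x⟫_ℝ + lam T k 0 := funext (lam_eq T k)
  rw [this]
  fun_prop

theorem gradLam_ne_zero (T : Affine.Triangle ℝ Plane) (k : Fin 3) : gradLam T k ≠ 0 := by
  intro h
  have := lam_sub T k (T.points k) (T.points (k + 1))
  rw [h, lam_points, lam_points] at this
  fin_cases k <;> simp at this

theorem mem_closedTriangle {T : Affine.Triangle ℝ Plane} {x : Plane} :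
    x ∈ closedTriangle T ↔ ∀ k, 0 ≤ lam T k x := by
  have : closedTriangle T = {x | ∀ k, 0 ≤ lam T k x} := (triBasis T).convexHull_eq_nonneg_coord
  rw [this]; rfl

theorem mem_interior {T : Affine.Triangle ℝ Plane} {x : Plane} :
    x ∈ interior (closedTriangle T) ↔ ∀ k, 0 < lam T k x := by
  have : interior (closedTriangle T) = {x | ∀ k, 0 < lam T k x} := (triBasis T).interior_convexHull
  rw [this]; rfl

theorem convex_closedTriangle (T : Affine.Triangle ℝ Plane) : Convex ℝ (closedTriangle T) :=
  convex_convexHull ℝ _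

theorem isCompact_closedTriangle (T : Affine.Triangle ℝ Plane) : IsCompact (closedTriangle T) :=
  (finite_range _).isCompact_convexHull ℝ

theorem isClosed_closedTriangle (T : Affine.Triangle ℝ Plane) : IsClosed (closedTriangle T) :=
  (isCompact_closedTriangle T).isClosed

theorem points_mem (T : Affine.Triangle ℝ Plane) (k : Fin 3) : T.points k ∈ closedTriangle T :=
  subset_convexHull ℝ _ (mem_range_self k)

theorem points_inj {T : Affine.Triangle ℝ Plane} {i j : Fin 3} :
    T.points i = T.points j ↔ i = j := T.independent.injective.eq_iff

/-- An affine function evaluated through barycentric coordinates. -/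
theorem affine_eq_sum_lam (T : Affine.Triangle ℝ Plane) (a x : Plane) (c : ℝ) :
    ⟪a, x⟫_ℝ + c = lam T 0 x * (⟪a, T.points 0⟫_ℝ + c) + lam T 1 x * (⟪a, T.points 1⟫_ℝ + c) +
      lam T 2 x * (⟪a, T.points 2⟫_ℝ + c) := by
  have h := sum_lam T x
  conv_lhs => rw [← lam_combination T x]
  simp only [inner_add_right, inner_smul_right]
  linear_combination (-c) * h

theorem ext_lam (T : Affine.Triangle ℝ Plane) {x y : Plane}
    (h : ∀ k, lam T k x = lam T k y) : x = y := by
  rw [← lam_combination T x, ← lam_combination T y, h 0, h 1, h 2]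

theorem lam_add_smul (T : Affine.Triangle ℝ Plane) (k : Fin 3) (x d : Plane) (s : ℝ) :
    lam T k (x + s • d) = lam T k x + s * ⟪gradLam T k, d⟫_ℝ := by
  have := lam_sub T k (x + s • d) x
  rw [add_sub_cancel_left, inner_smul_right] at this
  linarith

theorem lam_lineMap (T : Affine.Triangle ℝ Plane) (k : Fin 3) (x y : Plane) (s : ℝ) :
    lam T k (AffineMap.lineMap x y s) = (1 - s) * lam T k x + s * lam T k y := by
  rw [AffineMap.apply_lineMap, AffineMap.lineMap_apply]
  simp
  ring

/-! ### Edges -/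

/-- The edge opposite to the vertex `k`. -/
def edge (T : Affine.Triangle ℝ Plane) (k : Fin 3) : Set Plane :=
  segment ℝ (T.points (k + 1)) (T.points (k + 2))

/-- The midpoint of the edge opposite to the vertex `k`. -/
noncomputable def edgeMid (T : Affine.Triangle ℝ Plane) (k : Fin 3) : Plane :=
  midpoint ℝ (T.points (k + 1)) (T.points (k + 2))

/-- The barycentre of a triangle. -/
noncomputable def bary (T : Affine.Triangle ℝ Plane) : Plane :=
  (3⁻¹ : ℝ) • (T.points 0 + T.points 1 + T.points 2)

theorem lam_edgeMid (T : Affine.Triangle ℝ Plane) (k j : Fin 3) :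
    lam T j (edgeMid T k) = if j = k then 0 else 1 / 2 := by
  rw [edgeMid, midpoint, lam_lineMap, lam_points, lam_points]
  fin_cases k <;> fin_cases j <;> simp <;> norm_num

theorem lam_bary (T : Affine.Triangle ℝ Plane) (k : Fin 3) : lam T k (bary T) = 1 / 3 := by
  have h : ∀ j, lam T k (T.points j) = ⟪gradLam T k, T.points j⟫_ℝ + lam T k 0 :=
    fun j => lam_eq T k _
  have h3 : lam T k (T.points 0) + lam T k (T.points 1) + lam T k (T.points 2) = 1 := by
    simp only [lam_points]; fin_cases k <;> simp
  rw [lam_eq, bary, inner_smul_right, inner_add_right, inner_add_right]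
  linarith [h 0, h 1, h 2]

theorem bary_mem (T : Affine.Triangle ℝ Plane) : bary T ∈ interior (closedTriangle T) := by
  rw [mem_interior]; intro k; rw [lam_bary]; norm_num

theorem closure_interior (T : Affine.Triangle ℝ Plane) :
    closure (interior (closedTriangle T)) = closedTriangle T := by
  rw [(convex_closedTriangle T).closure_interior_eq_closure_of_nonempty_interior ⟨_, bary_mem T⟩,
    (isClosed_closedTriangle T).closure_eq]

theorem mem_edge {T : Affine.Triangle ℝ Plane} {k : Fin 3} {x : Plane} :
    x ∈ edge T k ↔ x ∈ closedTriangle T ∧ lam T k x = 0 := by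
  constructor
  · intro hx
    refine ⟨(convex_closedTriangle T).segment_subset (points_mem T _) (points_mem T _) hx, ?_⟩
    rw [edge, segment_eq_image_lineMap] at hx
    obtain ⟨s, -, rfl⟩ := hx
    rw [lam_lineMap, lam_points, lam_points]
    fin_cases k <;> simp
  · rintro ⟨hx, h0⟩
    rw [mem_closedTriangle] at hx
    rw [edge, segment_eq_image_lineMap]
    have hs := sum_lam T x
    refine ⟨lam T (k + 2) x, ⟨hx _, ?_⟩, ?_⟩
    · have h0 := hx 0; have h1 := hx 1; have h2 := hx 2
      fin_cases k <;> simp <;> linarith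
    · apply ext_lam T
      intro j
      rw [lam_lineMap, lam_points, lam_points]
      fin_cases k <;> fin_cases j <;> simp_all <;> linarith

theorem edgeMid_mem_edge (T : Affine.Triangle ℝ Plane) (k : Fin 3) : edgeMid T k ∈ edge T k :=
  midpoint_mem_segment _ _

theorem edge_subset (T : Affine.Triangle ℝ Plane) (k : Fin 3) : edge T k ⊆ closedTriangle T :=
  fun _ hx => (mem_edge.1 hx).1

theorem edgeMid_mem (T : Affine.Triangle ℝ Plane) (k : Fin 3) : edgeMid T k ∈ closedTriangle T :=
  edge_subset T k (edgeMid_mem_edge T k)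

theorem edgeMid_inj {T : Affine.Triangle ℝ Plane} {k j : Fin 3} (h : edgeMid T k = edgeMid T j) :
    k = j := by
  have h1 := lam_edgeMid T k k
  rw [h, lam_edgeMid] at h1
  by_contra hne
  rw [if_neg hne, if_pos rfl] at h1
  norm_num at h1

/-- Any two distinct vertices are the end points of the edge opposite to the third one. -/
theorem exists_edge_index {i j : Fin 3} (h : i ≠ j) :
    ∃ k : Fin 3, (i = k + 1 ∧ j = k + 2) ∨ (i = k + 2 ∧ j = k + 1) := by
  revert i j; decide

/-- The edges opposite to `k` in `T` and to `k'` in `T'` have the same end points. -/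
def EdgeMatch (T : Affine.Triangle ℝ Plane) (k : Fin 3) (T' : Affine.Triangle ℝ Plane)
    (k' : Fin 3) : Prop :=
  (T'.points (k' + 1) = T.points (k + 1) ∧ T'.points (k' + 2) = T.points (k + 2)) ∨
  (T'.points (k' + 1) = T.points (k + 2) ∧ T'.points (k' + 2) = T.points (k + 1))

section
variable {T T' : Affine.Triangle ℝ Plane} {k k' : Fin 3}

theorem EdgeMatch.symm (h : EdgeMatch T k T' k') : EdgeMatch T' k' T k := by
  rcases h with ⟨h1, h2⟩ | ⟨h1, h2⟩
  · exact Or.inl ⟨h1.symm, h2.symm⟩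
  · exact Or.inr ⟨h2.symm, h1.symm⟩

theorem EdgeMatch.trans {T'' : Affine.Triangle ℝ Plane} {k'' : Fin 3}
    (h : EdgeMatch T k T' k') (h' : EdgeMatch T' k' T'' k'') : EdgeMatch T k T'' k'' := by
  rcases h with ⟨h1, h2⟩ | ⟨h1, h2⟩ <;> rcases h' with ⟨h3, h4⟩ | ⟨h3, h4⟩ <;>
    simp [EdgeMatch, h1, h2, h3, h4]

theorem EdgeMatch.edgeMid_eq (h : EdgeMatch T k T' k') : edgeMid T' k' = edgeMid T k := by
  rcases h with ⟨h1, h2⟩ | ⟨h1, h2⟩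
  · rw [edgeMid, h1, h2, edgeMid]
  · rw [edgeMid, h1, h2, edgeMid, midpoint_comm]

/-- Barycentric coordinates belonging to a common edge are proportional. -/
theorem EdgeMatch.lam_eq_mul (h : EdgeMatch T k T' k') (x : Plane) :
    lam T' k' x = lam T' k' (T.points k) * lam T k x := by
  have hD := triDet_ne_zero T
  have hD' := triDet_ne_zero T'
  have hk : lam T k (T.points k) = 1 := by simp [lam_points]
  have e1 := triDet_mul_lam T k x
  have e2 := triDet_mul_lam T' k' x
  have e3 := triDet_mul_lam T' k' (T.points k)
  have e4 := triDet_mul_lam T k (T.points k)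
  rw [hk, mul_one] at e4
  apply mul_left_cancel₀ hD'
  apply mul_left_cancel₀ hD
  have : triDet T * (triDet T' * (lam T' k' (T.points k) * lam T k x)) =
      (triDet T' * lam T' k' (T.points k)) * (triDet T * lam T k x) := by ring
  rw [this, e1, e2, e3, e4]
  rcases h with ⟨h1, h2⟩ | ⟨h1, h2⟩
  · rw [h1, h2, mul_comm]
  · rw [h1, h2]
    simp only [cross]
    ring

theorem EdgeMatch.inner_gradLam (h : EdgeMatch T k T' k') (d : Plane) :
    ⟪gradLam T' k', d⟫_ℝ = lam T' k' (T.points k) * ⟪gradLam T k, d⟫_ℝ := by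
  have h1 := lam_sub T' k' d 0
  have h2 := lam_sub T k d 0
  rw [sub_zero] at h1 h2
  rw [← h1, ← h2, h.lam_eq_mul d, h.lam_eq_mul 0]
  ring

/-- The ratio of the (unsigned) areas of two triangles with a common edge. -/
theorem EdgeMatch.abs_triDet (h : EdgeMatch T k T' k') :
    |triDet T| = |triDet T'| * |lam T' k' (T.points k)| := by
  have e3 := triDet_mul_lam T' k' (T.points k)
  have e4 := triDet_mul_lam T k (T.points k)
  have hk : lam T k (T.points k) = 1 := by simp [lam_points]
  rw [hk, mul_one] at e4
  rw [← abs_mul, e3, e4]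
  rcases h with ⟨h1, h2⟩ | ⟨h1, h2⟩
  · rw [h1, h2]
  · rw [h1, h2, ← abs_neg]; simp only [cross]; congr 1; ring

end

/-! ### Combinatorics of the triangulation -/

/-- A Lipschitz domain has no slits: it lies on one side of its boundary. -/
theorem IsPolygonalLipschitzDomain.interior_closure {Ω : Set Plane}
    (hΩ : IsPolygonalLipschitzDomain Ω) : interior (closure Ω) = Ω := by
  apply Subset.antisymm _ (interior_maximal subset_closure hΩ.isOpen)
  intro x hx
  by_contra hxΩ
  have hxf : x ∈ frontier Ω := by
    rw [hΩ.isOpen.frontier_eq]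
    exact ⟨interior_subset hx, hxΩ⟩
  obtain ⟨r, hr, R, K, g, hg, hball⟩ := hΩ.lipschitz x hxf
  have hgc : Continuous g := hg.continuous
  -- Points strictly below the graph have a neighbourhood disjoint from `Ω`.
  have hbelow : ∀ y ∈ Metric.ball x r, R y 1 < g (R y 0) → y ∉ closure Ω := by
    intro y hy hlt hyc
    have hopen : IsOpen (Metric.ball x r ∩ {z | R z 1 < g (R z 0)}) := by
      refine Metric.isOpen_ball.inter (isOpen_lt ?_ ?_)
      · fun_prop
      · fun_prop
    obtain ⟨z, ⟨hz1, hz2⟩, hzΩ⟩ := mem_closure_iff.1 hyc _ hopen ⟨hy, hlt⟩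
    exact lt_asymm hz2 ((hball z hz1).1 hzΩ)
  have hxle : R x 1 ≤ g (R x 0) := by
    by_contra hlt
    exact hxΩ ((hball x (Metric.mem_ball_self hr)).2 (not_le.1 hlt))
  set d : Plane := R.symm (EuclideanSpace.single 1 1) with hd
  have hcont : Tendsto (fun s : ℝ => x - s • d) (𝓝[>] 0) (𝓝 x) := by
    have : Continuous (fun s : ℝ => x - s • d) := by fun_prop
    have h := this.tendsto 0
    simp only [zero_smul, sub_zero] at h
    exact h.mono_left nhdsWithin_le_nhds
  have hev : ∀ᶠ y in 𝓝 x, y ∈ interior (closure Ω) ∧ y ∈ Metric.ball x r :=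
    Filter.Eventually.and (isOpen_interior.mem_nhds hx) (Metric.ball_mem_nhds x hr)
  obtain ⟨s, ⟨hs1, hs2⟩, hs0⟩ := ((hcont.eventually hev).and self_mem_nhdsWithin).exists
  refine hbelow _ hs2 ?_ (interior_subset hs1)
  have hs0' : (0 : ℝ) < s := hs0
  simp [hd]
  linarith

section
variable {Ω : Set Plane} {𝒯 : Finset (Affine.Triangle ℝ Plane)}

theorem IsRegularTriangulation.triangle_subset (h𝒯 : IsRegularTriangulation 𝒯 Ω)
    {T : Affine.Triangle ℝ Plane} (hT : T ∈ 𝒯) : closedTriangle T ⊆ closure Ω := by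
  rw [h𝒯.cover]
  exact subset_biUnion_of_mem (u := fun T => closedTriangle T) hT

theorem IsRegularTriangulation.exists_mem (h𝒯 : IsRegularTriangulation 𝒯 Ω)
    {x : Plane} (hx : x ∈ closure Ω) : ∃ T ∈ 𝒯, x ∈ closedTriangle T := by
  rw [h𝒯.cover] at hx
  simpa using hx

theorem interior_subset_domain (hΩ : IsPolygonalLipschitzDomain Ω)
    (h𝒯 : IsRegularTriangulation 𝒯 Ω) {T : Affine.Triangle ℝ Plane} (hT : T ∈ 𝒯) :
    interior (closedTriangle T) ⊆ Ω := by
  rw [← hΩ.interior_closure]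
  exact interior_mono (h𝒯.triangle_subset hT)

theorem IsRegularTriangulation.inter_cases (h𝒯 : IsRegularTriangulation 𝒯 Ω)
    {T T' : Affine.Triangle ℝ Plane} (hT : T ∈ 𝒯) (hT' : T' ∈ 𝒯) (hne : T ≠ T') :
    closedTriangle T ∩ closedTriangle T' = ∅ ∨
    (∃ i, closedTriangle T ∩ closedTriangle T' = {T.points i}) ∨
    ∃ k k', EdgeMatch T k T' k' ∧ closedTriangle T ∩ closedTriangle T' = edge T k := by
  rcases h𝒯.regular T hT T' hT' hne with h | ⟨i, j, -, h⟩ | ⟨i, i', j, j', hi, h1, h2, h⟩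
  · exact Or.inl h
  · exact Or.inr (Or.inl ⟨i, h⟩)
  · right; right
    have hj : j ≠ j' := by
      rintro rfl
      exact hi (points_inj.1 (h1.trans h2.symm))
    obtain ⟨k, hk⟩ := exists_edge_index hi
    obtain ⟨k', hk'⟩ := exists_edge_index hj
    refine ⟨k, k', ?_, ?_⟩
    · rcases hk with ⟨rfl, rfl⟩ | ⟨rfl, rfl⟩ <;> rcases hk' with ⟨rfl, rfl⟩ | ⟨rfl, rfl⟩ <;>
        simp [EdgeMatch, h1, h2]
    · rw [h]
      rcases hk with ⟨rfl, rfl⟩ | ⟨rfl, rfl⟩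
      · rfl
      · rw [segment_symm]; rfl

/-- A second triangle through a point in the relative interior of an edge shares that edge. -/
theorem IsRegularTriangulation.exists_edgeMatch (h𝒯 : IsRegularTriangulation 𝒯 Ω)
    {T T' : Affine.Triangle ℝ Plane} (hT : T ∈ 𝒯) (hT' : T' ∈ 𝒯) (hne : T ≠ T') {x : Plane}
    {k : Fin 3} (hxe : x ∈ edge T k) (hpos : ∀ j, j ≠ k → 0 < lam T j x)
    (hx' : x ∈ closedTriangle T') : ∃ k', EdgeMatch T k T' k' := by
  have hx : x ∈ closedTriangle T ∩ closedTriangle T' := ⟨edge_subset T k hxe, hx'⟩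
  rcases h𝒯.inter_cases hT hT' hne with h | ⟨i, h⟩ | ⟨l, k', hm, h⟩
  · rw [h] at hx; exact hx.elim
  · rw [h, mem_singleton_iff] at hx
    exfalso
    have h1 := hpos (k + 1) (by clear * -; revert k; decide)
    have h2 := hpos (k + 2) (by clear * -; revert k; decide)
    rw [hx, lam_points] at h1 h2
    split_ifs at h1 h2 with e1 e2 <;> simp at h1 h2
    exact absurd (e1.trans e2.symm) (by clear * -; revert k; decide)
  · rw [h] at hx
    have : l = k := by
      by_contra hlk
      exact (hpos l hlk).ne' (mem_edge.1 hx).2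
    exact ⟨k', this ▸ hm⟩

theorem IsRegularTriangulation.exists_edgeMatch_of_edgeMid (h𝒯 : IsRegularTriangulation 𝒯 Ω)
    {T T' : Affine.Triangle ℝ Plane} (hT : T ∈ 𝒯) (hT' : T' ∈ 𝒯) (hne : T ≠ T')
    {k : Fin 3} (hx' : edgeMid T k ∈ closedTriangle T') : ∃ k', EdgeMatch T k T' k' := by
  refine h𝒯.exists_edgeMatch hT hT' hne (edgeMid_mem_edge T k) (fun j hj => ?_) hx'
  rw [lam_edgeMid, if_neg hj]
  norm_num

theorem IsRegularTriangulation.disjoint_interior (h𝒯 : IsRegularTriangulation 𝒯 Ω)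
    {T T' : Affine.Triangle ℝ Plane} (hT : T ∈ 𝒯) (hT' : T' ∈ 𝒯) (hne : T ≠ T') :
    Disjoint (interior (closedTriangle T)) (interior (closedTriangle T')) := by
  rw [Set.disjoint_left]
  intro x hx hx'
  have hxx : x ∈ closedTriangle T ∩ closedTriangle T' :=
    ⟨interior_subset hx, interior_subset hx'⟩
  rw [mem_interior] at hx
  rcases h𝒯.inter_cases hT hT' hne with h | ⟨i, h⟩ | ⟨k, k', hm, h⟩
  · rw [h] at hxx; exact hxx.elim
  · rw [h, mem_singleton_iff] at hxx
    have := hx (i + 1)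
    rw [hxx, lam_points] at this
    fin_cases i <;> simp at this
  · rw [h] at hxx
    exact (hx k).ne' (mem_edge.1 hxx).2

theorem IsRegularTriangulation.eq_of_mem_interior (h𝒯 : IsRegularTriangulation 𝒯 Ω)
    {T T' : Affine.Triangle ℝ Plane} (hT : T ∈ 𝒯) (hT' : T' ∈ 𝒯) {x : Plane}
    (hx : x ∈ interior (closedTriangle T)) (hx' : x ∈ interior (closedTriangle T')) : T = T' := by
  by_contra hne
  exact Set.disjoint_left.1 (h𝒯.disjoint_interior hT hT' hne) hx hx'

/-- Two triangles with a common edge lie on different sides of it. -/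
theorem IsRegularTriangulation.lam_neg (h𝒯 : IsRegularTriangulation 𝒯 Ω)
    {T T' : Affine.Triangle ℝ Plane} (hT : T ∈ 𝒯) (hT' : T' ∈ 𝒯) (hne : T ≠ T')
    {k k' : Fin 3} (hm : EdgeMatch T k T' k') : lam T' k' (T.points k) < 0 := by
  have h0 : lam T' k' (T.points k) ≠ 0 := by
    intro h
    have := hm.abs_triDet
    rw [h, abs_zero, mul_zero, abs_eq_zero] at this
    exact triDet_ne_zero T this
  by_contra hlt
  have hpos : 0 < lam T' k' (T.points k) := lt_of_le_of_ne (not_lt.1 hlt) h0.symm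
  have hT1 : ∀ s ∈ Ioo (0 : ℝ) 1,
      AffineMap.lineMap (edgeMid T k) (bary T) s ∈ interior (closedTriangle T) := by
    intro s hs
    rw [mem_interior]
    intro j
    rw [lam_lineMap, lam_edgeMid, lam_bary]
    have h1 : 0 < s * (1 / 3 : ℝ) := by have := hs.1; positivity
    have h2 : 0 ≤ (1 - s) * (if j = k then 0 else 1 / 2 : ℝ) := by
      have : 0 ≤ 1 - s := by linarith [hs.2]
      split_ifs <;> positivity
    linarith
  have hT2 : ∀ᶠ s in 𝓝[>] (0 : ℝ), ∀ j, j ≠ k' →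
      0 < lam T' j (AffineMap.lineMap (edgeMid T k) (bary T) s) := by
    rw [eventually_all]
    intro j
    by_cases hj : j = k'
    · exact Eventually.of_forall fun s h => absurd hj h
    have hc : Continuous fun s : ℝ => lam T' j (AffineMap.lineMap (edgeMid T k) (bary T) s) :=
      (continuous_lam T' j).comp (by fun_prop)
    have hlim := hc.tendsto 0
    rw [AffineMap.lineMap_apply_zero, ← hm.edgeMid_eq, lam_edgeMid, if_neg hj] at hlim
    have h2 : (0 : ℝ) < 1 / 2 := by norm_num
    filter_upwards [nhdsWithin_le_nhds (hlim.eventually (lt_mem_nhds h2))]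
      with s hs _ using hm.edgeMid_eq ▸ hs
  obtain ⟨s, hs1, hs2⟩ := (hT2.and (Ioo_mem_nhdsGT (zero_lt_one))).exists
  refine Set.disjoint_left.1 (h𝒯.disjoint_interior hT hT' hne) (hT1 s hs2) ?_
  rw [mem_interior]
  intro j
  by_cases hj : j = k'
  · rw [hj, hm.lam_eq_mul]
    exact mul_pos hpos (mem_interior.1 (hT1 s hs2) k)
  · exact hs1 j hj

/-- The neighbour across an edge is unique. -/
theorem IsRegularTriangulation.edgeMatch_unique (h𝒯 : IsRegularTriangulation 𝒯 Ω)
    {T T₁ T₂ : Affine.Triangle ℝ Plane} (hT : T ∈ 𝒯) (hT₁ : T₁ ∈ 𝒯) (hT₂ : T₂ ∈ 𝒯)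
    (hne₁ : T ≠ T₁) (hne₂ : T ≠ T₂) {k k₁ k₂ : Fin 3} (h₁ : EdgeMatch T k T₁ k₁)
    (h₂ : EdgeMatch T k T₂ k₂) : T₁ = T₂ ∧ k₁ = k₂ := by
  have hTT : T₁ = T₂ := by
    by_contra hne
    have hm := h₁.symm.trans h₂
    have a := h𝒯.lam_neg hT₁ hT₂ hne hm
    have b := h𝒯.lam_neg hT hT₂ hne₂ h₂
    have c := h𝒯.lam_neg hT₁ hT hne₁.symm h₁.symm
    rw [h₂.lam_eq_mul] at a
    exact absurd (mul_pos_of_neg_of_neg b c) (not_lt.2 a.le)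
  refine ⟨hTT, ?_⟩
  subst hTT
  exact edgeMid_inj (h₁.edgeMid_eq.trans h₂.edgeMid_eq.symm)

theorem EdgeMatch.lam_pos {T T' : Affine.Triangle ℝ Plane} {k k' : Fin 3}
    (hm : EdgeMatch T k T' k') {x : Plane} (hxe : x ∈ edge T k)
    (hpos : ∀ j, j ≠ k → 0 < lam T j x) : ∀ j, j ≠ k' → 0 < lam T' j x := by
  have hxe' := hxe
  rw [edge, segment_eq_image_lineMap] at hxe
  obtain ⟨s, -, rfl⟩ := hxe
  have h1 := hpos (k + 1) (by clear * -; revert k; decide)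
  have h2 := hpos (k + 2) (by clear * -; revert k; decide)
  have hk : k + 1 ≠ k + 2 := by clear * -; revert k; decide
  rw [lam_lineMap, lam_points, lam_points] at h1 h2
  simp only [if_true, if_neg hk, if_neg hk.symm] at h1 h2
  intro j hj
  have hj' : j = k' + 1 ∨ j = k' + 2 := by clear * - hj; revert j k'; decide
  have hk' : k' + 1 ≠ k' + 2 := by clear * -; revert k'; decide
  rcases hm with ⟨e1, e2⟩ | ⟨e1, e2⟩ <;> rw [← e1, ← e2, lam_lineMap, lam_points, lam_points] <;>
    rcases hj' with rfl | rfl <;> simp only [if_true, if_neg hk', if_neg hk'.symm] <;> linarith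

/-- Near a point in the relative interior of a common edge, the two triangles are the two half
planes. -/
theorem IsRegularTriangulation.eventually_edge (h𝒯 : IsRegularTriangulation 𝒯 Ω)
    {T T' : Affine.Triangle ℝ Plane} (hT : T ∈ 𝒯) (hT' : T' ∈ 𝒯) (hne : T ≠ T')
    {k k' : Fin 3} (hm : EdgeMatch T k T' k') {x : Plane} (hxe : x ∈ edge T k)
    (hpos : ∀ j, j ≠ k → 0 < lam T j x) :
    ∀ᶠ y in 𝓝 x,
      (0 < lam T k y → y ∈ interior (closedTriangle T)) ∧
      (lam T k y < 0 → y ∈ interior (closedTriangle T')) ∧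
      (lam T k y = 0 → y ∈ closedTriangle T) := by
  have aux : ∀ (S : Affine.Triangle ℝ Plane) (l : Fin 3), (∀ j, j ≠ l → 0 < lam S j x) →
      ∀ᶠ y in 𝓝 x, ∀ j, j ≠ l → 0 < lam S j y := by
    intro S l hS
    rw [eventually_all]
    intro j
    by_cases hj : j = l
    · exact Eventually.of_forall fun s h => absurd hj h
    have hlim := (continuous_lam S j).tendsto x
    filter_upwards [hlim.eventually (lt_mem_nhds (hS j hj))] with y hy _ using hy
  have hneg := h𝒯.lam_neg hT hT' hne hm
  filter_upwards [aux T k hpos, aux T' k' (hm.lam_pos hxe hpos)] with y hy hy'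
  refine ⟨fun h => ?_, fun h => ?_, fun h => ?_⟩
  · rw [mem_interior]
    intro j
    by_cases hj : j = k
    · rwa [hj]
    · exact hy j hj
  · rw [mem_interior]
    intro j
    by_cases hj : j = k'
    · rw [hj, hm.lam_eq_mul]
      exact mul_pos_of_neg_of_neg hneg h
    · exact hy' j hj
  · rw [mem_closedTriangle]
    intro j
    by_cases hj : j = k
    · rw [hj, h]
    · exact (hy j hj).le

theorem lam_edgeMid_pos (T : Affine.Triangle ℝ Plane) (k : Fin 3) :
    ∀ j, j ≠ k → 0 < lam T j (edgeMid T k) := by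
  intro j hj
  rw [lam_edgeMid, if_neg hj]
  norm_num

theorem mem_domain_of_edge (hΩ : IsPolygonalLipschitzDomain Ω) (h𝒯 : IsRegularTriangulation 𝒯 Ω)
    {T T' : Affine.Triangle ℝ Plane} (hT : T ∈ 𝒯) (hT' : T' ∈ 𝒯) (hne : T ≠ T')
    {k k' : Fin 3} (hm : EdgeMatch T k T' k') {x : Plane} (hxe : x ∈ edge T k)
    (hpos : ∀ j, j ≠ k → 0 < lam T j x) : x ∈ Ω := by
  rw [← hΩ.interior_closure, mem_interior_iff_mem_nhds]
  filter_upwards [h𝒯.eventually_edge hT hT' hne hm hxe hpos] with y hy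
  rcases lt_trichotomy (lam T k y) 0 with h | h | h
  · exact h𝒯.triangle_subset hT' (interior_subset (hy.2.1 h))
  · exact h𝒯.triangle_subset hT (hy.2.2 h)
  · exact h𝒯.triangle_subset hT (interior_subset (hy.1 h))

theorem edgeMid_mem_domain (hΩ : IsPolygonalLipschitzDomain Ω) (h𝒯 : IsRegularTriangulation 𝒯 Ω)
    {T T' : Affine.Triangle ℝ Plane} (hT : T ∈ 𝒯) (hT' : T' ∈ 𝒯) (hne : T ≠ T')
    {k k' : Fin 3} (hm : EdgeMatch T k T' k') : edgeMid T k ∈ Ω :=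
  mem_domain_of_edge hΩ h𝒯 hT hT' hne hm (edgeMid_mem_edge T k) (lam_edgeMid_pos T k)

theorem not_edge_subset_frontier (hΩ : IsPolygonalLipschitzDomain Ω)
    (h𝒯 : IsRegularTriangulation 𝒯 Ω)
    {T T' : Affine.Triangle ℝ Plane} (hT : T ∈ 𝒯) (hT' : T' ∈ 𝒯) (hne : T ≠ T')
    {k k' : Fin 3} (hm : EdgeMatch T k T' k') : ¬ edge T k ⊆ frontier Ω := by
  intro h
  have h1 := h (edgeMid_mem_edge T k)
  rw [hΩ.isOpen.frontier_eq] at h1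
  exact h1.2 (edgeMid_mem_domain hΩ h𝒯 hT hT' hne hm)

/-- An edge that is not contained in the boundary belongs to a second triangle. -/
theorem IsRegularTriangulation.exists_neighbour (h𝒯 : IsRegularTriangulation 𝒯 Ω)
    (hΩ : IsPolygonalLipschitzDomain Ω)
    {T : Affine.Triangle ℝ Plane} (hT : T ∈ 𝒯) {k : Fin 3} (he : ¬ edge T k ⊆ frontier Ω) :
    ∃ T' ∈ 𝒯, T ≠ T' ∧ ∃ k', EdgeMatch T k T' k' := by
  obtain ⟨x₀, hx₀, hx₀f⟩ := not_subset.1 he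
  have hx₀Ω : x₀ ∈ Ω := by
    by_contra h
    exact hx₀f (by
      rw [hΩ.isOpen.frontier_eq]
      exact ⟨h𝒯.triangle_subset hT (edge_subset T k hx₀), h⟩)
  -- Move `x₀` into the relative interior of the edge.
  have hc : Continuous fun s : ℝ => AffineMap.lineMap x₀ (edgeMid T k) s := by fun_prop
  have hev : ∀ᶠ s in 𝓝[>] (0 : ℝ), AffineMap.lineMap x₀ (edgeMid T k) s ∈ Ω := by
    have := hc.tendsto 0
    rw [AffineMap.lineMap_apply_zero] at this
    exact nhdsWithin_le_nhds (this.eventually (hΩ.isOpen.mem_nhds hx₀Ω))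
  obtain ⟨s, hsΩ, hs⟩ := (hev.and (Ioo_mem_nhdsGT zero_lt_one)).exists
  set x₁ := AffineMap.lineMap x₀ (edgeMid T k) s with hx₁
  have hk0 : lam T k x₁ = 0 := by
    rw [hx₁, lam_lineMap, (mem_edge.1 hx₀).2, lam_edgeMid, if_pos rfl]; simp
  have hj : ∀ j, j ≠ k → 0 < lam T j x₁ := by
    intro j hj
    rw [hx₁, lam_lineMap, lam_edgeMid, if_neg hj]
    have h1 := mem_closedTriangle.1 (edge_subset T k hx₀) j
    have h2 : 0 ≤ (1 - s) * lam T j x₀ := mul_nonneg (by linarith [hs.2]) h1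
    have h3 : 0 < s * (1 / 2 : ℝ) := by have := hs.1; positivity
    linarith
  have hx₁e : x₁ ∈ edge T k := by
    rw [mem_edge, mem_closedTriangle]
    refine ⟨fun j => ?_, hk0⟩
    by_cases h : j = k
    · rw [h, hk0]
    · exact (hj j h).le
  -- Approach `x₁` from the other side of the edge.
  have hlim : Tendsto (fun t : ℝ => x₁ + (-t) • gradLam T k) (𝓝[>] 0) (𝓝 x₁) := by
    have : Continuous (fun t : ℝ => x₁ + (-t) • gradLam T k) := by fun_prop
    have h := this.tendsto 0
    simp only [neg_zero, zero_smul, add_zero] at h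
    exact h.mono_left nhdsWithin_le_nhds
  have hfreq : ∃ᶠ t in 𝓝[>] (0 : ℝ), ∃ T' ∈ 𝒯,
      x₁ + (-t) • gradLam T k ∈ closedTriangle T' ∧ 0 < t := by
    refine (((hlim.eventually (hΩ.isOpen.mem_nhds hsΩ)).and self_mem_nhdsWithin).mono ?_).frequently
    rintro t ⟨ht, ht0⟩
    obtain ⟨T', hT', h⟩ := h𝒯.exists_mem (subset_closure ht)
    exact ⟨T', hT', h, ht0⟩
  have hfreq' : ∃ T' ∈ 𝒯, ∃ᶠ t in 𝓝[>] (0 : ℝ),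
      x₁ + (-t) • gradLam T k ∈ closedTriangle T' ∧ 0 < t := by
    by_contra hcon
    push Not at hcon
    have : ∀ᶠ t in 𝓝[>] (0 : ℝ), ∀ T' ∈ 𝒯,
        ¬ (x₁ + (-t) • gradLam T k ∈ closedTriangle T' ∧ 0 < t) := by
      rw [Filter.eventually_all_finset]
      intro T' hT'
      filter_upwards [hcon T' hT'] with t ht h
      exact absurd h.2 (not_lt.2 (ht h.1))
    exact hfreq (this.mono fun t ht ⟨T', hT', h⟩ => ht T' hT' h)
  obtain ⟨T', hT', hfr⟩ := hfreq'
  have hx₁T' : x₁ ∈ closedTriangle T' :=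
    (isClosed_closedTriangle T').mem_of_frequently_of_tendsto (hfr.mono fun t ht => ht.1) hlim
  have hne : T ≠ T' := by
    rintro rfl
    obtain ⟨t, ht, ht0⟩ := hfr.exists
    have h1 := mem_closedTriangle.1 ht k
    rw [lam_add_smul, hk0, real_inner_self_eq_norm_sq] at h1
    have h2 : 0 < t * ‖gradLam T k‖ ^ 2 :=
      mul_pos ht0 (pow_pos (norm_pos_iff.2 (gradLam_ne_zero T k)) 2)
    linarith
  exact ⟨T', hT', hne, h𝒯.exists_edgeMatch hT hT' hne hx₁e hj hx₁T'⟩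

/-- Near a point there are only triangles containing that point. -/
theorem eventually_mem_imp_mem (𝒯 : Finset (Affine.Triangle ℝ Plane)) (x : Plane) :
    ∀ᶠ y in 𝓝 x, ∀ T ∈ 𝒯, y ∈ closedTriangle T → x ∈ closedTriangle T := by
  rw [Filter.eventually_all_finset]
  intro T _
  by_cases hx : x ∈ closedTriangle T
  · exact Eventually.of_forall fun _ _ => hx
  · filter_upwards [(isClosed_closedTriangle T).isOpen_compl.mem_nhds hx] with y hy h
    exact absurd h hy

theorem isPreconnected_ball_diff_center (x : Plane) (r : ℝ) (hr : 0 < r) :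
    IsPreconnected (Metric.ball x r \ {x}) := by
  have h1 : IsPreconnected ({0}ᶜ : Set Plane) :=
    (isConnected_compl_singleton_of_one_lt_rank (by
      rw [← Module.finrank_eq_rank]; simp) 0).isPreconnected
  have h2 : OpenPartialHomeomorph.univBall x r '' {0}ᶜ = Metric.ball x r \ {x} := by
    have hinj : InjOn (OpenPartialHomeomorph.univBall x r) univ := by
      have := (OpenPartialHomeomorph.univBall x r).injOn
      rwa [OpenPartialHomeomorph.univBall_source] at this
    have himg : OpenPartialHomeomorph.univBall x r '' univ = Metric.ball x r := by
      have := (OpenPartialHomeomorph.univBall x r).image_source_eq_target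
      rwa [OpenPartialHomeomorph.univBall_source,
        OpenPartialHomeomorph.univBall_target x hr] at this
    rw [compl_eq_univ_sdiff, hinj.image_sdiff, himg]
    simp
  rw [← h2]
  exact h1.image _ (OpenPartialHomeomorph.continuous_univBall x r).continuousOn

theorem exists_vertex_or_interior_or_edge {T : Affine.Triangle ℝ Plane} {x : Plane}
    (hx : x ∈ closedTriangle T) :
    (∃ i, x = T.points i) ∨ x ∈ interior (closedTriangle T) ∨
      ∃ k, x ∈ edge T k ∧ ∀ j, j ≠ k → 0 < lam T j x := by
  by_cases hint : x ∈ interior (closedTriangle T)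
  · exact Or.inr (Or.inl hint)
  rw [mem_interior] at hint
  push Not at hint
  obtain ⟨k, hk⟩ := hint
  have hx' := mem_closedTriangle.1 hx
  have hk0 : lam T k x = 0 := le_antisymm hk (hx' k)
  by_cases hall : ∀ j, j ≠ k → 0 < lam T j x
  · exact Or.inr (Or.inr ⟨k, mem_edge.2 ⟨hx, hk0⟩, hall⟩)
  left
  push Not at hall
  obtain ⟨j, hjk, hj⟩ := hall
  have hj0 : lam T j x = 0 := le_antisymm hj (hx' j)
  have hs := sum_lam T x
  obtain ⟨i, hik, hij⟩ : ∃ i, i ≠ k ∧ i ≠ j := by clear * -; revert k j; decide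
  refine ⟨i, ext_lam T fun l => ?_⟩
  rw [lam_points]
  fin_cases i <;> fin_cases j <;> fin_cases k <;> fin_cases l <;> simp_all

theorem eq_of_locally_eq {s : Set Plane} (hs : IsPreconnected s) (f : Plane → ℝ)
    (hf : ∀ x ∈ s, ∀ᶠ y in 𝓝[s] x, f y = f x) {x y : Plane} (hx : x ∈ s) (hy : y ∈ s) :
    f x = f y := by
  have := isPreconnected_iff_preconnectedSpace.1 hs
  have : IsLocallyConstant (fun z : s => f z) := by
    rw [IsLocallyConstant.iff_eventually_eq]
    rintro ⟨z, hz⟩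
    exact eventually_nhds_subtype_iff s ⟨z, hz⟩ (fun y => f y = f z) |>.2 (hf z hz)
  exact IsLocallyConstant.iff_is_const.1 this ⟨x, hx⟩ ⟨y, hy⟩

/-- Values attached to the triangles that agree across interior edges are all equal. -/
theorem IsRegularTriangulation.eq_const_of_edgeMatch (hΩ : IsPolygonalLipschitzDomain Ω)
    (h𝒯 : IsRegularTriangulation 𝒯 Ω) (c : Affine.Triangle ℝ Plane → ℝ)
    (hc : ∀ T ∈ 𝒯, ∀ T' ∈ 𝒯, T ≠ T' → ∀ k k', EdgeMatch T k T' k' → c T = c T') :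
    ∃ C, ∀ T ∈ 𝒯, c T = C := by
  classical
  set F : Set Plane := ⋃ T ∈ 𝒯, range T.points with hF
  have hFfin : F.Finite := 𝒯.finite_toSet.biUnion fun T _ => finite_range _
  have hτe : ∀ z, ∃ T, z ∈ Ω → T ∈ 𝒯 ∧ z ∈ closedTriangle T := by
    intro z
    by_cases hz : z ∈ Ω
    · obtain ⟨T, hT, h⟩ := h𝒯.exists_mem (_root_.subset_closure hz)
      exact ⟨T, fun _ => ⟨hT, h⟩⟩
    · obtain ⟨w, hw⟩ := hΩ.isConnected.nonempty
      obtain ⟨T, -, -⟩ := h𝒯.exists_mem (_root_.subset_closure hw)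
      exact ⟨T, fun h => absurd h hz⟩
  choose τ hτ' using hτe
  have hτ𝒯 : ∀ z ∈ Ω, τ z ∈ 𝒯 := fun z hz => (hτ' z hz).1
  have hτ : ∀ z ∈ Ω, z ∈ closedTriangle (τ z) := fun z hz => (hτ' z hz).2
  -- Away from the vertices, the triangles through a point carry the same value.
  have hstep : ∀ x ∈ Ω, x ∉ F → ∀ T ∈ 𝒯, ∀ T' ∈ 𝒯, x ∈ closedTriangle T → x ∈ closedTriangle T' →
      c T = c T' := by
    intro x hxΩ hxF T hT T' hT' hx hx'
    by_cases hne : T = T'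
    · rw [hne]
    have hxx : x ∈ closedTriangle T ∩ closedTriangle T' := ⟨hx, hx'⟩
    rcases h𝒯.inter_cases hT hT' hne with h | ⟨i, h⟩ | ⟨k, k', hm, h⟩
    · rw [h] at hxx; exact hxx.elim
    · rw [h, mem_singleton_iff] at hxx
      exact absurd (mem_biUnion (x := T) hT (by rw [hxx]; exact mem_range_self i)) hxF
    · exact hc T hT T' hT' hne k k' hm
  -- Removing a vertex does not disconnect a small disc around it.
  have hall : ∀ x ∈ Ω, ∀ T ∈ 𝒯, ∀ T' ∈ 𝒯, x ∈ closedTriangle T → x ∈ closedTriangle T' →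
      c T = c T' := by
    intro x hxΩ T hT T' hT' hx hx'
    have hev : ∀ᶠ y in 𝓝 x, y ∈ Ω ∧ y ∉ F \ {x} := by
      refine Filter.Eventually.and (hΩ.isOpen.mem_nhds hxΩ) ?_
      exact (hFfin.subset sdiff_subset).isClosed.isOpen_compl.mem_nhds (by simp)
    obtain ⟨r, hr, hball⟩ := Metric.eventually_nhds_iff_ball.1 hev
    have hpre := isPreconnected_ball_diff_center x r hr
    have hpunct : ∀ S ∈ 𝒯, x ∈ closedTriangle S →
        ∃ y ∈ Metric.ball x r \ {x}, y ∈ closedTriangle S := by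
      intro S hS hxS
      have hb : x ∈ closure (interior (closedTriangle S)) := by rwa [closure_interior]
      obtain ⟨y, ⟨hy, hyS⟩⟩ : (Metric.ball x r ∩ (interior (closedTriangle S) \ {x})).Nonempty := by
        have h1 : (Metric.ball x r ∩ interior (closedTriangle S)).Nonempty :=
          mem_closure_iff.1 hb _ Metric.isOpen_ball (Metric.mem_ball_self hr)
        have h2 : IsOpen (Metric.ball x r ∩ interior (closedTriangle S)) :=
          Metric.isOpen_ball.inter isOpen_interior
        obtain ⟨z, hz⟩ := h1
        by_cases hzx : z = x
        · rw [hzx] at hz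
          have := (h2.mem_nhds hz)
          have h3 := (nhdsWithin_le_nhds (s := {x}ᶜ) this)
          obtain ⟨w, hw, hwx⟩ := (Filter.Eventually.and h3 self_mem_nhdsWithin).exists
          exact ⟨w, hw.1, hw.2, hwx⟩
        · exact ⟨z, hz.1, hz.2, hzx⟩
      exact ⟨y, ⟨hy, hyS.2⟩, interior_subset hyS.1⟩
    obtain ⟨y, hy, hyT⟩ := hpunct T hT hx
    obtain ⟨y', hy', hyT'⟩ := hpunct T' hT' hx'
    have hmemΩ : ∀ z ∈ Metric.ball x r \ {x}, z ∈ Ω ∧ z ∉ F := fun z hz =>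
      ⟨(hball z hz.1).1, fun hzF => (hball z hz.1).2 ⟨hzF, hz.2⟩⟩
    have hconst : c (τ y) = c (τ y') := by
      refine eq_of_locally_eq hpre (fun z => c (τ z)) (fun z hz => ?_) hy hy'
      filter_upwards [nhdsWithin_le_nhds (eventually_mem_imp_mem 𝒯 z), self_mem_nhdsWithin]
        with w hw hw'
      have hwΩ := (hmemΩ w hw').1
      have hzΩ := (hmemΩ z hz).1
      exact hstep z hzΩ (hmemΩ z hz).2 _ (hτ𝒯 w hwΩ) _ (hτ𝒯 z hzΩ)
        (hw _ (hτ𝒯 w hwΩ) (hτ w hwΩ)) (hτ z hzΩ)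
    have e1 := hstep y (hmemΩ y hy).1 (hmemΩ y hy).2 T hT _ (hτ𝒯 y (hmemΩ y hy).1) hyT
      (hτ y (hmemΩ y hy).1)
    have e2 := hstep y' (hmemΩ y' hy').1 (hmemΩ y' hy').2 T' hT' _ (hτ𝒯 y' (hmemΩ y' hy').1) hyT'
      (hτ y' (hmemΩ y' hy').1)
    rw [e1, e2, hconst]
  obtain ⟨x₀, hx₀⟩ := hΩ.isConnected.nonempty
  refine ⟨c (τ x₀), fun T hT => ?_⟩
  have hb := interior_subset_domain hΩ h𝒯 hT (bary_mem T)
  have hconst : c (τ (bary T)) = c (τ x₀) := by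
    refine eq_of_locally_eq hΩ.isConnected.isPreconnected (fun z => c (τ z)) (fun z hz => ?_) hb hx₀
    filter_upwards [nhdsWithin_le_nhds (eventually_mem_imp_mem 𝒯 z), self_mem_nhdsWithin]
      with w hw hw'
    exact hall z hz _ (hτ𝒯 w hw') _ (hτ𝒯 z hz) (hw _ (hτ𝒯 w hw') (hτ w hw')) (hτ z hz)
  rw [← hconst]
  exact hall _ hb T hT _ (hτ𝒯 _ hb) (interior_subset (bary_mem T)) (hτ _ hb)

/-- Every triangulation has a boundary edge. -/
theorem IsRegularTriangulation.exists_boundary_edge (hΩ : IsPolygonalLipschitzDomain Ω)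
    (h𝒯 : IsRegularTriangulation 𝒯 Ω) : ∃ T ∈ 𝒯, ∃ k, edge T k ⊆ frontier Ω := by
  set F : Set Plane := ⋃ T ∈ 𝒯, range T.points with hF
  have hFfin : F.Finite := 𝒯.finite_toSet.biUnion fun T _ => finite_range _
  have hconn : IsPreconnected Fᶜ := (hFfin.countable.isConnected_compl_of_one_lt_rank (by
      rw [← Module.finrank_eq_rank]; simp)).isPreconnected
  have hin : (Fᶜ ∩ Ω).Nonempty := by
    by_contra h
    rw [not_nonempty_iff_eq_empty, ← disjoint_iff_inter_eq_empty,
      disjoint_compl_left_iff_subset] at h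
    obtain ⟨x, hx⟩ := hΩ.isConnected.nonempty
    exact (infinite_of_mem_nhds x (hΩ.isOpen.mem_nhds hx)) (hFfin.subset h)
  have hout : (Fᶜ ∩ Ωᶜ).Nonempty := by
    by_contra h
    rw [not_nonempty_iff_eq_empty, ← compl_union, compl_empty_iff] at h
    have hb : Bornology.IsBounded (univ : Set Plane) := by
      rw [← h]; exact hFfin.isBounded.union hΩ.isBounded
    exact NormedSpace.unbounded_univ ℝ Plane hb
  obtain ⟨x, hxF, hxf⟩ : (Fᶜ ∩ frontier Ω).Nonempty := by
    by_contra h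
    obtain ⟨z, hzF, hz⟩ := hconn Ω (closure Ω)ᶜ hΩ.isOpen isClosed_closure.isOpen_compl
      (fun z hz => by
        by_cases hzc : z ∈ closure Ω
        · left
          by_contra hzΩ
          exact h ⟨z, hz, by rw [hΩ.isOpen.frontier_eq]; exact ⟨hzc, hzΩ⟩⟩
        · exact Or.inr hzc)
      hin (by
        obtain ⟨z, hz, hzΩ⟩ := hout
        refine ⟨z, hz, fun hzc => h ⟨z, hz, ?_⟩⟩
        rw [hΩ.isOpen.frontier_eq]
        exact ⟨hzc, hzΩ⟩)
    exact hz.2 (_root_.subset_closure hz.1)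
  obtain ⟨T, hT, hx⟩ := h𝒯.exists_mem (frontier_subset_closure hxf)
  have hxΩ : x ∉ Ω := by
    rw [hΩ.isOpen.frontier_eq] at hxf; exact hxf.2
  rcases exists_vertex_or_interior_or_edge hx with ⟨i, h⟩ | h | ⟨k, hk, hpos⟩
  · exact absurd (mem_biUnion (x := T) hT (by rw [h]; exact mem_range_self i)) hxF
  · exact absurd (interior_subset_domain hΩ h𝒯 hT h) hxΩ
  · refine ⟨T, hT, k, ?_⟩
    by_contra hnot
    obtain ⟨T', hT', hne, k', hm⟩ := h𝒯.exists_neighbour hΩ hT hnot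
    exact hxΩ (mem_domain_of_edge hΩ h𝒯 hT hT' hne hm hk hpos)

end

/-! ### Integration over triangles -/

/-- The area of a triangle. -/
noncomputable def area (T : Affine.Triangle ℝ Plane) : ℝ :=
  volume.real (interior (closedTriangle T))

theorem area_pos (T : Affine.Triangle ℝ Plane) : 0 < area T := by
  refine ENNReal.toReal_pos ?_ ?_
  · exact (isOpen_interior.measure_pos volume ⟨_, bary_mem T⟩).ne'
  · exact ((measure_mono interior_subset).trans_lt (isCompact_closedTriangle T).measure_lt_top).ne

theorem cross_map (L : Plane →L[ℝ] Plane) (u w : Plane) :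
    cross (L u) (L w) = L.det * cross u w := by
  have hb : ∀ v : Plane, v = v 0 • EuclideanSpace.single 0 1 + v 1 • EuclideanSpace.single 1 1 := by
    intro v
    ext i
    fin_cases i <;> simp
  have hdet : L.det = L (EuclideanSpace.single 0 1) 0 * L (EuclideanSpace.single 1 1) 1 -
      L (EuclideanSpace.single 1 1) 0 * L (EuclideanSpace.single 0 1) 1 := by
    rw [ContinuousLinearMap.det,
      ← LinearMap.det_toMatrix (EuclideanSpace.basisFun (Fin 2) ℝ).toBasis, Matrix.det_fin_two]
    simp [LinearMap.toMatrix_apply]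
  have hL : ∀ (v : Plane) (i : Fin 2), L v i = v 0 * L (EuclideanSpace.single 0 1) i +
      v 1 * L (EuclideanSpace.single 1 1) i := by
    intro v i
    conv_lhs => rw [hb v]
    simp
  rw [hdet, cross, cross, hL u 0, hL u 1, hL w 0, hL w 1]
  ring

/-- The linear part of the affine map sending the vertices of `T` to those of `T'`. -/
noncomputable def triMapLin (T T' : Affine.Triangle ℝ Plane) : Plane →L[ℝ] Plane :=
  ∑ k, (innerSL ℝ (gradLam T k)).smulRight (T'.points k)

/-- The affine map sending the vertices of `T` to those of `T'`. -/
noncomputable def triMap (T T' : Affine.Triangle ℝ Plane) (x : Plane) : Plane :=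
  triMapLin T T' x + ∑ k, lam T k 0 • T'.points k

theorem triMap_eq (T T' : Affine.Triangle ℝ Plane) (x : Plane) :
    triMap T T' x =
      lam T 0 x • T'.points 0 + lam T 1 x • T'.points 1 + lam T 2 x • T'.points 2 := by
  rw [lam_eq T 0 x, lam_eq T 1 x, lam_eq T 2 x]
  simp [triMap, triMapLin, Fin.sum_univ_three]
  module

theorem lam_triMap (T T' : Affine.Triangle ℝ Plane) (k : Fin 3) (x : Plane) :
    lam T' k (triMap T T' x) = lam T k x := by
  have hs := sum_lam T x
  have h : ∀ j, lam T' k (T'.points j) = ⟪gradLam T' k, T'.points j⟫_ℝ + lam T' k 0 :=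
    fun j => lam_eq T' k _
  rw [lam_eq, triMap_eq]
  simp only [inner_add_right, inner_smul_right]
  have h0 := h 0
  have h1 := h 1
  have h2 := h 2
  rw [lam_points] at h0 h1 h2
  have e : ∀ j, ⟪gradLam T' k, T'.points j⟫_ℝ = (if k = j then 1 else 0) - lam T' k 0 := by
    intro j
    have := h j
    rw [lam_points] at this
    linarith
  rw [e 0, e 1, e 2]
  fin_cases k <;> simp <;> linear_combination (-lam T' _ 0) * hs

theorem triMap_triMap (T T' : Affine.Triangle ℝ Plane) (x : Plane) :
    triMap T' T (triMap T T' x) = x :=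
  ext_lam T fun k => by rw [lam_triMap, lam_triMap]

theorem image_triMap (T T' : Affine.Triangle ℝ Plane) :
    triMap T T' '' interior (closedTriangle T) = interior (closedTriangle T') := by
  ext y
  constructor
  · rintro ⟨x, hx, rfl⟩
    rw [mem_interior] at hx ⊢
    intro k
    rw [lam_triMap]
    exact hx k
  · intro hy
    refine ⟨triMap T' T y, ?_, triMap_triMap T' T y⟩
    rw [mem_interior] at hy ⊢
    intro k
    rw [lam_triMap]
    exact hy k

theorem integral_triMap (T T' : Affine.Triangle ℝ Plane) (g : Plane → ℝ) :
    ∫ x in interior (closedTriangle T'), g x =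
      |(triMapLin T T').det| * ∫ x in interior (closedTriangle T), g (triMap T T' x) := by
  rw [← image_triMap T T', integral_image_eq_integral_abs_det_fderiv_smul volume
    isOpen_interior.measurableSet (f := triMap T T') (f' := fun _ => triMapLin T T')]
  · simp only [smul_eq_mul]
    rw [integral_const_mul]
  · intro x _
    exact ((triMapLin T T').hasFDerivAt.add_const _).hasFDerivWithinAt
  · intro x _ y _ h
    rw [← triMap_triMap T T' x, h, triMap_triMap]

theorem area_triMap (T T' : Affine.Triangle ℝ Plane) :
    area T' = |(triMapLin T T').det| * area T := by
  have := integral_triMap T T' (fun _ => 1)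
  simpa [area] using this

theorem area_mul_abs_triDet (T T' : Affine.Triangle ℝ Plane) :
    area T' * |triDet T| = area T * |triDet T'| := by
  have hp : ∀ j, triMap T T' (T.points j) = T'.points j := by
    intro j
    apply ext_lam T'
    intro k
    rw [lam_triMap, lam_points, lam_points]
  have hd : ∀ x y, triMapLin T T' (x - y) = triMap T T' x - triMap T T' y := by
    intro x y
    simp [triMap]
  have : triDet T' = (triMapLin T T').det * triDet T := by
    rw [triDet, triDet, ← cross_map, hd, hd, hp, hp, hp]
  rw [area_triMap T T', this, abs_mul]
  ring

theorem integrableOn_interior (T : Affine.Triangle ℝ Plane) {g : Plane → ℝ} (hg : Continuous g) :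
    IntegrableOn g (interior (closedTriangle T)) :=
  (hg.continuousOn.integrableOn_compact (isCompact_closedTriangle T)).mono_set interior_subset

/-- The integrals of the barycentric coordinates agree, by symmetry. -/
theorem integral_lam_eq (T : Affine.Triangle ℝ Plane) (e : Fin 3 ≃ Fin 3) (k : Fin 3) :
    ∫ x in interior (closedTriangle T), lam T (e k) x =
      ∫ x in interior (closedTriangle T), lam T k x := by
  -- Relabelling the vertices gives an affine self-map of the triangle.
  set T' : Affine.Triangle ℝ Plane := T.reindex e with hT'
  have hp : ∀ j, T'.points (e j) = T.points j := by
    intro j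
    simp [hT', Affine.Simplex.reindex]
  have hc : closedTriangle T' = closedTriangle T := by
    rw [closedTriangle, closedTriangle]
    congr 1
    ext x
    constructor
    · rintro ⟨j, rfl⟩
      exact ⟨e.symm j, by rw [← hp, e.apply_symm_apply]⟩
    · rintro ⟨j, rfl⟩
      exact ⟨e j, hp j⟩
  have hlam : ∀ x j, lam T' (e j) x = lam T j x := by
    intro x j
    have h1 := affine_eq_sum_lam T (gradLam T' (e j)) x (lam T' (e j) 0)
    simp only [← lam_eq] at h1
    rw [h1, ← hp 0, ← hp 1, ← hp 2, lam_points, lam_points, lam_points]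
    fin_cases j <;> simp
  have hd : |(triMapLin T T').det| = 1 := by
    have h := area_triMap T T'
    have h' : area T' = area T := by rw [area, area, hc]
    rw [h'] at h
    have hpos := area_pos T
    exact mul_right_cancel₀ hpos.ne' (by linarith)
  have h := integral_triMap T T' (fun x => lam T' (e k) x)
  rw [hd, one_mul, hc] at h
  simp only [lam_triMap] at h
  simp only [hlam] at h
  exact h.symm

theorem integral_lam (T : Affine.Triangle ℝ Plane) (k : Fin 3) :
    ∫ x in interior (closedTriangle T), lam T k x = area T / 3 := by
  have hi := fun j => integrableOn_interior T (continuous_lam T j)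
  have hsum : (∫ x in interior (closedTriangle T), lam T 0 x) +
      (∫ x in interior (closedTriangle T), lam T 1 x) +
      (∫ x in interior (closedTriangle T), lam T 2 x) = area T := by
    rw [← integral_add (hi 0) (hi 1)]
    refine (integral_add ((hi 0).add (hi 1)) (hi 2)).symm.trans ?_
    simp only [Pi.add_apply, sum_lam]
    simp [area]
  have h1 := integral_lam_eq T (Equiv.swap k 0) 0
  have h2 := integral_lam_eq T (Equiv.swap k 1) 1
  have h3 := integral_lam_eq T (Equiv.swap k 2) 2
  rw [Equiv.swap_apply_right] at h1 h2 h3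
  linarith

/-- Affine functions are integrated exactly by the barycentre rule. -/
theorem integral_affine (T : Affine.Triangle ℝ Plane) (a : Plane) (c : ℝ) :
    ∫ x in interior (closedTriangle T), (⟪a, x⟫_ℝ + c) = area T * (⟪a, bary T⟫_ℝ + c) := by
  have hi := fun j (r : ℝ) => (integrableOn_interior T (continuous_lam T j)).mul_const r
  rw [affine_eq_sum_lam T a (bary T) c, lam_bary, lam_bary, lam_bary]
  have h3 := integral_add ((hi 0 (⟪a, T.points 0⟫_ℝ + c)).add (hi 1 (⟪a, T.points 1⟫_ℝ + c)))
    (hi 2 (⟪a, T.points 2⟫_ℝ + c))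
  have h2 := integral_add (hi 0 (⟪a, T.points 0⟫_ℝ + c)) (hi 1 (⟪a, T.points 1⟫_ℝ + c))
  simp only [Pi.add_apply] at h3
  rw [setIntegral_congr_fun isOpen_interior.measurableSet
    (fun x _ => affine_eq_sum_lam T a x c), h3, h2]
  simp only [integral_mul_const, integral_lam]
  ring

section
variable {Ω : Set Plane} {𝒯 : Finset (Affine.Triangle ℝ Plane)}

theorem mem_openPieces {x : Plane} :
    x ∈ openPieces 𝒯 ↔ ∃ T ∈ 𝒯, x ∈ interior (closedTriangle T) := by
  simp [openPieces]

theorem isOpen_openPieces (𝒯 : Finset (Affine.Triangle ℝ Plane)) : IsOpen (openPieces 𝒯) :=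
  isOpen_biUnion fun _ _ => isOpen_interior

theorem openPieces_subset (hΩ : IsPolygonalLipschitzDomain Ω) (h𝒯 : IsRegularTriangulation 𝒯 Ω) :
    openPieces 𝒯 ⊆ Ω :=
  iUnion₂_subset fun _ hT => interior_subset_domain hΩ h𝒯 hT

/-- Up to a null set, the domain is the union of the open triangles. -/
theorem ae_eq_openPieces (hΩ : IsPolygonalLipschitzDomain Ω) (h𝒯 : IsRegularTriangulation 𝒯 Ω) :
    (Ω : Set Plane) =ᵐ[volume] openPieces 𝒯 := by
  refine (Filter.EventuallyLE.antisymm (LE.le.eventuallyLE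
    (openPieces_subset hΩ h𝒯)) ?_).symm
  have h0 : volume (⋃ T ∈ 𝒯, frontier (closedTriangle T)) = 0 := by
    refine (measure_biUnion_null_iff 𝒯.countable_toSet).2 ?_
    exact fun T _ => (convex_closedTriangle T).addHaar_frontier volume
  rw [ae_le_set]
  refine measure_mono_null (fun x hx => ?_) h0
  obtain ⟨T, hT, hxT⟩ := h𝒯.exists_mem (_root_.subset_closure hx.1)
  refine mem_biUnion (x := T) hT ?_
  rw [(isClosed_closedTriangle T).frontier_eq]
  exact ⟨hxT, fun h => hx.2 (mem_openPieces.2 ⟨T, hT, h⟩)⟩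

theorem restrict_eq_openPieces (hΩ : IsPolygonalLipschitzDomain Ω)
    (h𝒯 : IsRegularTriangulation 𝒯 Ω) :
    volume.restrict Ω = volume.restrict (openPieces 𝒯) :=
  Measure.restrict_congr_set (ae_eq_openPieces hΩ h𝒯)

theorem ae_mem_openPieces (hΩ : IsPolygonalLipschitzDomain Ω)
    (h𝒯 : IsRegularTriangulation 𝒯 Ω) : ∀ᵐ x ∂(volume.restrict Ω), x ∈ openPieces 𝒯 := by
  rw [restrict_eq_openPieces hΩ h𝒯]
  exact ae_restrict_mem (isOpen_openPieces 𝒯).measurableSet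

theorem integral_eq_sum (hΩ : IsPolygonalLipschitzDomain Ω) (h𝒯 : IsRegularTriangulation 𝒯 Ω)
    (F : Plane → ℝ) (hF : ∀ T ∈ 𝒯, IntegrableOn F (interior (closedTriangle T))) :
    ∫ x in Ω, F x = ∑ T ∈ 𝒯, ∫ x in interior (closedTriangle T), F x := by
  rw [restrict_eq_openPieces hΩ h𝒯, openPieces]
  exact integral_biUnion_finset 𝒯 (fun T _ => isOpen_interior.measurableSet)
    (fun T hT T' hT' hne => h𝒯.disjoint_interior hT hT' hne) hF

/-- The integral of a function which is affine on each open triangle. -/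
theorem integral_piecewise_affine (hΩ : IsPolygonalLipschitzDomain Ω)
    (h𝒯 : IsRegularTriangulation 𝒯 Ω) (F : Plane → ℝ) (a : Affine.Triangle ℝ Plane → Plane)
    (c : Affine.Triangle ℝ Plane → ℝ)
    (hF : ∀ T ∈ 𝒯, ∀ x ∈ interior (closedTriangle T), F x = ⟪a T, x⟫_ℝ + c T) :
    ∫ x in Ω, F x = ∑ T ∈ 𝒯, area T * (⟪a T, bary T⟫_ℝ + c T) := by
  rw [integral_eq_sum hΩ h𝒯]
  · refine Finset.sum_congr rfl fun T hT => ?_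
    rw [← integral_affine, setIntegral_congr_fun isOpen_interior.measurableSet (hF T hT)]
  · intro T hT
    refine (integrableOn_congr_fun (hF T hT) isOpen_interior.measurableSet).2 ?_
    exact integrableOn_interior T (by fun_prop)

theorem integral_piecewise_const (hΩ : IsPolygonalLipschitzDomain Ω)
    (h𝒯 : IsRegularTriangulation 𝒯 Ω) (F : Plane → ℝ) (c : Affine.Triangle ℝ Plane → ℝ)
    (hF : ∀ T ∈ 𝒯, ∀ x ∈ interior (closedTriangle T), F x = c T) :
    ∫ x in Ω, F x = ∑ T ∈ 𝒯, area T * c T := by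
  rw [integral_piecewise_affine hΩ h𝒯 F (fun _ => 0) c (fun T hT x hx => by simp [hF T hT x hx])]
  simp

theorem ae_of_forall_pieces (hΩ : IsPolygonalLipschitzDomain Ω)
    (h𝒯 : IsRegularTriangulation 𝒯 Ω) {p : Plane → Prop}
    (h : ∀ T ∈ 𝒯, ∀ᵐ x, x ∈ interior (closedTriangle T) → p x) :
    ∀ᵐ x ∂(volume.restrict Ω), p x := by
  have h' : ∀ᵐ x, ∀ T ∈ 𝒯, x ∈ interior (closedTriangle T) → p x :=
    (ae_ball_iff 𝒯.countable_toSet).2 h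
  filter_upwards [ae_mem_openPieces hΩ h𝒯, ae_restrict_of_ae h'] with x hx hx'
  obtain ⟨T, hT, hxT⟩ := mem_openPieces.1 hx
  exact hx' T hT hxT

end

/-! ### Integration by parts on half planes -/

theorem gradient_apply (ψ : Plane → ℝ) (x : Plane) (i : Fin 2) :
    gradient ψ x i = fderiv ℝ ψ x (EuclideanSpace.single i 1) := by
  rw [← inner_gradient_left, EuclideanSpace.inner_single_right]
  simp

theorem gradient_eq_zero_of_notMem_tsupport {ψ : Plane → ℝ} {x : Plane} (hx : x ∉ tsupport ψ) :
    gradient ψ x = 0 := by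
  have : fderiv ℝ ψ x = 0 := by
    by_contra h
    exact hx (support_fderiv_subset ℝ h)
  rw [gradient, this, map_zero]

theorem continuous_gradient {ψ : Plane → ℝ} (hψ : ContDiff ℝ 1 ψ) : Continuous (gradient ψ) := by
  have : Continuous (fderiv ℝ ψ) := hψ.continuous_fderiv one_ne_zero
  exact (InnerProductSpace.toDual ℝ Plane).symm.continuous.comp this

theorem hasCompactSupport_gradient {ψ : Plane → ℝ} (hψ : HasCompactSupport ψ) :
    HasCompactSupport (gradient ψ) :=
  hψ.mono' fun x hx => by
    by_contra h
    exact hx (gradient_eq_zero_of_notMem_tsupport h)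

/-- The integral of a directional derivative of a compactly supported function vanishes. -/
theorem integral_lineDeriv_eq_zero {F : Plane → ℝ} {C : NNReal} (hF : LipschitzWith C F)
    (hFc : HasCompactSupport F) (v : Plane) : ∫ x, lineDeriv ℝ F x v = 0 := by
  have h := LipschitzWith.integral_lineDeriv_mul_eq (μ := volume)
    (LipschitzWith.const (1 : ℝ) : LipschitzWith 0 fun _ : Plane => (1 : ℝ)) hF hFc (-v)
  simp only [neg_neg, mul_one] at h
  rw [← h]
  simp [lineDeriv]

theorem integral_fderiv_eq_zero {F : Plane → ℝ} (hF : ContDiff ℝ 1 F)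
    (hFc : HasCompactSupport F) (v : Plane) : ∫ x, fderiv ℝ F x v = 0 := by
  obtain ⟨C, hC⟩ := ContDiff.lipschitzWith_of_hasCompactSupport hFc hF one_ne_zero
  rw [← integral_lineDeriv_eq_zero hC hFc v]
  refine integral_congr_ae (Eventually.of_forall fun x => ?_)
  exact ((hF.differentiable one_ne_zero x).lineDeriv_eq_fderiv).symm

section
variable {n t : Plane}

/-- Integration in orthonormal coordinates. -/
theorem integral_frame (hn : ‖n‖ = 1) (ht : ‖t‖ = 1) (hnt : ⟪n, t⟫_ℝ = 0) (m : Plane)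
    (F : Plane → ℝ) : ∫ x, F x = ∫ p : ℝ × ℝ, F (m + (p.1 • n + p.2 • t)) := by
  have hon : Orthonormal ℝ ![n, t] := by
    rw [orthonormal_iff_ite]
    intro i j
    fin_cases i <;> fin_cases j <;>
      simp [hnt, real_inner_comm, hn, ht]
  let b : OrthonormalBasis (Fin 2) ℝ Plane := OrthonormalBasis.mk hon
    (hon.linearIndependent.span_eq_top_of_card_eq_finrank (by simp)).ge
  have hb : ∀ y : Plane, b.repr.symm y = y 0 • n + y 1 • t := by
    intro y
    rw [← b.sum_repr_symm]
    simp [b, Fin.sum_univ_two]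
  have h1 : ∫ x, F x = ∫ x, F (m + x) := (integral_add_left_eq_self F m).symm
  have h2 : ∫ x, F (m + x) = ∫ y : Plane, F (m + b.repr.symm y) :=
    (b.measurePreserving_repr_symm.integral_comp b.repr.symm.toMeasurableEquiv.measurableEmbedding
      (fun x => F (m + x))).symm
  have h3 : ∫ y : Plane, F (m + b.repr.symm y) =
      ∫ v : Fin 2 → ℝ, F (m + b.repr.symm (WithLp.toLp 2 v)) :=
    ((PiLp.volume_preserving_toLp (Fin 2)).integral_comp
      (MeasurableEquiv.toLp 2 (Fin 2 → ℝ)).measurableEmbedding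
      (fun y : Plane => F (m + b.repr.symm y))).symm
  have h4 := ((volume_preserving_finTwoArrow ℝ).symm).integral_comp
    (MeasurableEquiv.finTwoArrow (α := ℝ)).symm.measurableEmbedding
      (fun v : Fin 2 → ℝ => F (m + b.repr.symm (WithLp.toLp 2 v)))
  rw [h1, h2, h3, ← h4]
  refine integral_congr_ae (Eventually.of_forall fun p => ?_)
  simp only [hb]
  rfl

theorem frame_expand (hn : ‖n‖ = 1) (ht : ‖t‖ = 1) (hnt : ⟪n, t⟫_ℝ = 0) (u w : Plane) :
    ⟪u, w⟫_ℝ = ⟪u, n⟫_ℝ * ⟪n, w⟫_ℝ + ⟪u, t⟫_ℝ * ⟪t, w⟫_ℝ := by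
  have hon : Orthonormal ℝ ![n, t] := by
    rw [orthonormal_iff_ite]
    intro i j
    fin_cases i <;> fin_cases j <;>
      simp [hnt, real_inner_comm, hn, ht]
  let b : OrthonormalBasis (Fin 2) ℝ Plane := OrthonormalBasis.mk hon
    (hon.linearIndependent.span_eq_top_of_card_eq_finrank (by simp)).ge
  have := b.sum_inner_mul_inner u w
  rw [← this]
  simp [b, Fin.sum_univ_two]

theorem integrable_frame (hn : ‖n‖ = 1) (ht : ‖t‖ = 1) (hnt : ⟪n, t⟫_ℝ = 0) (m : Plane)
    {G : Plane → ℝ} (hG : Continuous G) (hGc : HasCompactSupport G) :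
    Integrable (fun p : ℝ × ℝ => G (m + (p.1 • n + p.2 • t))) := by
  refine Continuous.integrable_of_hasCompactSupport (by fun_prop) ?_
  have hemb : Topology.IsClosedEmbedding (fun p : ℝ × ℝ => m + (p.1 • n + p.2 • t)) := by
    have hc : Continuous (fun p : ℝ × ℝ => m + (p.1 • n + p.2 • t)) := by fun_prop
    have hleft : Function.LeftInverse (fun x : Plane => ((⟪n, x - m⟫_ℝ, ⟪t, x - m⟫_ℝ) : ℝ × ℝ))
        (fun p : ℝ × ℝ => m + (p.1 • n + p.2 • t)) := by
      rintro ⟨s, τ⟩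
      have htn : ⟪t, n⟫_ℝ = 0 := by rw [real_inner_comm, hnt]
      simp [inner_add_right, inner_smul_right, hnt, htn, hn, ht]
    exact hleft.isClosedEmbedding (by fun_prop) hc
  exact hGc.comp_isClosedEmbedding hemb

/-- The divergence theorem on a half plane for the fields `(a + b x) ψ`. -/
theorem integral_halfPlane (hn : ‖n‖ = 1) (ht : ‖t‖ = 1) (hnt : ⟪n, t⟫_ℝ = 0) (m a : Plane)
    (b : ℝ) {ψ : Plane → ℝ} (hψ : ContDiff ℝ 1 ψ) (hψc : HasCompactSupport ψ) :
    ∫ x in {x | 0 < ⟪n, x - m⟫_ℝ}, (⟪a + b • x, gradient ψ x⟫_ℝ + 2 * b * ψ x) =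
      -(⟪a + b • m, n⟫_ℝ * ∫ τ : ℝ, ψ (m + τ • t)) := by
  have htn : ⟪t, n⟫_ℝ = 0 := by rw [real_inner_comm, hnt]
  -- The normal and the tangential component of the field.
  set Fn : Plane → ℝ := fun x => ⟪a + b • x, n⟫_ℝ * ψ x with hFn
  set Ft : Plane → ℝ := fun x => ⟪a + b • x, t⟫_ℝ * ψ x with hFt
  have hlin : ∀ v : Plane, ContDiff ℝ 1 fun x : Plane => ⟪a + b • x, v⟫_ℝ := fun v =>
    ContDiff.inner ℝ (by fun_prop) (by fun_prop)
  have hFnC : ContDiff ℝ 1 Fn := (hlin n).mul hψ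
  have hFtC : ContDiff ℝ 1 Ft := (hlin t).mul hψ
  have hFnc : HasCompactSupport Fn := hψc.mul_left
  have hFtc : HasCompactSupport Ft := hψc.mul_left
  have hder : ∀ (v x : Plane), fderiv ℝ (fun x => ⟪a + b • x, v⟫_ℝ * ψ x) x v =
      b * ‖v‖ ^ 2 * ψ x + ⟪a + b • x, v⟫_ℝ * ⟪v, gradient ψ x⟫_ℝ := by
    intro v x
    have h1 : HasFDerivAt (fun x : Plane => ⟪a + b • x, v⟫_ℝ)
        (b • (innerSL ℝ v)) x := by
      have : (fun x : Plane => ⟪a + b • x, v⟫_ℝ) = fun x => (b • (innerSL ℝ v)) x + ⟪a, v⟫_ℝ := by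
        ext y
        simp [inner_add_left, inner_smul_left, real_inner_comm]
        ring
      rw [this]
      exact (b • (innerSL ℝ v)).hasFDerivAt.add_const _
    have h2 := (hψ.differentiable one_ne_zero x).hasFDerivAt
    change fderiv ℝ ((fun x : Plane => ⟪a + b • x, v⟫_ℝ) * ψ) x v = _
    rw [(h1.mul h2).fderiv]
    rw [real_inner_comm (gradient ψ x) v]
    simp
    ring
  have hG : ∀ x, ⟪a + b • x, gradient ψ x⟫_ℝ + 2 * b * ψ x =
      fderiv ℝ Fn x n + fderiv ℝ Ft x t := by
    intro x
    rw [hder n x, hder t x, frame_expand hn ht hnt, hn, ht]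
    ring
  have hcont : ∀ (F : Plane → ℝ) (v : Plane), ContDiff ℝ 1 F →
      Continuous fun x => fderiv ℝ F x v := fun F v hF =>
    (hF.continuous_fderiv one_ne_zero).clm_apply continuous_const
  have hcs : ∀ (F : Plane → ℝ) (v : Plane), HasCompactSupport F →
      HasCompactSupport fun x => fderiv ℝ F x v := fun F v hF => hF.fderiv_apply ℝ v
  have hmeas : MeasurableSet {x : Plane | 0 < ⟪n, x - m⟫_ℝ} :=
    (isOpen_lt continuous_const (by fun_prop)).measurableSet
  have hmem : ∀ p : ℝ × ℝ, m + (p.1 • n + p.2 • t) ∈ {x : Plane | 0 < ⟪n, x - m⟫_ℝ} ↔ 0 < p.1 := by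
    intro p
    simp [inner_add_right, inner_smul_right, hnt, hn]
  have hind : ∀ (F : Plane → ℝ), ∫ x in {x : Plane | 0 < ⟪n, x - m⟫_ℝ}, F x =
      ∫ p : ℝ × ℝ, (Ioi (0 : ℝ) ×ˢ univ).indicator (fun p => F (m + (p.1 • n + p.2 • t))) p := by
    intro F
    rw [← integral_indicator hmeas, integral_frame hn ht hnt m]
    refine integral_congr_ae (Eventually.of_forall fun p => ?_)
    dsimp only
    by_cases hp : 0 < p.1
    · rw [indicator_of_mem ((hmem p).2 hp), indicator_of_mem (by simpa using hp)]
    · rw [indicator_of_notMem (fun h => hp ((hmem p).1 h)), indicator_of_notMem (by simpa using hp)]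
  have hhd : ∀ (F : Plane → ℝ), ContDiff ℝ 1 F → ∀ (s τ : ℝ),
      HasDerivAt (fun s : ℝ => F (m + (s • n + τ • t))) (fderiv ℝ F (m + (s • n + τ • t)) n) s ∧
      HasDerivAt (fun τ : ℝ => F (m + (s • n + τ • t))) (fderiv ℝ F (m + (s • n + τ • t)) t) τ := by
    intro F hF s τ
    have hd := (hF.differentiable one_ne_zero (m + (s • n + τ • t))).hasFDerivAt
    constructor
    · have h1 : HasDerivAt (fun s : ℝ => m + (s • n + τ • t)) n s := by
        simpa using (((hasDerivAt_id s).smul_const n).add_const (τ • t)).const_add m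
      exact hd.comp_hasDerivAt s h1
    · have h1 : HasDerivAt (fun τ : ℝ => m + (s • n + τ • t)) t τ := by
        simpa using (((hasDerivAt_id τ).smul_const t).const_add (s • n)).const_add m
      exact hd.comp_hasDerivAt τ h1
  have hint : ∀ (G : Plane → ℝ), Continuous G → HasCompactSupport G →
      Integrable ((Ioi (0 : ℝ) ×ˢ (univ : Set ℝ)).indicator
        (fun p : ℝ × ℝ => G (m + (p.1 • n + p.2 • t)))) := fun G hG hGc =>
    (integrable_frame hn ht hnt m hG hGc).indicator (measurableSet_Ioi.prod MeasurableSet.univ)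
  have hslice : ∀ (F : Plane → ℝ), ContDiff ℝ 1 F → HasCompactSupport F → ∀ (x v : Plane), v ≠ 0 →
      ContDiff ℝ 1 (fun s : ℝ => F (x + s • v)) ∧
        HasCompactSupport (fun s : ℝ => F (x + s • v)) := by
    intro F hF hFc x v hv
    refine ⟨hF.comp (by fun_prop), ?_⟩
    have hemb : Topology.IsClosedEmbedding (fun s : ℝ => x + s • v) :=
      (Homeomorph.addLeft x).isClosedEmbedding.comp (isClosedEmbedding_smul_left hv)
    exact hFc.comp_isClosedEmbedding hemb
  have hn0 : n ≠ 0 := fun h => by simp [h] at hn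
  have ht0 : t ≠ 0 := fun h => by simp [h] at ht
  have hnormal : ∫ x in {x : Plane | 0 < ⟪n, x - m⟫_ℝ}, fderiv ℝ Fn x n =
      -(⟪a + b • m, n⟫_ℝ * ∫ τ : ℝ, ψ (m + τ • t)) := by
    rw [hind, Measure.volume_eq_prod,
      integral_prod_symm _ (hint _ (hcont Fn n hFnC) (hcs Fn n hFnc)), ← integral_const_mul,
      ← integral_neg]
    refine integral_congr_ae (Eventually.of_forall fun τ => ?_)
    have h1 : ∀ s : ℝ, (Ioi (0 : ℝ) ×ˢ (univ : Set ℝ)).indicator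
        (fun p : ℝ × ℝ => fderiv ℝ Fn (m + (p.1 • n + p.2 • t)) n) (s, τ) =
        (Ioi (0 : ℝ)).indicator (deriv fun s : ℝ => Fn (m + (s • n + τ • t))) s := by
      intro s
      by_cases hs : 0 < s
      · rw [indicator_of_mem (by simpa using hs), indicator_of_mem (by simpa using hs),
          ((hhd Fn hFnC s τ).1).deriv]
      · rw [indicator_of_notMem (by simpa using hs), indicator_of_notMem (by simpa using hs)]
    simp only [h1]
    rw [integral_indicator measurableSet_Ioi]
    obtain ⟨c1, c2⟩ := hslice Fn hFnC hFnc (m + τ • t) n hn0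
    have e : (fun s : ℝ => Fn (m + (s • n + τ • t))) = fun s : ℝ => Fn (m + τ • t + s • n) := by
      ext s
      congr 1
      abel
    rw [e, HasCompactSupport.integral_Ioi_deriv_eq c1 c2]
    simp only [hFn, zero_smul, add_zero]
    have : ⟪a + b • (m + τ • t), n⟫_ℝ = ⟪a + b • m, n⟫_ℝ := by
      simp [inner_add_left, inner_smul_left, htn]
    rw [this]
  have htangent : ∫ x in {x : Plane | 0 < ⟪n, x - m⟫_ℝ}, fderiv ℝ Ft x t = 0 := by
    rw [hind, Measure.volume_eq_prod,
      integral_prod _ (hint _ (hcont Ft t hFtC) (hcs Ft t hFtc))]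
    refine integral_eq_zero_of_ae (Eventually.of_forall fun s => ?_)
    by_cases hs : 0 < s
    · have h1 : ∀ τ : ℝ, (Ioi (0 : ℝ) ×ˢ (univ : Set ℝ)).indicator
          (fun p : ℝ × ℝ => fderiv ℝ Ft (m + (p.1 • n + p.2 • t)) t) (s, τ) =
          deriv (fun τ : ℝ => Ft (m + (s • n + τ • t))) τ := by
        intro τ
        rw [indicator_of_mem (by simpa using hs), ((hhd Ft hFtC s τ).2).deriv]
      simp only [h1]
      obtain ⟨c1, c2⟩ := hslice Ft hFtC hFtc (m + s • n) t ht0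
      have e : (fun τ : ℝ => Ft (m + (s • n + τ • t))) = fun τ : ℝ => Ft (m + s • n + τ • t) := by
        ext τ
        congr 1
        abel
      rw [e]
      exact integral_eq_zero_of_hasDerivAt_of_integrable
        (fun τ => (c1.differentiable one_ne_zero τ).hasDerivAt)
        ((c1.continuous_deriv le_rfl).integrable_of_hasCompactSupport c2.deriv)
        (c1.continuous.integrable_of_hasCompactSupport c2)
    · refine integral_eq_zero_of_ae (Eventually.of_forall fun τ => ?_)
      exact indicator_of_notMem (by simpa using hs) _
  simp only [hG]
  rw [integral_add, hnormal, htangent, add_zero]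
  · exact ((hcont Fn n hFnC).integrable_of_hasCompactSupport (hcs Fn n hFnc)).integrableOn
  · exact ((hcont Ft t hFtC).integrable_of_hasCompactSupport (hcs Ft t hFtc)).integrableOn

end

/-! ### Weak divergence and weak gradient of piecewise polynomials -/

theorem MvPolynomial_eval_of_totalDegree_le_one (P : MvPolynomial (Fin 2) ℝ)
    (hP : P.totalDegree ≤ 1) : ∃ (a : Plane) (c : ℝ), ∀ x : Plane,
      MvPolynomial.eval (fun i => x i) P = ⟪a, x⟫_ℝ + c := by
  refine ⟨!₂[P.coeff (Finsupp.single 0 1), P.coeff (Finsupp.single 1 1)], P.coeff 0, fun x => ?_⟩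
  have hP' : P = MvPolynomial.C (P.coeff 0) +
      (MvPolynomial.C (P.coeff (Finsupp.single 0 1)) * MvPolynomial.X 0 +
        MvPolynomial.C (P.coeff (Finsupp.single 1 1)) * MvPolynomial.X 1) := by
    ext s
    simp only [MvPolynomial.coeff_add, MvPolynomial.coeff_C, MvPolynomial.coeff_C_mul,
      MvPolynomial.coeff_X]
    by_cases h0 : s = 0
    · subst h0
      simp
    by_cases h1 : s = Finsupp.single 0 1
    · subst h1
      have : (Finsupp.single 1 1 : Fin 2 →₀ ℕ) ≠ Finsupp.single 0 1 := by
        intro h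
        have := DFunLike.congr_fun h 0
        simp at this
      simp [this, Finsupp.single_eq_zero, eq_comm]
    by_cases h2 : s = Finsupp.single 1 1
    · subst h2
      simp [Ne.symm h0, Ne.symm h1]
    · rw [if_neg (Ne.symm h0), if_neg (Ne.symm h1), if_neg (Ne.symm h2)]
      simp only [mul_zero, add_zero]
      apply MvPolynomial.coeff_eq_zero_of_totalDegree_lt
      refine lt_of_le_of_lt hP ?_
      by_contra hle
      rw [not_lt] at hle
      have hs : s 0 + s 1 ≤ 1 := by
        have e : ∑ i ∈ s.support, s i = s 0 + s 1 := by
          rw [Finset.sum_subset (Finset.subset_univ s.support) (fun i _ hi => by simpa using hi),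
            Fin.sum_univ_two]
        rw [← e]
        exact hle
      have hcases : (s 0 = 0 ∧ s 1 = 0) ∨ (s 0 = 1 ∧ s 1 = 0) ∨ (s 0 = 0 ∧ s 1 = 1) := by omega
      rcases hcases with ⟨e0, e1⟩ | ⟨e0, e1⟩ | ⟨e0, e1⟩
      · exact h0 (by ext i; fin_cases i <;> simp [e0, e1])
      · exact h1 (by ext i; fin_cases i <;> simp [e0, e1])
      · exact h2 (by ext i; fin_cases i <;> simp [e0, e1])
  conv_lhs => rw [hP']
  rw [inner_plane]
  simp
  ring

section
variable {Ω : Set Plane} {𝒯 : Finset (Affine.Triangle ℝ Plane)}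

/-- The functions in `P₁(𝒯)` are the piecewise affine ones. -/
theorem mem_piecewisePoly_one {v : Plane → ℝ} : v ∈ PiecewisePoly 1 𝒯 ↔
    ∃ (a : Affine.Triangle ℝ Plane → Plane) (c : Affine.Triangle ℝ Plane → ℝ), ∀ T ∈ 𝒯,
      ∀ x ∈ interior (closedTriangle T), v x = ⟪a T, x⟫_ℝ + c T := by
  constructor
  · intro h
    have : ∀ T, ∃ (p : Plane × ℝ), T ∈ 𝒯 → ∀ x ∈ interior (closedTriangle T),
        v x = ⟪p.1, x⟫_ℝ + p.2 := by
      intro T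
      by_cases hT : T ∈ 𝒯
      · obtain ⟨P, hP, hv⟩ := h T hT
        obtain ⟨a, c, hac⟩ := MvPolynomial_eval_of_totalDegree_le_one P hP
        exact ⟨(a, c), fun _ x hx => (hv x hx).trans (hac x)⟩
      · exact ⟨0, fun h => absurd h hT⟩
    choose p hp using this
    exact ⟨fun T => (p T).1, fun T => (p T).2, hp⟩
  · rintro ⟨a, c, h⟩ T hT
    refine ⟨MvPolynomial.C (a T 0) * MvPolynomial.X 0 + MvPolynomial.C (a T 1) * MvPolynomial.X 1 +
      MvPolynomial.C (c T), ?_, fun x hx => ?_⟩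
    · refine (MvPolynomial.totalDegree_add _ _).trans (max_le ?_ (by simp))
      refine (MvPolynomial.totalDegree_add _ _).trans (max_le ?_ ?_) <;>
      · refine (MvPolynomial.totalDegree_mul _ _).trans ?_
        simp
    · rw [h T hT x hx, inner_plane]
      simp

theorem mem_piecewisePoly_zero {v : Plane → ℝ} : v ∈ PiecewisePoly 0 𝒯 ↔
    ∃ c : Affine.Triangle ℝ Plane → ℝ, ∀ T ∈ 𝒯, ∀ x ∈ interior (closedTriangle T), v x = c T := by
  constructor
  · intro h
    have : ∀ T, ∃ c : ℝ, T ∈ 𝒯 → ∀ x ∈ interior (closedTriangle T), v x = c := by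
      intro T
      by_cases hT : T ∈ 𝒯
      · obtain ⟨P, hP, hv⟩ := h T hT
        refine ⟨P.coeff 0, fun _ x hx => (hv x hx).trans ?_⟩
        rw [MvPolynomial.totalDegree_eq_zero_iff_eq_C.1 (Nat.le_zero.1 hP)]
        simp
      · exact ⟨0, fun h => absurd h hT⟩
    choose c hc using this
    exact ⟨c, hc⟩
  · rintro ⟨c, h⟩ T hT
    exact ⟨MvPolynomial.C (c T), by simp, fun x hx => by simp [h T hT x hx]⟩

theorem mem_piecewisePolyVec_zero {q : Plane → Plane} : q ∈ PiecewisePolyVec 0 𝒯 ↔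
    ∃ a : Affine.Triangle ℝ Plane → Plane, ∀ T ∈ 𝒯, ∀ x ∈ interior (closedTriangle T),
      q x = a T := by
  constructor
  · intro h
    obtain ⟨c0, h0⟩ := mem_piecewisePoly_zero.1 (h 0)
    obtain ⟨c1, h1⟩ := mem_piecewisePoly_zero.1 (h 1)
    refine ⟨fun T => !₂[c0 T, c1 T], fun T hT x hx => ?_⟩
    ext i
    fin_cases i
    · exact h0 T hT x hx
    · exact h1 T hT x hx
  · rintro ⟨a, h⟩ i
    exact mem_piecewisePoly_zero.2 ⟨fun T => a T i, fun T hT x hx => by simp only [h T hT x hx]⟩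

theorem gradient_affine {v : Plane → ℝ} {U : Set Plane} (hU : IsOpen U) {a : Plane} {c : ℝ}
    (h : ∀ x ∈ U, v x = ⟪a, x⟫_ℝ + c) {x : Plane} (hx : x ∈ U) : gradient v x = a := by
  have h1 : HasGradientAt (fun y : Plane => ⟪a, y⟫_ℝ + c) a x := by
    rw [hasGradientAt_iff_hasFDerivAt]
    exact ((innerSL ℝ a).hasFDerivAt (x := x)).add_const c
  refine (h1.congr_of_eventuallyEq ?_).gradient
  filter_upwards [hU.mem_nhds hx] with y hy using h y hy

theorem gradNC_eq {v : Plane → ℝ} {T : Affine.Triangle ℝ Plane} (hT : T ∈ 𝒯) {a : Plane} {c : ℝ}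
    (h : ∀ x ∈ interior (closedTriangle T), v x = ⟪a, x⟫_ℝ + c) {x : Plane}
    (hx : x ∈ interior (closedTriangle T)) : gradNC 𝒯 v x = a := by
  rw [gradNC, indicator_of_mem (mem_openPieces.2 ⟨T, hT, hx⟩)]
  exact gradient_affine isOpen_interior h hx

/-- A function with the same moments as a constant on an open triangle equals that constant. -/
theorem ae_eq_of_integral_test {T : Affine.Triangle ℝ Plane} {d : Plane → ℝ} {C : ℝ}
    (hd : IntegrableOn d (interior (closedTriangle T)))
    (h : ∀ ψ ∈ TestFunctions (interior (closedTriangle T)), ∫ x, d x * ψ x = ∫ x, C * ψ x) :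
    ∀ᵐ x, x ∈ interior (closedTriangle T) → d x = C := by
  have key := isOpen_interior.ae_eq_zero_of_integral_contDiff_smul_eq_zero (μ := volume)
    (U := interior (closedTriangle T)) (f := fun x => d x - C)
    (by
      refine IntegrableOn.locallyIntegrableOn (hd.sub ?_)
      exact integrableOn_interior T continuous_const) ?_
  · filter_upwards [key] with x hx hxT
    linarith [hx hxT]
  · intro ψ hψ hψc hψs
    have hdψ : Integrable fun x => d x * ψ x := by
      have h1 : IntegrableOn (fun x => d x * ψ x) (interior (closedTriangle T)) := by
        obtain ⟨B, hB⟩ := hψ.continuous.bounded_above_of_compact_support hψc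
        exact hd.mul_bdd (c := B) hψ.continuous.aestronglyMeasurable
          (Eventually.of_forall hB)
      refine (integrableOn_iff_integrable_of_support_subset ?_).1 h1
      intro x hx
      refine hψs (subset_tsupport _ ?_)
      intro h0
      exact hx (by simp [h0])
    have hCψ : Integrable fun x => C * ψ x :=
      (hψ.continuous.integrable_of_hasCompactSupport hψc).const_mul C
    have := h ψ ⟨hψ, hψc, hψs⟩
    have e : ∀ x, ψ x • (d x - C) = d x * ψ x - C * ψ x := fun x => by
      simp only [smul_eq_mul]; ring
    simp only [e]
    rw [integral_sub hdψ hCψ, this, sub_self]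

theorem integrableOn_of_memLp (hΩ : IsPolygonalLipschitzDomain Ω) {d : Plane → ℝ}
    (hd : MemLp d 2 (volume.restrict Ω)) : IntegrableOn d Ω := by
  have : IsFiniteMeasure (volume.restrict Ω) :=
    ⟨by rw [Measure.restrict_apply_univ]; exact hΩ.isBounded.measure_lt_top⟩
  exact hd.integrable one_le_two

theorem setIntegral_eq_of_support {U : Set Plane} {F : Plane → ℝ} (hF : ∀ x, x ∉ U → F x = 0) :
    ∫ x in U, F x = ∫ x, F x :=
  setIntegral_eq_integral_of_forall_compl_eq_zero hF

theorem test_eq_zero {U : Set Plane} {ψ : Plane → ℝ} (hψ : ψ ∈ TestFunctions U) {x : Plane}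
    (hx : x ∉ U) : ψ x = 0 ∧ gradient ψ x = 0 := by
  have : x ∉ tsupport ψ := fun h => hx (hψ.2.2 h)
  exact ⟨image_eq_zero_of_notMem_tsupport this, gradient_eq_zero_of_notMem_tsupport this⟩

theorem testFunctions_mono {U V : Set Plane} {ψ : Plane → ℝ} (hψ : ψ ∈ TestFunctions U)
    (h : U ⊆ V) : ψ ∈ TestFunctions V :=
  ⟨hψ.1, hψ.2.1, hψ.2.2.trans h⟩

/-- The field `(a + b x) ψ` has integral divergence zero. -/
theorem integral_div_eq_zero (a : Plane) (b : ℝ) {ψ : Plane → ℝ} (hψ : ContDiff ℝ 1 ψ)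
    (hψc : HasCompactSupport ψ) :
    ∫ x, ⟪a + b • x, gradient ψ x⟫_ℝ = - ∫ x, 2 * b * ψ x := by
  have hc : ∀ i : Fin 2, ContDiff ℝ 1 fun x : Plane => (a i + b * x i) * ψ x := fun i => by fun_prop
  have hder : ∀ (i : Fin 2) (x : Plane), fderiv ℝ (fun x : Plane => (a i + b * x i) * ψ x) x
      (EuclideanSpace.single i 1) = b * ψ x + (a i + b * x i) * gradient ψ x i := by
    intro i x
    have h1 : HasFDerivAt (fun x : Plane => a i + b * x i)
        (b • (EuclideanSpace.proj i : Plane →L[ℝ] ℝ)) x :=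
      ((EuclideanSpace.proj i : Plane →L[ℝ] ℝ).hasFDerivAt.const_mul b).const_add (a i)
    have h2 := (hψ.differentiable one_ne_zero x).hasFDerivAt
    change fderiv ℝ ((fun x : Plane => a i + b * x i) * ψ) x _ = _
    rw [(h1.mul h2).fderiv, gradient_apply]
    simp
    ring
  have hz : ∀ i : Fin 2, ∫ x, (b * ψ x + (a i + b * x i) * gradient ψ x i) = 0 := by
    intro i
    rw [← integral_fderiv_eq_zero (hc i) hψc.mul_left (EuclideanSpace.single i 1)]
    simp only [hder]
  have hint : ∀ i : Fin 2, Integrable fun x => b * ψ x + (a i + b * x i) * gradient ψ x i := by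
    intro i
    have : (fun x => b * ψ x + (a i + b * x i) * gradient ψ x i) = fun x =>
        fderiv ℝ (fun x : Plane => (a i + b * x i) * ψ x) x (EuclideanSpace.single i 1) := by
      ext x
      rw [hder]
    rw [this]
    exact (((hc i).continuous_fderiv one_ne_zero).clm_apply
      continuous_const).integrable_of_hasCompactSupport (hψc.mul_left.fderiv_apply ℝ _)
  have hψi : Integrable fun x => 2 * b * ψ x :=
    (hψ.continuous.integrable_of_hasCompactSupport hψc).const_mul _
  have e : ∀ x : Plane, ⟪a + b • x, gradient ψ x⟫_ℝ =
      (b * ψ x + (a 0 + b * x 0) * gradient ψ x 0) +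
        (b * ψ x + (a 1 + b * x 1) * gradient ψ x 1) - 2 * b * ψ x := by
    intro x
    rw [inner_plane]
    simp
    ring
  simp only [e]
  refine (integral_sub ((hint 0).add (hint 1)) hψi).trans ?_
  rw [integral_add' (hint 0) (hint 1), hz 0, hz 1]
  ring

section
variable {q : Plane → Plane} {d : Plane → ℝ} {a : Affine.Triangle ℝ Plane → Plane}
  {b : Affine.Triangle ℝ Plane → ℝ}

/-- On each triangle, the weak divergence of `a + b x` is the classical one. -/
theorem IsWeakDivergence.ae_eq (hΩ : IsPolygonalLipschitzDomain Ω)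
    (h𝒯 : IsRegularTriangulation 𝒯 Ω) (hd : IsWeakDivergence Ω q d)
    (hq : ∀ T ∈ 𝒯, ∀ᵐ x, x ∈ interior (closedTriangle T) → q x = a T + b T • x)
    {T : Affine.Triangle ℝ Plane} (hT : T ∈ 𝒯) :
    ∀ᵐ x, x ∈ interior (closedTriangle T) → d x = 2 * b T := by
  have hTΩ := interior_subset_domain hΩ h𝒯 hT
  refine ae_eq_of_integral_test ((integrableOn_of_memLp hΩ hd.1).mono_set hTΩ) fun ψ hψ => ?_
  have h1 := hd.2 ψ (testFunctions_mono hψ hTΩ)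
  have hz : ∀ x ∉ Ω, ψ x = 0 ∧ gradient ψ x = 0 := fun x hx =>
    test_eq_zero (testFunctions_mono hψ hTΩ) hx
  rw [setIntegral_eq_of_support (fun x hx => by rw [(hz x hx).2, inner_zero_right]),
    setIntegral_eq_of_support (fun x hx => by rw [(hz x hx).1, mul_zero])] at h1
  have h2 : ∫ x, ⟪q x, gradient ψ x⟫_ℝ = ∫ x, ⟪a T + b T • x, gradient ψ x⟫_ℝ := by
    refine integral_congr_ae ?_
    filter_upwards [hq T hT] with x hx
    by_cases hxT : x ∈ interior (closedTriangle T)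
    · rw [hx hxT]
    · rw [(test_eq_zero hψ hxT).2, inner_zero_right, inner_zero_right]
  rw [h2, integral_div_eq_zero _ _ (hψ.1.of_le (by norm_cast)) hψ.2.1] at h1
  linarith

/-- A field with a weak divergence has no normal jumps across interior edges. -/
theorem IsWeakDivergence.jump_eq_zero (hΩ : IsPolygonalLipschitzDomain Ω)
    (h𝒯 : IsRegularTriangulation 𝒯 Ω) (hd : IsWeakDivergence Ω q d)
    (hq : ∀ T ∈ 𝒯, ∀ᵐ x, x ∈ interior (closedTriangle T) → q x = a T + b T • x)
    {T T' : Affine.Triangle ℝ Plane} (hT : T ∈ 𝒯) (hT' : T' ∈ 𝒯) (hne : T ≠ T') {k k' : Fin 3}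
    (hm : EdgeMatch T k T' k') :
    ⟪a T + b T • edgeMid T k, gradLam T k⟫_ℝ = ⟪a T' + b T' • edgeMid T k, gradLam T k⟫_ℝ := by
  set m := edgeMid T k with hmdef
  -- A test function concentrated at the midpoint of the edge.
  obtain ⟨r, hr, hball⟩ := Metric.eventually_nhds_iff_ball.1
    ((h𝒯.eventually_edge hT hT' hne hm (edgeMid_mem_edge T k) (lam_edgeMid_pos T k)).and
      (hΩ.isOpen.mem_nhds (edgeMid_mem_domain hΩ h𝒯 hT hT' hne hm)))
  let bump : ContDiffBump m := ⟨r / 4, r / 2, by positivity, by linarith⟩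
  set ψ : Plane → ℝ := fun x => bump x with hψdef
  have hψB : ψ ∈ TestFunctions (Metric.ball m r) := by
    refine ⟨bump.contDiff, bump.hasCompactSupport, ?_⟩
    rw [hψdef, bump.tsupport_eq]
    exact Metric.closedBall_subset_ball (by change r / 2 < r; linarith)
  have hψ : ψ ∈ TestFunctions Ω := testFunctions_mono hψB fun x hx => (hball x hx).2
  have hψ1 : ContDiff ℝ 1 ψ := hψ.1.of_le (by norm_cast)
  -- Unit normal and unit tangent.
  set g := gradLam T k with hg
  have hg0 : ‖g‖ ≠ 0 := norm_ne_zero_iff.2 (gradLam_ne_zero T k)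
  have hgpos : 0 < ‖g‖ := norm_pos_iff.2 (gradLam_ne_zero T k)
  set n : Plane := ‖g‖⁻¹ • g with hn
  have hn1 : ‖n‖ = 1 := by rw [hn, norm_smul, norm_inv, norm_norm, inv_mul_cancel₀ hg0]
  set t : Plane := !₂[-n 1, n 0] with ht
  have hnt : ⟪n, t⟫_ℝ = 0 := by rw [inner_plane]; simp [ht]; ring
  have ht1 : ‖t‖ = 1 := by
    have h1 := real_inner_self_eq_norm_sq n
    have h2 := real_inner_self_eq_norm_sq t
    rw [inner_plane] at h1 h2
    have h3 : ‖t‖ ^ 2 = 1 := by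
      rw [hn1] at h1
      rw [← h2]
      simp [ht]
      linarith
    exact (pow_eq_one_iff_of_nonneg (norm_nonneg t) two_ne_zero).1 h3
  set H : Set Plane := {x | 0 < ⟪n, x - m⟫_ℝ} with hH
  set H' : Set Plane := {x | 0 < ⟪-n, x - m⟫_ℝ} with hH'
  have hlam : ∀ x, lam T k x = ‖g‖ * ⟪n, x - m⟫_ℝ := by
    intro x
    have := lam_sub T k x m
    rw [hmdef, lam_edgeMid, if_pos rfl, sub_zero, ← hmdef] at this
    rw [this, hn, inner_smul_left]
    simp only [conj_trivial]
    rw [← mul_assoc, mul_inv_cancel₀ hg0, one_mul]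
  have hHlam : ∀ x, x ∈ H ↔ 0 < lam T k x := fun x => by
    rw [hlam, mul_pos_iff_of_pos_left hgpos]; rfl
  have hHlam' : ∀ x, x ∈ H' ↔ lam T k x < 0 := fun x => by
    rw [hlam, hH', mem_ofPred_eq, inner_neg_left, neg_pos, mul_neg_iff]
    constructor
    · exact fun h => Or.inl ⟨hgpos, h⟩
    · rintro (h | h)
      · exact h.2
      · exact absurd h.1 (not_lt.2 hgpos.le)
  have hmeasH : MeasurableSet H := (isOpen_lt continuous_const (by fun_prop)).measurableSet
  have hmeasH' : MeasurableSet H' := (isOpen_lt continuous_const (by fun_prop)).measurableSet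
  have hfront : ∀ᵐ x : Plane, x ∉ frontier (closedTriangle T) :=
    measure_eq_zero_iff_ae_notMem.1 ((convex_closedTriangle T).addHaar_frontier volume)
  -- Integrals of functions supported near the midpoint split into two half planes.
  have key : ∀ F G G' : Plane → ℝ, Integrable G → Integrable G' →
      (∀ x, x ∉ Metric.ball m r → F x = 0 ∧ G x = 0 ∧ G' x = 0) →
      (∀ᵐ x, (x ∈ interior (closedTriangle T) → F x = G x) ∧
        (x ∈ interior (closedTriangle T') → F x = G' x)) →
      ∫ x in Ω, F x = (∫ x in H, G x) + ∫ x in H', G' x := by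
    intro F G G' hG hG' h0 hF
    rw [setIntegral_eq_of_support (fun x hx => (h0 x fun h => hx (hball x h).2).1),
      ← integral_indicator hmeasH, ← integral_indicator hmeasH',
      ← integral_add (hG.indicator hmeasH) (hG'.indicator hmeasH')]
    refine integral_congr_ae ?_
    filter_upwards [hF, hfront] with x hx hxf
    by_cases hxB : x ∈ Metric.ball m r
    · obtain ⟨⟨c1, c2, c3⟩, -⟩ := hball x hxB
      rcases lt_trichotomy (lam T k x) 0 with h | h | h
      · rw [indicator_of_notMem (by rw [hHlam]; exact not_lt.2 h.le),
          indicator_of_mem ((hHlam' x).2 h), zero_add, hx.2 (c2 h)]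
      · exfalso
        rw [(isClosed_closedTriangle T).frontier_eq] at hxf
        refine hxf ⟨c3 h, fun hi => ?_⟩
        exact (mem_interior.1 hi k).ne' h
      · rw [indicator_of_mem ((hHlam x).2 h),
          indicator_of_notMem (by rw [hHlam']; exact not_lt.2 h.le), add_zero, hx.1 (c1 h)]
    · obtain ⟨e1, e2, e3⟩ := h0 x hxB
      simp [indicator, e1, e2, e3]
  have hgi : ∀ S : Affine.Triangle ℝ Plane,
      Integrable fun x => ⟪a S + b S • x, gradient ψ x⟫_ℝ := by
    intro S
    refine Continuous.integrable_of_hasCompactSupport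
      (Continuous.inner (by fun_prop) (continuous_gradient hψ1)) ?_
    refine (hasCompactSupport_gradient hψ.2.1).mono fun x hx h => hx ?_
    simp only [h, inner_zero_right]
  have hψi : ∀ S : Affine.Triangle ℝ Plane, Integrable fun x => 2 * b S * ψ x := fun S =>
    (hψ1.continuous.integrable_of_hasCompactSupport hψ.2.1).const_mul _
  have e1 := key (fun x => ⟪q x, gradient ψ x⟫_ℝ) _ _ (hgi T) (hgi T')
    (fun x hx => by simp only [(test_eq_zero hψB hx).2, inner_zero_right, and_self])
    (by
      filter_upwards [hq T hT, hq T' hT'] with x hx hx'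
      exact ⟨fun h => by rw [hx h], fun h => by rw [hx' h]⟩)
  have e2 := key (fun x => d x * ψ x) _ _ (hψi T) (hψi T')
    (fun x hx => by simp only [(test_eq_zero hψB hx).1, mul_zero, and_self])
    (by
      filter_upwards [hd.ae_eq hΩ h𝒯 hq hT, hd.ae_eq hΩ h𝒯 hq hT'] with x hx hx'
      exact ⟨fun h => by rw [hx h], fun h => by rw [hx' h]⟩)
  have e3 := hd.2 ψ hψ
  have f1 := integral_halfPlane hn1 ht1 hnt m (a T) (b T) hψ1 hψ.2.1
  have f2 := integral_halfPlane (n := -n) (by rw [norm_neg, hn1]) ht1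
    (by rw [inner_neg_left, hnt, neg_zero]) m (a T') (b T') hψ1 hψ.2.1
  rw [integral_add (hgi T).integrableOn (hψi T).integrableOn] at f1
  rw [integral_add (hgi T').integrableOn (hψi T').integrableOn, inner_neg_right] at f2
  rw [e1, e2] at e3
  have hI : 0 < ∫ τ : ℝ, ψ (m + τ • t) := by
    have ht0 : t ≠ 0 := fun h => by simp [h] at ht1
    have hemb : Topology.IsClosedEmbedding (fun s : ℝ => m + s • t) :=
      (Homeomorph.addLeft m).isClosedEmbedding.comp (isClosedEmbedding_smul_left ht0)
    refine Continuous.integral_pos_of_hasCompactSupport_nonneg_nonzero (x := 0)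
      (hψ1.continuous.comp hemb.continuous) (hψ.2.1.comp_isClosedEmbedding hemb)
      (fun τ => bump.nonneg) ?_
    have : ψ (m + (0 : ℝ) • t) = 1 := by
      rw [zero_smul, add_zero]
      exact bump.one_of_mem_closedBall (Metric.mem_closedBall_self bump.rIn_pos.le)
    rw [this]
    exact one_ne_zero
  have hfin : (⟪a T + b T • m, n⟫_ℝ - ⟪a T' + b T' • m, n⟫_ℝ) * ∫ τ : ℝ, ψ (m + τ • t) = 0 := by
    linarith
  have hfin' := (mul_eq_zero.1 hfin).resolve_right hI.ne'
  rw [hn, inner_smul_right, inner_smul_right, ← mul_sub] at hfin'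
  linarith [(mul_eq_zero.1 hfin').resolve_left (inv_ne_zero hg0)]

end

/-- On each triangle, the weak gradient of an affine function is the classical one. -/
theorem IsWeakGradient.ae_eq (hΩ : IsPolygonalLipschitzDomain Ω)
    (h𝒯 : IsRegularTriangulation 𝒯 Ω) {β : Plane → ℝ} {g : Plane → Plane}
    (hg : IsWeakGradient Ω β g) {T : Affine.Triangle ℝ Plane} (hT : T ∈ 𝒯) {a : Plane} {c : ℝ}
    (hβ : ∀ x ∈ interior (closedTriangle T), β x = ⟪a, x⟫_ℝ + c) :
    ∀ᵐ x, x ∈ interior (closedTriangle T) → g x = a := by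
  have hTΩ := interior_subset_domain hΩ h𝒯 hT
  have hcomp : ∀ i : Fin 2, ∀ᵐ x, x ∈ interior (closedTriangle T) → g x i = a i := by
    intro i
    have hgi : MemLp (fun x => g x i) 2 (volume.restrict Ω) :=
      (EuclideanSpace.proj i : Plane →L[ℝ] ℝ).comp_memLp' hg.1
    refine ae_eq_of_integral_test ((integrableOn_of_memLp hΩ hgi).mono_set hTΩ) fun ψ hψ => ?_
    have hψ1 : ContDiff ℝ 1 ψ := hψ.1.of_le (by norm_cast)
    have h1 := hg.2 ψ (testFunctions_mono hψ hTΩ) i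
    have hz : ∀ x ∉ Ω, ψ x = 0 ∧ gradient ψ x = 0 := fun x hx =>
      test_eq_zero (testFunctions_mono hψ hTΩ) hx
    rw [setIntegral_eq_of_support (fun x hx => by rw [(hz x hx).2]; simp),
      setIntegral_eq_of_support (fun x hx => by rw [(hz x hx).1, mul_zero])] at h1
    have h2 : ∫ x, β x * gradient ψ x i = ∫ x, (⟪a, x⟫_ℝ + c) * gradient ψ x i := by
      refine integral_congr_ae (Eventually.of_forall fun x => ?_)
      by_cases hxT : x ∈ interior (closedTriangle T)
      · simp only [hβ x hxT]
      · simp only [(test_eq_zero hψ hxT).2]; simp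
    have hc : ContDiff ℝ 1 fun x : Plane => (⟪a, x⟫_ℝ + c) * ψ x :=
      ContDiff.mul (ContDiff.add (ContDiff.inner ℝ contDiff_const contDiff_id) contDiff_const) hψ1
    have hder : ∀ x : Plane, fderiv ℝ (fun x : Plane => (⟪a, x⟫_ℝ + c) * ψ x) x
        (EuclideanSpace.single i 1) = (⟪a, x⟫_ℝ + c) * gradient ψ x i + a i * ψ x := by
      intro x
      have h1 : HasFDerivAt (fun x : Plane => ⟪a, x⟫_ℝ + c) (innerSL ℝ a) x :=
        ((innerSL ℝ a).hasFDerivAt (x := x)).add_const c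
      have h2 := (hψ1.differentiable one_ne_zero x).hasFDerivAt
      change fderiv ℝ ((fun x : Plane => ⟪a, x⟫_ℝ + c) * ψ) x _ = _
      rw [(h1.mul h2).fderiv, gradient_apply]
      simp [EuclideanSpace.inner_single_right]
      ring
    have h3 := integral_fderiv_eq_zero hc hψ.2.1.mul_left (EuclideanSpace.single i 1)
    simp only [hder] at h3
    rw [integral_add] at h3
    · linarith
    · refine Continuous.integrable_of_hasCompactSupport ?_ ?_
      · have := continuous_gradient hψ1
        fun_prop
      · refine (hasCompactSupport_gradient hψ.2.1).mono fun x hx h => hx ?_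
        simp only [h]
        simp
    · exact (hψ1.continuous.integrable_of_hasCompactSupport hψ.2.1).const_mul _
  filter_upwards [hcomp 0, hcomp 1] with x h0 h1 hx
  ext i
  fin_cases i
  · exact h0 hx
  · exact h1 hx

theorem isWeakGradient_weakGradient {β : Plane → ℝ} (hβ : β ∈ H1 Ω) :
    IsWeakGradient Ω β (weakGradient Ω β) := by
  rw [weakGradient, dif_pos hβ.2]
  exact hβ.2.choose_spec

theorem gradient_mem_testFunctions {U : Set Plane} {ψ : Plane → ℝ} (hψ : ψ ∈ TestFunctions U)
    (i : Fin 2) : (fun x => gradient ψ x i) ∈ TestFunctions U := by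
  have e : (fun x => gradient ψ x i) = fun x => fderiv ℝ ψ x (EuclideanSpace.single i 1) :=
    funext fun x => gradient_apply ψ x i
  rw [e]
  refine ⟨?_, hψ.2.1.fderiv_apply ℝ _, (tsupport_fderiv_apply_subset ℝ _).trans hψ.2.2⟩
  exact (hψ.1.fderiv_right (m := ∞) (by norm_cast)).clm_apply contDiff_const

theorem gradient_gradient_comm {U : Set Plane} {ψ : Plane → ℝ} (hψ : ψ ∈ TestFunctions U)
    (i j : Fin 2) (x : Plane) :
    gradient (fun x => gradient ψ x i) x j = gradient (fun x => gradient ψ x j) x i := by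
  have e : ∀ i : Fin 2, (fun x => gradient ψ x i) =
      fun x => fderiv ℝ ψ x (EuclideanSpace.single i 1) :=
    fun i => funext fun x => gradient_apply ψ x i
  have hsymm : IsSymmSndFDerivAt ℝ ψ x := hψ.1.contDiffAt.isSymmSndFDerivAt (by simp; norm_cast)
  have hdiff : DifferentiableAt ℝ (fderiv ℝ ψ) x :=
    (hψ.1.fderiv_right (m := ∞) (by norm_cast)).differentiable (by simp) x
  have hs : ∀ i j : Fin 2, gradient (fun x => gradient ψ x i) x j =
      fderiv ℝ (fderiv ℝ ψ) x (EuclideanSpace.single j 1) (EuclideanSpace.single i 1) := by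
    intro i j
    rw [e i, gradient_apply, fderiv_clm_apply hdiff (differentiableAt_const _)]
    simp
  rw [hs, hs, hsymm.eq]

theorem integrableOn_mul_test (hΩ : IsPolygonalLipschitzDomain Ω) {g ψ : Plane → ℝ}
    (hg : MemLp g 2 (volume.restrict Ω)) (hψ : ψ ∈ TestFunctions Ω) :
    IntegrableOn (fun x => g x * ψ x) Ω := by
  obtain ⟨B, hB⟩ := hψ.1.continuous.bounded_above_of_compact_support hψ.2.1
  exact (integrableOn_of_memLp hΩ hg).mul_bdd (c := B) hψ.1.continuous.aestronglyMeasurable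
    (Eventually.of_forall hB)

/-- A `Curl` is weakly divergence free. -/
theorem isWeakDivergence_curl (hΩ : IsPolygonalLipschitzDomain Ω) {β : Plane → ℝ}
    (hβ : β ∈ H1 Ω) : IsWeakDivergence Ω (curl Ω β) (fun _ => 0) := by
  refine ⟨MemLp.zero', fun ψ hψ => ?_⟩
  have hg := isWeakGradient_weakGradient hβ
  have hgi : ∀ i : Fin 2, MemLp (fun x => weakGradient Ω β x i) 2 (volume.restrict Ω) := fun i =>
    (EuclideanSpace.proj i : Plane →L[ℝ] ℝ).comp_memLp' hg.1
  have e : ∀ x, ⟪curl Ω β x, gradient ψ x⟫_ℝ =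
      weakGradient Ω β x 1 * gradient ψ x 0 - weakGradient Ω β x 0 * gradient ψ x 1 := by
    intro x
    rw [inner_plane]
    simp [curl]
    ring
  have h1 := hg.2 _ (gradient_mem_testFunctions hψ 0) 1
  have h0 := hg.2 _ (gradient_mem_testFunctions hψ 1) 0
  simp only [gradient_gradient_comm hψ 0 1] at h1
  simp only [e]
  rw [integral_sub (integrableOn_mul_test hΩ (hgi 1) (gradient_mem_testFunctions hψ 0))
    (integrableOn_mul_test hΩ (hgi 0) (gradient_mem_testFunctions hψ 1))]
  simp only [zero_mul, integral_zero, neg_zero]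
  linarith

/-- Each Cartesian multiple of an `H¹` function has a weak divergence. -/
theorem isWeakDivergence_single {β : Plane → ℝ} {g : Plane → Plane} (hg : IsWeakGradient Ω β g)
    (i : Fin 2) : IsWeakDivergence Ω (fun x => β x • EuclideanSpace.single i 1)
      (fun x => g x i) := by
  refine ⟨(EuclideanSpace.proj i : Plane →L[ℝ] ℝ).comp_memLp' hg.1, fun ψ hψ => ?_⟩
  rw [← hg.2 ψ hψ i]
  refine integral_congr_ae (Eventually.of_forall fun x => ?_)
  simp [gradient_apply]

end

/-! ### Potentials on a simply connected domain -/

/-- The real line with the discrete topology, the fibre of the covering space of local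
potentials. -/
def DiscreteReal : Type := ℝ

instance : TopologicalSpace DiscreteReal := ⊥

instance : DiscreteTopology DiscreteReal := ⟨rfl⟩

section
variable {Ω : Set Plane} {𝒯 : Finset (Affine.Triangle ℝ Plane)}
  {g : Affine.Triangle ℝ Plane → Plane}

/-- Tangential continuity of a piecewise constant field across interior edges. -/
def TangentiallyContinuous (𝒯 : Finset (Affine.Triangle ℝ Plane))
    (g : Affine.Triangle ℝ Plane → Plane) : Prop :=
  ∀ T ∈ 𝒯, ∀ T' ∈ 𝒯, T ≠ T' → ∀ k k', EdgeMatch T k T' k' →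
    ⟪g T, T.points (k + 2) - T.points (k + 1)⟫_ℝ = ⟪g T', T.points (k + 2) - T.points (k + 1)⟫_ℝ

theorem TangentiallyContinuous.inner_eq (hg : TangentiallyContinuous 𝒯 g)
    (h𝒯 : IsRegularTriangulation 𝒯 Ω) {T T' : Affine.Triangle ℝ Plane} (hT : T ∈ 𝒯) (hT' : T' ∈ 𝒯)
    {x y : Plane} (hx : x ∈ closedTriangle T) (hx' : x ∈ closedTriangle T')
    (hy : y ∈ closedTriangle T) (hy' : y ∈ closedTriangle T') :
    ⟪g T, y - x⟫_ℝ = ⟪g T', y - x⟫_ℝ := by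
  by_cases hne : T = T'
  · rw [hne]
  have hxx : x ∈ closedTriangle T ∩ closedTriangle T' := ⟨hx, hx'⟩
  have hyy : y ∈ closedTriangle T ∩ closedTriangle T' := ⟨hy, hy'⟩
  rcases h𝒯.inter_cases hT hT' hne with h | ⟨i, h⟩ | ⟨k, k', hm, h⟩
  · rw [h] at hxx; exact hxx.elim
  · rw [h, mem_singleton_iff] at hxx hyy
    rw [hxx, hyy, sub_self, inner_zero_right, inner_zero_right]
  · rw [h, edge, segment_eq_image_lineMap] at hxx hyy
    obtain ⟨s, -, rfl⟩ := hxx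
    obtain ⟨s', -, rfl⟩ := hyy
    have e : AffineMap.lineMap (T.points (k + 1)) (T.points (k + 2)) s' -
        AffineMap.lineMap (T.points (k + 1)) (T.points (k + 2)) s =
        (s' - s) • (T.points (k + 2) - T.points (k + 1)) := by
      simp only [AffineMap.lineMap_apply, vsub_eq_sub, vadd_eq_add]
      module
    rw [e, inner_smul_right, inner_smul_right, hg T hT T' hT' hne k k' hm]

/-- The open star of a point: all points whose triangles contain the given point. -/
def star (𝒯 : Finset (Affine.Triangle ℝ Plane)) (x : Plane) : Set Plane :=
  {y | ∀ T ∈ 𝒯, y ∈ closedTriangle T → x ∈ closedTriangle T}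

theorem isOpen_star (x : Plane) : IsOpen (star 𝒯 x) := by
  rw [isOpen_iff_mem_nhds]
  intro y hy
  filter_upwards [eventually_mem_imp_mem 𝒯 y] with z hz T hT hzT
  exact hy T hT (hz T hT hzT)

theorem self_mem_star (x : Plane) : x ∈ star 𝒯 x := fun _ _ h => h

/-- The covering space of local potentials of a tangentially continuous field `g`. In the chart
around `i` the local potential is `y ↦ ⟪g, y - i⟫`; two of these differ by a constant. -/
noncomputable def potentialCore (g : Affine.Triangle ℝ Plane → Plane)
    (hg : TangentiallyContinuous 𝒯 g) (h𝒯 : IsRegularTriangulation 𝒯 Ω)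
    (τ : Plane → Affine.Triangle ℝ Plane)
    (hτ : ∀ y ∈ Ω, τ y ∈ 𝒯 ∧ y ∈ closedTriangle (τ y)) :
    FiberBundleCore Ω Ω DiscreteReal where
  baseSet i := {y | (y : Plane) ∈ star 𝒯 i}
  isOpen_baseSet i := (isOpen_star (i : Plane)).preimage continuous_subtype_val
  indexAt y := y
  mem_baseSet_at y := self_mem_star (y : Plane)
  coordChange i j y t := (show ℝ from t) + ⟪g (τ y), (j : Plane) - i⟫_ℝ
  coordChange_self i y _ t := by
    change (show ℝ from t) + ⟪g (τ y), (i : Plane) - i⟫_ℝ = t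
    rw [sub_self, inner_zero_right, add_zero]
  continuousOn_coordChange i j := by
    intro p hp
    have hev : ∀ p' ∈ ({y : Ω | (y : Plane) ∈ star 𝒯 i} ∩ {y : Ω | (y : Plane) ∈ star 𝒯 j}) ×ˢ
        (univ : Set DiscreteReal),
        ((show ℝ from p'.2) + ⟪g (τ p'.1), (j : Plane) - i⟫_ℝ : ℝ) =
        ((show ℝ from p'.2) + ⟪g (τ p.1), (j : Plane) - i⟫_ℝ : ℝ) := by
      rintro p' hp'
      obtain ⟨h1, h2⟩ := hτ p.1 p.1.2
      obtain ⟨h3, h4⟩ := hτ p'.1 p'.1.2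
      congr 1
      exact hg.inner_eq h𝒯 h3 h1 (hp'.1.1 _ h3 h4) (hp.1.1 _ h1 h2) (hp'.1.2 _ h3 h4)
        (hp.1.2 _ h1 h2)
    have hc : Continuous fun p' : Ω × DiscreteReal =>
        (show DiscreteReal from ((show ℝ from p'.2) + ⟪g (τ p.1), (j : Plane) - i⟫_ℝ : ℝ)) :=
      (continuous_of_discreteTopology (f := fun t : DiscreteReal =>
        (show DiscreteReal from ((show ℝ from t) + ⟪g (τ p.1), (j : Plane) - i⟫_ℝ : ℝ)))).comp
        continuous_snd
    exact hc.continuousWithinAt.congr hev (hev p hp)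
  coordChange_comp i j k y _ t := by
    change ((show ℝ from t) + ⟪g (τ y), (j : Plane) - i⟫_ℝ) + ⟪g (τ y), (k : Plane) - j⟫_ℝ =
      (show ℝ from t) + ⟪g (τ y), (k : Plane) - i⟫_ℝ
    rw [add_assoc, ← inner_add_right]
    congr 2
    abel

/-- On a simply connected domain, a tangentially continuous piecewise constant field has a
continuous potential: the covering space of local potentials has a section. -/
theorem exists_potential (hΩ : IsPolygonalLipschitzDomain Ω) (hsc : IsSimplyConnected Ω)
    (h𝒯 : IsRegularTriangulation 𝒯 Ω) (hg : TangentiallyContinuous 𝒯 g) :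
    ∃ β : Plane → ℝ, ∀ x ∈ Ω, ∀ᶠ y in 𝓝 x, ∀ T ∈ 𝒯, y ∈ closedTriangle T →
      β y - β x = ⟪g T, y - x⟫_ℝ := by
  classical
  have := hsc.simplyConnectedSpace
  have := hΩ.isOpen.locallyPathConnectedSpace
  have hτe : ∀ z, ∃ T, z ∈ Ω → T ∈ 𝒯 ∧ z ∈ closedTriangle T := by
    intro z
    by_cases hz : z ∈ Ω
    · obtain ⟨T, hT, h⟩ := h𝒯.exists_mem (_root_.subset_closure hz)
      exact ⟨T, fun _ => ⟨hT, h⟩⟩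
    · obtain ⟨w, hw⟩ := hΩ.isConnected.nonempty
      obtain ⟨T, -, -⟩ := h𝒯.exists_mem (_root_.subset_closure hw)
      exact ⟨T, fun h => absurd h hz⟩
  choose τ hτ using hτe
  let Z := potentialCore g hg h𝒯 τ hτ
  have hcov : IsCoveringMap Z.proj := FiberBundle.isCoveringMap
  obtain ⟨x₀, hx₀⟩ := hΩ.isConnected.nonempty
  obtain ⟨s, ⟨-, hs⟩, -⟩ := hcov.existsUnique_continuousMap_lifts (ContinuousMap.id Ω) ⟨x₀, hx₀⟩
    (⟨⟨x₀, hx₀⟩, (0 : ℝ)⟩ : Z.TotalSpace) rfl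
  have hs' : ∀ y : Ω, (s y).1 = y := fun y => congrFun hs y
  let val : Z.TotalSpace → ℝ := fun e => e.2
  let β : Plane → ℝ := fun y => if h : y ∈ Ω then val (s ⟨y, h⟩) else 0
  have hβ : ∀ y : Ω, β y = val (s y) := fun y => by
    simp only [β]
    rw [dif_pos y.2]
  refine ⟨β, fun x hx => ?_⟩
  -- In the chart around `x` the section is locally constant.
  have hloc : ∀ᶠ y in 𝓝 (⟨x, hx⟩ : Ω), (Z.localTriv ⟨x, hx⟩ (s y)).2 =
      (Z.localTriv ⟨x, hx⟩ (s ⟨x, hx⟩)).2 := by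
    have hmem : s ⟨x, hx⟩ ∈ (Z.localTriv ⟨x, hx⟩).source := by
      rw [Z.mem_localTriv_source, hs']
      exact self_mem_star (𝒯 := 𝒯) x
    have hcont : ContinuousAt (fun y => (Z.localTriv ⟨x, hx⟩ (s y)).2) ⟨x, hx⟩ :=
      continuous_snd.continuousAt.comp
        (((Z.localTriv ⟨x, hx⟩).continuousAt hmem).comp s.continuous.continuousAt)
    have := hcont.eventually (isOpen_discrete {(Z.localTriv ⟨x, hx⟩ (s ⟨x, hx⟩)).2} |>.mem_nhds rfl)
    exact this
  have hval : ∀ y : Ω, (show ℝ from (Z.localTriv ⟨x, hx⟩ (s y)).2) =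
      β y + ⟪g (τ y), x - y⟫_ℝ := by
    intro y
    rw [hβ]
    change val (s y) + ⟪g (τ (s y).1), x - (s y).1⟫_ℝ = _
    rw [hs']
  have hloc' : ∀ᶠ y in 𝓝 x, y ∈ Ω → β y + ⟪g (τ y), x - y⟫_ℝ = β x := by
    have h := hloc
    rw [nhds_subtype_eq_comap, eventually_comap] at h
    filter_upwards [h] with y hy hyΩ
    have h1 := (hval ⟨y, hyΩ⟩).symm.trans ((hy ⟨y, hyΩ⟩ rfl).trans (hval ⟨x, hx⟩))
    simpa using h1
  filter_upwards [hloc', hΩ.isOpen.mem_nhds hx, eventually_mem_imp_mem 𝒯 x]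
    with y hy hyΩ hys T hT hyT
  obtain ⟨h1, h2⟩ := hτ y hyΩ
  have h3 := hy hyΩ
  rw [hg.inner_eq h𝒯 hT h1 (hys T hT hyT) (hys _ h1 h2) hyT h2]
  rw [← neg_sub y x, inner_neg_right] at h3
  linarith

end

/-! ### Sobolev regularity of the potential -/

/-- A locally uniform Lipschitz bound at each point gives a global one. -/
theorem lipschitzWith_of_eventually {F : Plane → ℝ} {C : NNReal}
    (h : ∀ x, ∀ᶠ y in 𝓝 x, |F y - F x| ≤ C * ‖y - x‖) : LipschitzWith C F := by
  have hcont : Continuous F := by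
    rw [continuous_iff_continuousAt]
    intro x
    rw [ContinuousAt, tendsto_iff_dist_tendsto_zero]
    have hlim : Tendsto (fun y => (C : ℝ) * ‖y - x‖) (𝓝 x) (𝓝 0) := by
      have : Continuous fun y => (C : ℝ) * ‖y - x‖ := by fun_prop
      simpa using this.tendsto x
    exact squeeze_zero' (Eventually.of_forall fun _ => dist_nonneg)
      ((h x).mono fun y hy => by rwa [Real.dist_eq]) hlim
  refine LipschitzWith.of_dist_le_mul fun x y => ?_
  rw [dist_comm, dist_comm x y, Real.dist_eq, dist_eq_norm]
  set v := y - x with hv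
  set f : ℝ → ℝ := fun s => |F (x + s • v) - F x| with hf
  have hline : Continuous fun s : ℝ => x + s • v := by fun_prop
  have key := image_le_of_liminf_slope_right_le_deriv_boundary (f := f) (a := 0) (b := 1)
    (B := fun s => C * ‖v‖ * s) (B' := fun _ => C * ‖v‖)
    (by
      have : Continuous f := by fun_prop
      exact this.continuousOn)
    (by simp [hf]) (by fun_prop)
    (fun s _ => by simpa using ((hasDerivAt_id s).const_mul (C * ‖v‖)).hasDerivWithinAt)
    (by
      intro s _ r hr
      refine Eventually.frequently ?_
      have h1 := (hline.tendsto s).eventually (h (x + s • v))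
      filter_upwards [nhdsWithin_le_nhds h1, self_mem_nhdsWithin] with z hz hzs
      have hzs' : 0 < z - s := sub_pos.2 hzs
      have e : x + z • v - (x + s • v) = (z - s) • v := by module
      rw [e, norm_smul, Real.norm_eq_abs, abs_of_pos hzs'] at hz
      have h2 : f z - f s ≤ |F (x + z • v) - F (x + s • v)| := by
        have := abs_sub_abs_le_abs_sub (F (x + z • v) - F x) (F (x + s • v) - F x)
        simp only [hf]
        rwa [sub_sub_sub_cancel_right] at this
      rw [slope_def_field]
      refine lt_of_le_of_lt ?_ hr
      rw [div_le_iff₀ hzs']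
      calc f z - f s ≤ C * ((z - s) * ‖v‖) := h2.trans hz
        _ = C * ‖v‖ * (z - s) := by ring)
  have := key (x := 1) (by simp)
  simpa [hf, hv] using this

section
variable {Ω : Set Plane} {𝒯 : Finset (Affine.Triangle ℝ Plane)}

/-- The function given by `F T` on the open triangle `T` and by `0` off the open triangles. -/
noncomputable def piecewise {E : Type*} [AddCommMonoid E] (𝒯 : Finset (Affine.Triangle ℝ Plane))
    (F : Affine.Triangle ℝ Plane → Plane → E) (x : Plane) : E :=
  ∑ T ∈ 𝒯, (interior (closedTriangle T)).indicator (F T) x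

theorem piecewise_eq {E : Type*} [AddCommMonoid E] (h𝒯 : IsRegularTriangulation 𝒯 Ω)
    (F : Affine.Triangle ℝ Plane → Plane → E) {T : Affine.Triangle ℝ Plane} (hT : T ∈ 𝒯)
    {x : Plane} (hx : x ∈ interior (closedTriangle T)) : piecewise 𝒯 F x = F T x := by
  rw [piecewise, Finset.sum_eq_single_of_mem T hT, indicator_of_mem hx]
  intro T' hT' hne
  refine indicator_of_notMem (fun hx' => hne ?_) _
  exact h𝒯.eq_of_mem_interior hT' hT hx' hx

theorem memLp_of_piecewise {E : Type*} [NormedAddCommGroup E] [NormedSpace ℝ E]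
    [FiniteDimensional ℝ E]
    (hΩ : IsPolygonalLipschitzDomain Ω) (h𝒯 : IsRegularTriangulation 𝒯 Ω)
    {F : Affine.Triangle ℝ Plane → Plane → E} (hF : ∀ T ∈ 𝒯, Continuous (F T)) {v : Plane → E}
    (hv : ∀ T ∈ 𝒯, ∀ᵐ x, x ∈ interior (closedTriangle T) → v x = F T x) :
    MemLp v 2 (volume.restrict Ω) := by
  have hfin : IsFiniteMeasure (volume.restrict Ω) :=
    ⟨by rw [Measure.restrict_apply_univ]; exact hΩ.isBounded.measure_lt_top⟩
  have hP : MemLp (piecewise 𝒯 F) 2 (volume.restrict Ω) := by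
    refine memLp_finsetSum (f := fun T => (interior (closedTriangle T)).indicator (F T)) 𝒯
      fun T hT => ?_
    obtain ⟨B, hB⟩ := (isCompact_closedTriangle T).exists_bound_of_continuousOn
      (hF T hT).continuousOn
    refine MemLp.of_bound ((hF T hT).aestronglyMeasurable.indicator
      isOpen_interior.measurableSet) (max B 0) (Eventually.of_forall fun x => ?_)
    by_cases hx : x ∈ interior (closedTriangle T)
    · rw [indicator_of_mem hx]
      exact (hB x (interior_subset hx)).trans (le_max_left _ _)
    · rw [indicator_of_notMem hx, norm_zero]
      exact le_max_right _ _
  refine hP.ae_eq ?_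
  refine ae_of_forall_pieces hΩ h𝒯 fun T hT => ?_
  filter_upwards [hv T hT] with x hx hxT
  rw [piecewise_eq h𝒯 F hT hxT, hx hxT]

/-- `β` is a potential of the piecewise constant field `g`, in the sense of finite increments. -/
def IsPotential (Ω : Set Plane) (𝒯 : Finset (Affine.Triangle ℝ Plane))
    (g : Affine.Triangle ℝ Plane → Plane) (β : Plane → ℝ) : Prop :=
  ∀ x ∈ Ω, ∀ᶠ y in 𝓝 x, ∀ T ∈ 𝒯, y ∈ closedTriangle T → β y - β x = ⟪g T, y - x⟫_ℝ

variable {g : Affine.Triangle ℝ Plane → Plane} {β : Plane → ℝ}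

theorem IsPotential.exists_affine (hβ : IsPotential Ω 𝒯 g β) (hΩ : IsPolygonalLipschitzDomain Ω)
    (h𝒯 : IsRegularTriangulation 𝒯 Ω) : ∃ c : Affine.Triangle ℝ Plane → ℝ, ∀ T ∈ 𝒯,
      ∀ x ∈ interior (closedTriangle T), β x = ⟪g T, x⟫_ℝ + c T := by
  refine ⟨fun T => β (bary T) - ⟪g T, bary T⟫_ℝ, fun T hT x hx => ?_⟩
  have := eq_of_locally_eq (convex_closedTriangle T).interior.isPreconnected
    (fun y => β y - ⟪g T, y⟫_ℝ) (fun z hz => ?_) hx (bary_mem T)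
  · simp only at this ⊢
    linarith
  · filter_upwards [nhdsWithin_le_nhds (hβ z (interior_subset_domain hΩ h𝒯 hT hz)),
      self_mem_nhdsWithin] with y hy hyT
    have := hy T hT (interior_subset hyT)
    rw [inner_sub_right] at this
    linarith

theorem IsPotential.eventually_le (hβ : IsPotential Ω 𝒯 g β) (hΩ : IsPolygonalLipschitzDomain Ω)
    (h𝒯 : IsRegularTriangulation 𝒯 Ω) {x : Plane} (hx : x ∈ Ω) :
    ∀ᶠ y in 𝓝 x, |β y - β x| ≤ (∑ T ∈ 𝒯, ‖g T‖) * ‖y - x‖ := by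
  filter_upwards [hβ x hx, hΩ.isOpen.mem_nhds hx] with y hy hyΩ
  obtain ⟨T, hT, hyT⟩ := h𝒯.exists_mem (_root_.subset_closure hyΩ)
  rw [hy T hT hyT]
  refine (abs_real_inner_le_norm _ _).trans ?_
  gcongr
  exact Finset.single_le_sum (f := fun T => ‖g T‖) (fun _ _ => norm_nonneg _) hT

theorem IsPotential.continuousOn (hβ : IsPotential Ω 𝒯 g β) (hΩ : IsPolygonalLipschitzDomain Ω)
    (h𝒯 : IsRegularTriangulation 𝒯 Ω) : ContinuousOn β Ω := by
  intro x hx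
  refine ContinuousAt.continuousWithinAt ?_
  rw [ContinuousAt, tendsto_iff_dist_tendsto_zero]
  have hlim : Tendsto (fun y => (∑ T ∈ 𝒯, ‖g T‖) * ‖y - x‖) (𝓝 x) (𝓝 0) := by
    have : Continuous fun y => (∑ T ∈ 𝒯, ‖g T‖) * ‖y - x‖ := by fun_prop
    simpa using this.tendsto x
  exact squeeze_zero' (Eventually.of_forall fun _ => dist_nonneg)
    ((hβ.eventually_le hΩ h𝒯 hx).mono fun y hy => by rwa [Real.dist_eq]) hlim

/-- The product of a potential with a test function is Lipschitz. -/
theorem IsPotential.lipschitz_mul (hβ : IsPotential Ω 𝒯 g β) (hΩ : IsPolygonalLipschitzDomain Ω)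
    (h𝒯 : IsRegularTriangulation 𝒯 Ω) {ψ : Plane → ℝ} (hψ : ψ ∈ TestFunctions Ω) :
    ∃ C, LipschitzWith C fun x => β x * ψ x := by
  have hψ1 : ContDiff ℝ 1 ψ := hψ.1.of_le (by norm_cast)
  obtain ⟨K, hK⟩ := ContDiff.lipschitzWith_of_hasCompactSupport hψ.2.1 hψ1 one_ne_zero
  obtain ⟨B, hB⟩ := hψ1.continuous.bounded_above_of_compact_support hψ.2.1
  obtain ⟨M, hM⟩ := IsCompact.exists_bound_of_continuousOn (f := β) hψ.2.1
    ((hβ.continuousOn hΩ h𝒯).mono hψ.2.2)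
  set L := ∑ T ∈ 𝒯, ‖g T‖ with hL
  have hL0 : 0 ≤ L := Finset.sum_nonneg fun _ _ => norm_nonneg _
  have hB0 : 0 ≤ B := (norm_nonneg _).trans (hB 0)
  set M' := max M 0 with hM'
  have hC0 : 0 ≤ M' * K + L * B := by positivity
  refine ⟨⟨M' * K + L * B, hC0⟩, lipschitzWith_of_eventually fun x => ?_⟩
  change ∀ᶠ y in 𝓝 x, |β y * ψ y - β x * ψ x| ≤ (M' * K + L * B) * ‖y - x‖
  by_cases hx : x ∈ tsupport ψ
  · filter_upwards [hβ.eventually_le hΩ h𝒯 (hψ.2.2 hx)] with y hy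
    have e : β y * ψ y - β x * ψ x = β x * (ψ y - ψ x) + (β y - β x) * ψ y := by ring
    have h1 : |β x| ≤ M' := (hM x hx).trans (le_max_left _ _)
    have h2 : |ψ y - ψ x| ≤ K * ‖y - x‖ := by
      have := hK.dist_le_mul y x
      rwa [Real.dist_eq, dist_eq_norm] at this
    have h3 : |ψ y| ≤ B := hB y
    rw [e]
    calc |β x * (ψ y - ψ x) + (β y - β x) * ψ y|
        ≤ |β x| * |ψ y - ψ x| + |β y - β x| * |ψ y| := by
          rw [← abs_mul, ← abs_mul]; exact abs_add_le _ _
      _ ≤ M' * (K * ‖y - x‖) + L * ‖y - x‖ * B := by gcongr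
      _ = (M' * K + L * B) * ‖y - x‖ := by ring
  · have h0 : ∀ᶠ y in 𝓝 x, y ∉ tsupport ψ := (isClosed_tsupport ψ).isOpen_compl.mem_nhds hx
    filter_upwards [h0] with y hy
    rw [image_eq_zero_of_notMem_tsupport hx, image_eq_zero_of_notMem_tsupport hy]
    simp only [mul_zero, sub_self, abs_zero]
    positivity

theorem IsPotential.isWeakGradient (hβ : IsPotential Ω 𝒯 g β) (hΩ : IsPolygonalLipschitzDomain Ω)
    (h𝒯 : IsRegularTriangulation 𝒯 Ω) :
    IsWeakGradient Ω β (piecewise 𝒯 fun T _ => g T) := by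
  obtain ⟨c, hc⟩ := hβ.exists_affine hΩ h𝒯
  have hG : MemLp (piecewise 𝒯 fun T _ => g T) 2 (volume.restrict Ω) :=
    memLp_of_piecewise hΩ h𝒯 (F := fun T _ => g T) (fun _ _ => continuous_const)
      fun T hT => Eventually.of_forall fun x hx => piecewise_eq h𝒯 _ hT hx
  have hβL : MemLp β 2 (volume.restrict Ω) :=
    memLp_of_piecewise hΩ h𝒯 (F := fun T x => ⟪g T, x⟫_ℝ + c T) (fun _ _ => by fun_prop)
      fun T hT => Eventually.of_forall fun x hx => hc T hT x hx
  refine ⟨hG, fun ψ hψ i => ?_⟩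
  have hψ1 : ContDiff ℝ 1 ψ := hψ.1.of_le (by norm_cast)
  obtain ⟨C, hC⟩ := hβ.lipschitz_mul hΩ h𝒯 hψ
  have h0 := integral_lineDeriv_eq_zero hC (hψ.2.1.mul_left) (EuclideanSpace.single i 1)
  rw [← setIntegral_eq_of_support (U := Ω)] at h0
  · have hae : ∀ᵐ x ∂(volume.restrict Ω),
        lineDeriv ℝ (fun x => β x * ψ x) x (EuclideanSpace.single i 1) =
        β x * gradient ψ x i + piecewise 𝒯 (fun T _ => g T) x i * ψ x := by
      refine ae_of_forall_pieces hΩ h𝒯 fun T hT => Eventually.of_forall fun x hx => ?_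
      rw [piecewise_eq h𝒯 _ hT hx]
      have h1 : HasFDerivAt β (innerSL ℝ (g T)) x := by
        have h1 : HasFDerivAt (fun y : Plane => ⟪g T, y⟫_ℝ + c T) (innerSL ℝ (g T)) x :=
          ((innerSL ℝ (g T)).hasFDerivAt (x := x)).add_const (c T)
        refine h1.congr_of_eventuallyEq ?_
        filter_upwards [isOpen_interior.mem_nhds hx] with y hy using hc T hT y hy
      have h2 := (hψ1.differentiable one_ne_zero x).hasFDerivAt
      change lineDeriv ℝ (β * ψ) x _ = _
      rw [((h1.mul h2).hasLineDerivAt (EuclideanSpace.single i 1)).lineDeriv, gradient_apply]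
      simp [EuclideanSpace.inner_single_right]
      ring
    rw [integral_congr_ae hae, integral_add] at h0
    · linarith
    · exact integrableOn_mul_test hΩ hβL (gradient_mem_testFunctions hψ i)
    · exact integrableOn_mul_test hΩ ((EuclideanSpace.proj i : Plane →L[ℝ] ℝ).comp_memLp' hG) hψ
  · intro x hx
    have hx' : x ∉ tsupport ψ := fun h => hx (hψ.2.2 h)
    have hz : HasFDerivAt (fun x => β x * ψ x) (0 : Plane →L[ℝ] ℝ) x := by
      refine (hasFDerivAt_const (0 : ℝ) x).congr_of_eventuallyEq ?_
      filter_upwards [(isClosed_tsupport ψ).isOpen_compl.mem_nhds hx'] with y hy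
      rw [image_eq_zero_of_notMem_tsupport hy, mul_zero]
    rw [(hz.hasLineDerivAt (EuclideanSpace.single i 1)).lineDeriv]
    simp

/-- A piecewise constant, tangentially continuous field on a simply connected domain is the
gradient of a continuous piecewise affine function with mean zero. -/
theorem exists_mem_Yh (hΩ : IsPolygonalLipschitzDomain Ω) (hsc : IsSimplyConnected Ω)
    (h𝒯 : IsRegularTriangulation 𝒯 Ω) (hg : TangentiallyContinuous 𝒯 g) :
    ∃ α ∈ Yh 0 𝒯 Ω, ∃ c : Affine.Triangle ℝ Plane → ℝ, ∀ T ∈ 𝒯,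
      ∀ x ∈ interior (closedTriangle T), α x = ⟪g T, x⟫_ℝ + c T := by
  obtain ⟨β, hβ⟩ := exists_potential hΩ hsc h𝒯 hg
  set μ : ℝ := (∫ x in Ω, β x) / volume.real Ω with hμ
  have hα : IsPotential Ω 𝒯 g fun x => β x - μ := by
    intro x hx
    filter_upwards [hβ x hx] with y hy T hT hyT
    rw [sub_sub_sub_cancel_right]
    exact hy T hT hyT
  have haff : ∀ {γ : Plane → ℝ}, IsPotential Ω 𝒯 g γ → MemLp γ 2 (volume.restrict Ω) := by
    intro γ hγ
    obtain ⟨c, hc⟩ := hγ.exists_affine hΩ h𝒯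
    exact memLp_of_piecewise hΩ h𝒯 (F := fun T x => ⟪g T, x⟫_ℝ + c T) (fun _ _ => by fun_prop)
      fun T hT => Eventually.of_forall fun x hx => hc T hT x hx
  obtain ⟨c, hc⟩ := hα.exists_affine hΩ h𝒯
  refine ⟨fun x => β x - μ, ⟨mem_piecewisePoly_one.2 ⟨g, c, hc⟩,
    ⟨haff hα, _, hα.isWeakGradient hΩ h𝒯⟩, ?_⟩, c, hc⟩
  have hvol : volume.real Ω ≠ 0 :=
    (ENNReal.toReal_pos (hΩ.isOpen.measure_pos volume hΩ.isConnected.nonempty).ne'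
      hΩ.isBounded.measure_lt_top.ne).ne'
  have hconst : IntegrableOn (fun _ : Plane => μ) Ω :=
    integrableOn_const hΩ.isBounded.measure_lt_top.ne
  rw [integral_sub (integrableOn_of_memLp hΩ (haff hβ)) hconst, setIntegral_const, smul_eq_mul, hμ,
    mul_div_cancel₀ _ hvol, sub_self]

end

/-! ### Crouzeix–Raviart functions -/

section
variable {Ω : Set Plane} {𝒯 : Finset (Affine.Triangle ℝ Plane)}
  {a : Affine.Triangle ℝ Plane → Plane} {c : Affine.Triangle ℝ Plane → ℝ}

/-- The one-sided limits of a piecewise affine function. -/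
theorem tendsto_piecewise_affine {v : Plane → ℝ}
    (hv : ∀ T ∈ 𝒯, ∀ x ∈ interior (closedTriangle T), v x = ⟪a T, x⟫_ℝ + c T) {m : Plane} {r : ℝ} :
    Tendsto v (𝓝[openPieces 𝒯] m) (𝓝 r) ↔
      ∀ T ∈ 𝒯, m ∈ closedTriangle T → ⟪a T, m⟫_ℝ + c T = r := by
  have hT : ∀ T ∈ 𝒯, Tendsto v (𝓝[interior (closedTriangle T)] m) (𝓝 (⟪a T, m⟫_ℝ + c T)) := by
    intro T hT
    have hc : Continuous fun x : Plane => ⟪a T, x⟫_ℝ + c T := by fun_prop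
    refine ((hc.tendsto m).mono_left nhdsWithin_le_nhds).congr' ?_
    filter_upwards [self_mem_nhdsWithin] with x hx using (hv T hT x hx).symm
  constructor
  · intro h T hT𝒯 hm
    have hne : (𝓝[interior (closedTriangle T)] m).NeBot := by
      rw [← mem_closure_iff_nhdsWithin_neBot, closure_interior]
      exact hm
    refine tendsto_nhds_unique (hT T hT𝒯) (h.mono_left (nhdsWithin_mono _ fun x hx => ?_))
    exact mem_openPieces.2 ⟨T, hT𝒯, hx⟩
  · intro h
    rw [openPieces, ← Finset.set_biUnion_coe, nhdsWithin_biUnion 𝒯.finite_toSet]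
    simp only [tendsto_iSup]
    intro T hT𝒯
    by_cases hm : m ∈ closedTriangle T
    · rw [← h T hT𝒯 hm]
      exact hT T hT𝒯
    · have : 𝓝[interior (closedTriangle T)] m = ⊥ := by
        rw [← Filter.not_neBot, ← mem_closure_iff_nhdsWithin_neBot, closure_interior]
        exact hm
      rw [this]
      exact tendsto_bot

/-- The Crouzeix–Raviart conditions for the piecewise affine function `x ↦ ⟪a T, x⟫ + c T`. -/
structure IsCRCoeff (𝒯 : Finset (Affine.Triangle ℝ Plane)) (Ω : Set Plane)
    (a : Affine.Triangle ℝ Plane → Plane) (c : Affine.Triangle ℝ Plane → ℝ) : Prop where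
  continuous_mid : ∀ T ∈ 𝒯, ∀ T' ∈ 𝒯, T ≠ T' → ∀ k k', EdgeMatch T k T' k' →
    ⟪a T, edgeMid T k⟫_ℝ + c T = ⟪a T', edgeMid T k⟫_ℝ + c T'
  boundary : ∀ T ∈ 𝒯, ∀ k, edge T k ⊆ frontier Ω → ⟪a T, edgeMid T k⟫_ℝ + c T = 0

theorem mem_CR10_iff (hΩ : IsPolygonalLipschitzDomain Ω) (h𝒯 : IsRegularTriangulation 𝒯 Ω)
    {v : Plane → ℝ}
    (hv : ∀ T ∈ 𝒯, ∀ x ∈ interior (closedTriangle T), v x = ⟪a T, x⟫_ℝ + c T) :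
    v ∈ CR10 𝒯 Ω ↔ IsCRCoeff 𝒯 Ω a c := by
  have hedge : ∀ k : Fin 3, k + 1 ≠ k + 2 := by decide
  constructor
  · rintro ⟨-, h⟩
    refine ⟨fun T hT T' hT' hne k k' hm => ?_, fun T hT k hk => ?_⟩
    · obtain ⟨r, hr⟩ := (h T hT (k + 1) (k + 2) (hedge k)).1
        (not_edge_subset_frontier hΩ h𝒯 hT hT' hne hm)
      have hr' := (tendsto_piecewise_affine hv).1 hr
      change ∀ S ∈ 𝒯, edgeMid T k ∈ closedTriangle S → ⟪a S, edgeMid T k⟫_ℝ + c S = r at hr'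
      rw [hr' T hT (edgeMid_mem T k), hr' T' hT' (hm.edgeMid_eq ▸ edgeMid_mem T' k')]
    · exact (tendsto_piecewise_affine hv).1 ((h T hT (k + 1) (k + 2) (hedge k)).2 hk) T hT
        (edgeMid_mem T k)
  · intro h
    refine ⟨mem_piecewisePoly_one.2 ⟨a, c, hv⟩, fun T hT => ?_⟩
    have hlim : ∀ k, Tendsto v (𝓝[openPieces 𝒯] edgeMid T k)
        (𝓝 (⟪a T, edgeMid T k⟫_ℝ + c T)) := by
      intro k
      rw [tendsto_piecewise_affine hv]
      intro T' hT' hmem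
      by_cases hne : T = T'
      · rw [hne]
      obtain ⟨k', hm⟩ := h𝒯.exists_edgeMatch_of_edgeMid hT hT' hne hmem
      exact (h.continuous_mid T hT T' hT' hne k k' hm).symm
    have hk : ∀ k, (¬ edge T k ⊆ frontier Ω →
        ∃ r : ℝ, Tendsto v (𝓝[openPieces 𝒯] edgeMid T k) (𝓝 r)) ∧
        (edge T k ⊆ frontier Ω → Tendsto v (𝓝[openPieces 𝒯] edgeMid T k) (𝓝 0)) := by
      refine fun k => ⟨fun _ => ⟨_, hlim k⟩, fun hk => ?_⟩
      rw [← h.boundary T hT k hk]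
      exact hlim k
    intro i j hij
    obtain ⟨k, ⟨rfl, rfl⟩ | ⟨rfl, rfl⟩⟩ := exists_edge_index hij
    · exact hk k
    · rw [segment_symm, midpoint_comm]
      exact hk k

theorem exists_coeff_of_mem_CR10 (hΩ : IsPolygonalLipschitzDomain Ω)
    (h𝒯 : IsRegularTriangulation 𝒯 Ω) {v : Plane → ℝ} (hv : v ∈ CR10 𝒯 Ω) :
    ∃ (a : Affine.Triangle ℝ Plane → Plane) (c : Affine.Triangle ℝ Plane → ℝ),
      (∀ T ∈ 𝒯, ∀ x ∈ interior (closedTriangle T), v x = ⟪a T, x⟫_ℝ + c T) ∧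
      IsCRCoeff 𝒯 Ω a c := by
  obtain ⟨a, c, h⟩ := mem_piecewisePoly_one.1 hv.1
  exact ⟨a, c, h, (mem_CR10_iff hΩ h𝒯 h).1 hv⟩

theorem IsCRCoeff.sub {a' : Affine.Triangle ℝ Plane → Plane} {c' : Affine.Triangle ℝ Plane → ℝ}
    (h : IsCRCoeff 𝒯 Ω a c) (h' : IsCRCoeff 𝒯 Ω a' c') :
    IsCRCoeff 𝒯 Ω (fun T => a T - a' T) (fun T => c T - c' T) where
  continuous_mid T hT T' hT' hne k k' hm := by
    rw [inner_sub_left, inner_sub_left]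
    linarith [h.continuous_mid T hT T' hT' hne k k' hm, h'.continuous_mid T hT T' hT' hne k k' hm]
  boundary T hT k hk := by
    rw [inner_sub_left]
    linarith [h.boundary T hT k hk, h'.boundary T hT k hk]

/-- The piecewise gradient is injective on Crouzeix–Raviart functions. -/
theorem IsCRCoeff.eq_zero (hΩ : IsPolygonalLipschitzDomain Ω) (h𝒯 : IsRegularTriangulation 𝒯 Ω)
    (h : IsCRCoeff 𝒯 Ω a c) (ha : ∀ T ∈ 𝒯, a T = 0) : ∀ T ∈ 𝒯, c T = 0 := by
  obtain ⟨C, hC⟩ := h𝒯.eq_const_of_edgeMatch hΩ c fun T hT T' hT' hne k k' hm => by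
    have := h.continuous_mid T hT T' hT' hne k k' hm
    simpa [ha T hT, ha T' hT'] using this
  obtain ⟨T₀, hT₀, k, hk⟩ := h𝒯.exists_boundary_edge hΩ
  have := h.boundary T₀ hT₀ k hk
  rw [ha T₀ hT₀, inner_zero_left, zero_add, hC T₀ hT₀] at this
  intro T hT
  rw [hC T hT, this]

theorem eq_zero_of_sum_area (e : Affine.Triangle ℝ Plane → Plane)
    (h : ∑ T ∈ 𝒯, area T * ⟪e T, e T⟫_ℝ = 0) : ∀ T ∈ 𝒯, e T = 0 := by
  intro T hT
  have h0 := (Finset.sum_eq_zero_iff_of_nonneg (s := 𝒯)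
    (f := fun T => area T * ⟪e T, e T⟫_ℝ)
    (fun T _ => mul_nonneg (area_pos T).le real_inner_self_nonneg)).1 h T hT
  exact inner_self_eq_zero.1 ((mul_eq_zero.1 h0).resolve_left (area_pos T).ne')

/-- Solvability of the Crouzeix–Raviart system, in coefficients: the form is injective on a finite
dimensional space, hence surjective onto the dual. -/
theorem exists_CR_coeff (hΩ : IsPolygonalLipschitzDomain Ω) (h𝒯 : IsRegularTriangulation 𝒯 Ω)
    (F : Affine.Triangle ℝ Plane → ℝ) :
    ∃ (a : Affine.Triangle ℝ Plane → Plane) (c : Affine.Triangle ℝ Plane → ℝ),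
      IsCRCoeff 𝒯 Ω a c ∧ ∀ a' c', IsCRCoeff 𝒯 Ω a' c' →
        ∑ T ∈ 𝒯, area T * ⟪a T, a' T⟫_ℝ =
          ∑ T ∈ 𝒯, area T * (F T * (⟪a' T, bary T⟫_ℝ + c' T)) := by
  classical
  let ext (w : 𝒯 → Plane × ℝ) (T : Affine.Triangle ℝ Plane) : Plane × ℝ :=
    if h : T ∈ 𝒯 then w ⟨T, h⟩ else 0
  have hext : ∀ w T (hT : T ∈ 𝒯), ext w T = w ⟨T, hT⟩ := fun w T hT => dif_pos hT
  let S : Submodule ℝ (𝒯 → Plane × ℝ) :=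
    { carrier := {w | IsCRCoeff 𝒯 Ω (fun T => (ext w T).1) (fun T => (ext w T).2)}
      zero_mem' := by
        constructor
        · intro T hT T' hT' _ k k' _
          simp [hext _ T hT, hext _ T' hT']
        · intro T hT k _
          simp [hext _ T hT]
      add_mem' := by
        intro w w' hw hw'
        constructor
        · intro T hT T' hT' hne k k' hm
          have h1 := hw.continuous_mid T hT T' hT' hne k k' hm
          have h2 := hw'.continuous_mid T hT T' hT' hne k k' hm
          simp only [hext _ T hT, hext _ T' hT', Pi.add_apply, Prod.fst_add, Prod.snd_add,
            inner_add_left] at h1 h2 ⊢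
          linarith
        · intro T hT k hk
          have h1 := hw.boundary T hT k hk
          have h2 := hw'.boundary T hT k hk
          simp only [hext _ T hT, Pi.add_apply, Prod.fst_add, Prod.snd_add,
            inner_add_left] at h1 h2 ⊢
          linarith
      smul_mem' := by
        intro r w hw
        constructor
        · intro T hT T' hT' hne k k' hm
          have h1 := hw.continuous_mid T hT T' hT' hne k k' hm
          simp only [hext _ T hT, hext _ T' hT', Pi.smul_apply, Prod.smul_fst, Prod.smul_snd,
            inner_smul_left, smul_eq_mul, conj_trivial] at h1 ⊢
          rw [← mul_add, h1, mul_add]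
        · intro T hT k hk
          have h1 := hw.boundary T hT k hk
          simp only [hext _ T hT, Pi.smul_apply, Prod.smul_fst, Prod.smul_snd,
            inner_smul_left, smul_eq_mul, conj_trivial] at h1 ⊢
          rw [← mul_add, h1, mul_zero] }
  let L : S →ₗ[ℝ] Module.Dual ℝ S := LinearMap.mk₂ ℝ
    (fun u v => ∑ T : 𝒯, area T * ⟪(u.1 T).1, (v.1 T).1⟫_ℝ)
    (fun u u' v => by
      simp [inner_add_left, mul_add, Finset.sum_add_distrib])
    (fun r u v => by
      simp only [Submodule.coe_smul, Pi.smul_apply, Prod.smul_fst, inner_smul_left, conj_trivial,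
        smul_eq_mul, Finset.mul_sum]
      exact Finset.sum_congr rfl fun T _ => by ring)
    (fun u v v' => by
      simp [inner_add_right, mul_add, Finset.sum_add_distrib])
    (fun r u v => by
      simp only [Submodule.coe_smul, Pi.smul_apply, Prod.smul_fst, inner_smul_right,
        smul_eq_mul, Finset.mul_sum]
      exact Finset.sum_congr rfl fun T _ => by ring)
  have hL : ∀ u v : S, L u v = ∑ T : 𝒯, area T * ⟪(u.1 T).1, (v.1 T).1⟫_ℝ := fun u v => rfl
  have hinj : Function.Injective L := by
    rw [injective_iff_map_eq_zero]
    intro u hu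
    have h0 : L u u = 0 := by rw [hu]; rfl
    rw [hL] at h0
    have h1 : ∑ T ∈ 𝒯, area T * ⟪(ext u.1 T).1, (ext u.1 T).1⟫_ℝ = 0 := by
      rw [← h0, ← Finset.sum_coe_sort 𝒯]
      exact Finset.sum_congr rfl fun T _ => by rw [hext _ T.1 T.2]
    have ha := eq_zero_of_sum_area (fun T => (ext u.1 T).1) h1
    have hc := u.2.eq_zero hΩ h𝒯 ha
    refine Subtype.ext (funext fun T => ?_)
    have e1 := ha T.1 T.2
    have e2 := hc T.1 T.2
    simp only [hext _ T.1 T.2] at e1 e2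
    exact Prod.ext e1 e2
  have hsurj : Function.Surjective L :=
    (LinearMap.injective_iff_surjective_of_finrank_eq_finrank
      (Subspace.dual_finrank_eq (K := ℝ) (V := S)).symm).1 hinj
  let ℓ : Module.Dual ℝ S :=
    { toFun := fun v => ∑ T : 𝒯, area T * (F T * (⟪(v.1 T).1, bary T⟫_ℝ + (v.1 T).2))
      map_add' := fun v v' => by
        rw [← Finset.sum_add_distrib]
        refine Finset.sum_congr rfl fun T _ => ?_
        simp only [Submodule.coe_add, Pi.add_apply, Prod.fst_add, Prod.snd_add, inner_add_left]
        ring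
      map_smul' := fun r v => by
        simp only [Submodule.coe_smul, Pi.smul_apply, Prod.smul_fst, Prod.smul_snd,
          inner_smul_left, conj_trivial, smul_eq_mul, Finset.mul_sum, RingHom.id_apply]
        exact Finset.sum_congr rfl fun T _ => by ring }
  obtain ⟨u, hu⟩ := hsurj ℓ
  refine ⟨_, _, u.2, fun a' c' h' => ?_⟩
  have hv : (fun T : 𝒯 => (a' T, c' T)) ∈ S := by
    constructor
    · intro T hT T' hT' hne k k' hm
      simp only [hext _ T hT, hext _ T' hT']
      exact h'.continuous_mid T hT T' hT' hne k k' hm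
    · intro T hT k hk
      simp only [hext _ T hT]
      exact h'.boundary T hT k hk
  have h := congrArg (fun l : Module.Dual ℝ S => l ⟨_, hv⟩) hu
  simp only [hL] at h
  rw [← Finset.sum_coe_sort 𝒯, ← Finset.sum_coe_sort 𝒯]
  refine Eq.trans (Finset.sum_congr rfl fun T _ => ?_) h
  rw [hext _ T.1 T.2]

/-! ### Discrete integration by parts -/

/-- The scaled normals of a common edge are opposite. -/
theorem area_mul_inner_gradLam (h𝒯 : IsRegularTriangulation 𝒯 Ω) {T T' : Affine.Triangle ℝ Plane}
    (hT : T ∈ 𝒯) (hT' : T' ∈ 𝒯) (hne : T ≠ T') {k k' : Fin 3} (hm : EdgeMatch T k T' k')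
    (d : Plane) : area T' * ⟪gradLam T' k', d⟫_ℝ = -(area T * ⟪gradLam T k, d⟫_ℝ) := by
  have h1 := h𝒯.lam_neg hT hT' hne hm
  have h2 := hm.abs_triDet
  have h3 := area_mul_abs_triDet T T'
  have hD : |triDet T'| ≠ 0 := abs_ne_zero.2 (triDet_ne_zero T')
  rw [abs_of_neg h1] at h2
  have h4 : area T' * lam T' k' (T.points k) = - area T := by
    apply mul_right_cancel₀ hD
    rw [h2] at h3
    linarith
  rw [hm.inner_gradLam, ← mul_assoc, h4]
  ring

theorem sum_gradLam (T : Affine.Triangle ℝ Plane) (w : Plane) :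
    ⟪gradLam T 0, w⟫_ℝ + ⟪gradLam T 1, w⟫_ℝ + ⟪gradLam T 2, w⟫_ℝ = 0 := by
  have h := fun k => lam_sub T k w 0
  simp only [sub_zero] at h
  rw [← h 0, ← h 1, ← h 2]
  linarith [sum_lam T w, sum_lam T 0]

theorem affine_edgeMid (T : Affine.Triangle ℝ Plane) (v : Plane) (r : ℝ) (k : Fin 3) :
    ⟪v, edgeMid T k⟫_ℝ + r =
      ((⟪v, T.points (k + 1)⟫_ℝ + r) + (⟪v, T.points (k + 2)⟫_ℝ + r)) / 2 := by
  rw [affine_eq_sum_lam T v (edgeMid T k) r, lam_edgeMid, lam_edgeMid, lam_edgeMid]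
  fin_cases k <;> simp <;> ring

/-- The gradient of an affine function in terms of its values at the edge midpoints. -/
theorem inner_eq_sum_gradLam (T : Affine.Triangle ℝ Plane) (v w : Plane) (r : ℝ) :
    ⟪v, w⟫_ℝ = -2 * ∑ k, (⟪v, edgeMid T k⟫_ℝ + r) * ⟪gradLam T k, w⟫_ℝ := by
  have h1 := affine_eq_sum_lam T v w r
  have h2 := affine_eq_sum_lam T v 0 r
  have h := fun k => lam_sub T k w 0
  simp only [sub_zero] at h
  have hz := sum_gradLam T w
  simp only [Fin.sum_univ_three, affine_edgeMid]
  rw [inner_zero_right] at h2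
  have e0 := h 0
  have e1 := h 1
  have e2 := h 2
  rw [← e0, ← e1, ← e2] at hz ⊢
  simp only [Fin.isValue, zero_add, Fin.reduceAdd]
  linear_combination h1 - h2 +
    ((⟪v, T.points 0⟫_ℝ + r) + (⟪v, T.points 1⟫_ℝ + r) + (⟪v, T.points 2⟫_ℝ + r)) * hz

/-- Green's formula on a triangle for a lowest-order Raviart–Thomas field and an affine function;
`-2 |T| ∇λ` is the outer normal scaled by the length of the edge. -/
theorem triangle_green (T : Affine.Triangle ℝ Plane) (u v : Plane) (b r : ℝ) :
    area T * ⟪u + b • bary T, v⟫_ℝ =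
      (∑ k, (⟪v, edgeMid T k⟫_ℝ + r) * (-2 * area T * ⟪gradLam T k, u + b • edgeMid T k⟫_ℝ)) -
        area T * (2 * b * (⟪v, bary T⟫_ℝ + r)) := by
  have hmid : ∀ k, ⟪gradLam T k, u + b • edgeMid T k⟫_ℝ =
      ⟪gradLam T k, u + b • bary T⟫_ℝ - b / 3 := by
    intro k
    have := lam_sub T k (edgeMid T k) (bary T)
    rw [lam_edgeMid, if_pos rfl, lam_bary, inner_sub_right] at this
    simp only [inner_add_right, inner_smul_right]
    linear_combination (-b) * this
  have hb : ⟪v, bary T⟫_ℝ + r = (∑ k, (⟪v, edgeMid T k⟫_ℝ + r)) / 3 := by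
    rw [affine_eq_sum_lam T v (bary T) r, lam_bary, lam_bary, lam_bary]
    simp only [Fin.sum_univ_three, affine_edgeMid, Fin.isValue, zero_add, Fin.reduceAdd]
    ring
  rw [real_inner_comm, inner_eq_sum_gradLam T v _ r, hb]
  simp only [hmid, Fin.sum_univ_three]
  ring

/-- Contributions of the two sides of each interior edge cancel. -/
theorem sum_edges_eq_zero (hΩ : IsPolygonalLipschitzDomain Ω) (h𝒯 : IsRegularTriangulation 𝒯 Ω)
    (f : Affine.Triangle ℝ Plane × Fin 3 → ℝ)
    (hint : ∀ T ∈ 𝒯, ∀ T' ∈ 𝒯, T ≠ T' → ∀ k k', EdgeMatch T k T' k' → f (T, k) + f (T', k') = 0)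
    (hbd : ∀ T ∈ 𝒯, ∀ k, edge T k ⊆ frontier Ω → f (T, k) = 0) :
    ∑ T ∈ 𝒯, ∑ k, f (T, k) = 0 := by
  classical
  let N (p p' : Affine.Triangle ℝ Plane × Fin 3) : Prop :=
    p'.1 ∈ 𝒯 ∧ p.1 ≠ p'.1 ∧ EdgeMatch p.1 p.2 p'.1 p'.2
  -- Pair each side of an edge with the opposite side.
  let ι (p : Affine.Triangle ℝ Plane × Fin 3) : Affine.Triangle ℝ Plane × Fin 3 :=
    if h : ∃ p', N p p' then h.choose else p
  have hι : ∀ p, (∃ p', N p p') → N p (ι p) := by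
    intro p h
    simp only [ι]
    rw [dif_pos h]
    exact h.choose_spec
  have hι' : ∀ p, (¬ ∃ p', N p p') → ι p = p := fun p h => dif_neg h
  rw [← Finset.sum_product']
  refine Finset.sum_involution (fun p _ => ι p) ?_ ?_ ?_ ?_
  · rintro ⟨T, k⟩ hp
    have hT : T ∈ 𝒯 := (Finset.mem_product.1 hp).1
    by_cases h : ∃ p', N (T, k) p'
    · obtain ⟨h1, h2, h3⟩ := hι _ h
      exact hint T hT _ h1 h2 _ _ h3
    · have hz : f (T, k) = 0 := by
        apply hbd T hT
        by_contra hk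
        obtain ⟨T', hT', hne, k', hm⟩ := h𝒯.exists_neighbour hΩ hT hk
        exact h ⟨(T', k'), hT', hne, hm⟩
      rw [hι' _ h, hz, add_zero]
  · rintro ⟨T, k⟩ hp hf heq
    have hT : T ∈ 𝒯 := (Finset.mem_product.1 hp).1
    by_cases h : ∃ p', N (T, k) p'
    · have h2 := (hι _ h).2.1
      rw [heq] at h2
      exact h2 rfl
    · refine hf (hbd T hT k ?_)
      by_contra hk
      obtain ⟨T', hT', hne, k', hm⟩ := h𝒯.exists_neighbour hΩ hT hk
      exact h ⟨(T', k'), hT', hne, hm⟩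
  · rintro ⟨T, k⟩ hp
    by_cases h : ∃ p', N (T, k) p'
    · exact Finset.mem_product.2 ⟨(hι _ h).1, Finset.mem_univ _⟩
    · rw [hι' _ h]; exact hp
  · rintro ⟨T, k⟩ hp
    have hT : T ∈ 𝒯 := (Finset.mem_product.1 hp).1
    by_cases h : ∃ p', N (T, k) p'
    · obtain ⟨h1, h2, h3⟩ := hι _ h
      have h' : ∃ p', N (ι (T, k)) p' := ⟨(T, k), hT, h2.symm, h3.symm⟩
      obtain ⟨h4, h5, h6⟩ := hι _ h'
      obtain ⟨e1, e2⟩ := h𝒯.edgeMatch_unique h1 h4 hT h5 h2.symm h6 h3.symm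
      exact Prod.ext e1 e2
    · simp only [hι' _ h]

/-- Integration by parts of Raviart–Thomas fields against Crouzeix–Raviart functions. -/
theorem sum_inner_eq_neg_sum_div (hΩ : IsPolygonalLipschitzDomain Ω)
    (h𝒯 : IsRegularTriangulation 𝒯 Ω) {q : Plane → Plane} {d : Plane → ℝ}
    {u : Affine.Triangle ℝ Plane → Plane} {b : Affine.Triangle ℝ Plane → ℝ}
    (hd : IsWeakDivergence Ω q d)
    (hq : ∀ T ∈ 𝒯, ∀ᵐ x, x ∈ interior (closedTriangle T) → q x = u T + b T • x)
    (h : IsCRCoeff 𝒯 Ω a c) :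
    ∑ T ∈ 𝒯, area T * ⟪u T + b T • bary T, a T⟫_ℝ =
      - ∑ T ∈ 𝒯, area T * (2 * b T * (⟪a T, bary T⟫_ℝ + c T)) := by
  have hsum := sum_edges_eq_zero hΩ h𝒯 (fun p => (⟪a p.1, edgeMid p.1 p.2⟫_ℝ + c p.1) *
    (-2 * area p.1 * ⟪gradLam p.1 p.2, u p.1 + b p.1 • edgeMid p.1 p.2⟫_ℝ)) ?_ ?_
  · rw [Finset.sum_congr rfl fun T _ => triangle_green T (u T) (a T) (b T) (c T),
      Finset.sum_sub_distrib, hsum, zero_sub]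
  · intro T hT T' hT' hne k k' hm
    have h1 := h.continuous_mid T hT T' hT' hne k k' hm
    have h2 := hd.jump_eq_zero hΩ h𝒯 hq hT hT' hne hm
    have h3 := area_mul_inner_gradLam h𝒯 hT hT' hne hm (u T' + b T' • edgeMid T k)
    simp only
    rw [real_inner_comm, real_inner_comm (gradLam T k)] at h2
    rw [hm.edgeMid_eq, ← h1, h2]
    linear_combination (-2 * (⟪a T, edgeMid T k⟫_ℝ + c T)) * h3
  · intro T hT k hk
    simp only
    rw [h.boundary T hT k hk, zero_mul]

/-! ### Discrete Helmholtz decomposition -/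

/-- A piecewise constant field orthogonal to all piecewise gradients of Crouzeix–Raviart functions
has no normal jumps; rotated by a right angle it is tangentially continuous. -/
theorem tangentiallyContinuous_of_orthogonal (hΩ : IsPolygonalLipschitzDomain Ω)
    (h𝒯 : IsRegularTriangulation 𝒯 Ω) (q : Affine.Triangle ℝ Plane → Plane)
    (h : ∀ a c, IsCRCoeff 𝒯 Ω a c → ∑ T ∈ 𝒯, area T * ⟪q T, a T⟫_ℝ = 0) :
    TangentiallyContinuous 𝒯 (fun T => !₂[-q T 1, q T 0]) := by
  classical
  intro T hT T' hT' hne k k' hm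
  -- The Crouzeix–Raviart basis function of the common edge.
  let l (S : Affine.Triangle ℝ Plane) : Fin 3 := if S = T then k else k'
  have hlT : l T = k := if_pos rfl
  have hlT' : l T' = k' := if_neg hne.symm
  let a (S : Affine.Triangle ℝ Plane) : Plane :=
    if S = T ∨ S = T' then (-2 : ℝ) • gradLam S (l S) else 0
  let c (S : Affine.Triangle ℝ Plane) : ℝ :=
    if S = T ∨ S = T' then 1 - 2 * lam S (l S) 0 else 0
  have hval : ∀ S j, ⟪a S, edgeMid S j⟫_ℝ + c S =
      if (S = T ∧ j = k) ∨ (S = T' ∧ j = k') then 1 else 0 := by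
    intro S j
    by_cases hS : S = T ∨ S = T'
    · have e : ⟪a S, edgeMid S j⟫_ℝ + c S = 1 - 2 * lam S (l S) (edgeMid S j) := by
        simp only [a, c, if_pos hS]
        rw [lam_eq S (l S) (edgeMid S j), inner_smul_left, conj_trivial]
        ring
      rw [e, lam_edgeMid]
      rcases hS with rfl | rfl
      · rw [hlT]
        by_cases hj : j = k
        · simp [hj]
        · simp [hj, hne, Ne.symm hj]
      · rw [hlT']
        by_cases hj : j = k'
        · simp [hj]
        · simp [hj, hne.symm, Ne.symm hj]
    · have hS' := hS
      rw [not_or] at hS'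
      simp only [a, c, if_neg hS, inner_zero_left, add_zero]
      simp [hS'.1, hS'.2]
  have hCR : IsCRCoeff 𝒯 Ω a c := by
    have hdir : ∀ S ∈ 𝒯, ∀ S' ∈ 𝒯, S ≠ S' → ∀ j j', EdgeMatch S j S' j' →
        ((S = T ∧ j = k) ∨ (S = T' ∧ j = k')) → ((S' = T ∧ j' = k) ∨ (S' = T' ∧ j' = k')) := by
      intro S hS S' hS' hne' j j' hm' hcase
      rcases hcase with ⟨rfl, rfl⟩ | ⟨rfl, rfl⟩
      · exact Or.inr (h𝒯.edgeMatch_unique hT hS' hT' hne' hne hm' hm)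
      · exact Or.inl (h𝒯.edgeMatch_unique hT' hS' hT hne' hne.symm hm' hm.symm)
    constructor
    · intro S hS S' hS' hne' j j' hm'
      rw [hval, ← hm'.edgeMid_eq, hval]
      exact if_congr ⟨hdir S hS S' hS' hne' j j' hm',
        hdir S' hS' S hS hne'.symm j' j hm'.symm⟩ rfl rfl
    · intro S hS j hj
      rw [hval, if_neg]
      rintro (⟨rfl, rfl⟩ | ⟨rfl, rfl⟩)
      · exact not_edge_subset_frontier hΩ h𝒯 hT hT' hne hm hj
      · exact not_edge_subset_frontier hΩ h𝒯 hT' hT hne.symm hm.symm hj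
  have hs := h a c hCR
  rw [Finset.sum_eq_add_of_mem T T' hT hT' hne (fun S _ hS => by
    simp only [a]
    rw [if_neg (not_or.2 hS), inner_zero_right, mul_zero])] at hs
  have haT : a T = (-2 : ℝ) • gradLam T k := by
    have e : a T = (-2 : ℝ) • gradLam T (l T) := if_pos (Or.inl rfl)
    rw [e, hlT]
  have haT' : a T' = (-2 : ℝ) • gradLam T' k' := by
    have e : a T' = (-2 : ℝ) • gradLam T' (l T') := if_pos (Or.inr rfl)
    rw [e, hlT']
  rw [haT, haT', inner_smul_right, inner_smul_right] at hs
  have h3 := area_mul_inner_gradLam h𝒯 hT hT' hne hm (q T')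
  rw [real_inner_comm (gradLam T k), real_inner_comm (gradLam T' k')] at hs
  have h4 : area T * (⟪gradLam T k, q T⟫_ℝ - ⟪gradLam T k, q T'⟫_ℝ) = 0 := by linarith
  have h5 := sub_eq_zero.1 ((mul_eq_zero.1 h4).resolve_left (area_pos T).ne')
  rw [inner_gradLam, inner_gradLam, div_left_inj' (triDet_ne_zero T), neg_inj] at h5
  rw [inner_plane, inner_plane]
  simp only [cross] at h5
  simp only [Matrix.cons_val_zero, Matrix.cons_val_one]
  linarith

end

/-! ### Solutions in coefficients -/

section
variable {Ω : Set Plane} {𝒯 : Finset (Affine.Triangle ℝ Plane)}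

/-- The rotation by a right angle that turns a gradient into a curl. -/
noncomputable def rot (v : Plane) : Plane := !₂[v 1, -v 0]

theorem rot_rot_neg (v : Plane) : rot !₂[-v 1, v 0] = v := by
  ext i
  fin_cases i <;> simp [rot]

theorem rot_injective : Function.Injective rot := by
  intro v w h
  have h0 := congrArg (fun u : Plane => u 0) h
  have h1 := congrArg (fun u : Plane => u 1) h
  simp only [rot, Matrix.cons_val_zero, Matrix.cons_val_one, neg_inj] at h0 h1
  ext i
  fin_cases i
  · exact h1
  · exact h0

/-- On each triangle the weak curl of a piecewise affine `H¹` function is the classical one. -/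
theorem curl_ae_eq (hΩ : IsPolygonalLipschitzDomain Ω) (h𝒯 : IsRegularTriangulation 𝒯 Ω)
    {β : Plane → ℝ} (hβ : β ∈ H1 Ω) {B : Affine.Triangle ℝ Plane → Plane}
    {c : Affine.Triangle ℝ Plane → ℝ}
    (h : ∀ T ∈ 𝒯, ∀ x ∈ interior (closedTriangle T), β x = ⟪B T, x⟫_ℝ + c T) :
    ∀ T ∈ 𝒯, ∀ᵐ x, x ∈ interior (closedTriangle T) → curl Ω β x = rot (B T) := by
  intro T hT
  filter_upwards [(isWeakGradient_weakGradient hβ).ae_eq hΩ h𝒯 hT (h T hT)] with x hx hxT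
  rw [curl, hx hxT, rot]

theorem integral_inner_curl (hΩ : IsPolygonalLipschitzDomain Ω) (h𝒯 : IsRegularTriangulation 𝒯 Ω)
    {β : Plane → ℝ} (hβ : β ∈ H1 Ω) {B Q : Affine.Triangle ℝ Plane → Plane}
    {c : Affine.Triangle ℝ Plane → ℝ} {q : Plane → Plane}
    (h : ∀ T ∈ 𝒯, ∀ x ∈ interior (closedTriangle T), β x = ⟪B T, x⟫_ℝ + c T)
    (hq : ∀ T ∈ 𝒯, ∀ x ∈ interior (closedTriangle T), q x = Q T) :
    ∫ x in Ω, ⟪q x, curl Ω β x⟫_ℝ = ∑ T ∈ 𝒯, area T * ⟪Q T, rot (B T)⟫_ℝ := by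
  rw [← integral_piecewise_const hΩ h𝒯 (piecewise 𝒯 fun T _ => ⟪Q T, rot (B T)⟫_ℝ) _
    fun T hT x hx => piecewise_eq h𝒯 _ hT hx]
  refine integral_congr_ae (ae_of_forall_pieces hΩ h𝒯 fun T hT => ?_)
  filter_upwards [curl_ae_eq hΩ h𝒯 hβ h T hT] with x hx hxT
  rw [piecewise_eq h𝒯 _ hT hxT, hx hxT, hq T hT x hxT]

/-- Curls of `H¹` functions are orthogonal to piecewise gradients of Crouzeix–Raviart functions. -/
theorem sum_inner_rot_eq_zero (hΩ : IsPolygonalLipschitzDomain Ω)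
    (h𝒯 : IsRegularTriangulation 𝒯 Ω) {β : Plane → ℝ} (hβ : β ∈ H1 Ω)
    {B U : Affine.Triangle ℝ Plane → Plane} {c r : Affine.Triangle ℝ Plane → ℝ}
    (h : ∀ T ∈ 𝒯, ∀ x ∈ interior (closedTriangle T), β x = ⟪B T, x⟫_ℝ + c T)
    (hU : IsCRCoeff 𝒯 Ω U r) : ∑ T ∈ 𝒯, area T * ⟪U T, rot (B T)⟫_ℝ = 0 := by
  have key := sum_inner_eq_neg_sum_div hΩ h𝒯 (u := fun T => rot (B T)) (b := fun _ => 0)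
    (isWeakDivergence_curl hΩ hβ) (fun T hT => by
      filter_upwards [curl_ae_eq hΩ h𝒯 hβ h T hT] with x hx hxT
      rw [hx hxT, zero_smul, add_zero]) hU
  simp only [zero_smul, add_zero, mul_zero, zero_mul, Finset.sum_const_zero, neg_zero] at key
  rw [← key]
  exact Finset.sum_congr rfl fun T _ => by rw [real_inner_comm]

/-- An `H¹` function that is constant on each open triangle and has mean zero vanishes. -/
theorem eq_zero_of_piecewise_const (hΩ : IsPolygonalLipschitzDomain Ω)
    (h𝒯 : IsRegularTriangulation 𝒯 Ω) {γ : Plane → ℝ} {g : Plane → Plane}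
    (hg : IsWeakGradient Ω γ g) (h0 : ∫ x in Ω, γ x = 0) {c : Affine.Triangle ℝ Plane → ℝ}
    (h : ∀ T ∈ 𝒯, ∀ x ∈ interior (closedTriangle T), γ x = c T) : ∀ T ∈ 𝒯, c T = 0 := by
  -- The traces on an interior edge agree, since `γ e₀` and `γ e₁` have no normal jumps.
  have hjump : ∀ T ∈ 𝒯, ∀ T' ∈ 𝒯, T ≠ T' → ∀ k k', EdgeMatch T k T' k' → c T = c T' := by
    intro T hT T' hT' hne k k' hm
    have hi : ∀ i : Fin 2, (c T - c T') * gradLam T k i = 0 := by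
      intro i
      have := (isWeakDivergence_single hg i).jump_eq_zero hΩ h𝒯
        (a := fun T => c T • EuclideanSpace.single i 1) (b := fun _ => 0)
        (fun S hS => Eventually.of_forall fun x hx => by
          rw [h S hS x hx, zero_smul, add_zero]) hT hT' hne hm
      simp only [zero_smul, add_zero, inner_smul_left, conj_trivial,
        EuclideanSpace.inner_single_left, map_one, one_mul] at this
      linarith
    by_contra hcc
    refine gradLam_ne_zero T k ?_
    ext i
    exact (mul_eq_zero.1 (hi i)).resolve_left (sub_ne_zero.2 hcc)
  obtain ⟨C, hC⟩ := h𝒯.eq_const_of_edgeMatch hΩ c hjump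
  rw [integral_piecewise_const hΩ h𝒯 γ c h, Finset.sum_congr rfl fun T hT => by rw [hC T hT],
    ← Finset.sum_mul] at h0
  intro T hT
  have hpos : 0 < ∑ T ∈ 𝒯, area T := Finset.sum_pos (fun T _ => area_pos T) ⟨T, hT⟩
  rw [hC T hT]
  exact (mul_eq_zero.1 h0).resolve_left hpos.ne'

theorem IsWeakGradient.sub (hΩ : IsPolygonalLipschitzDomain Ω) {β β' : Plane → ℝ}
    {g g' : Plane → Plane} (hβ : MemLp β 2 (volume.restrict Ω))
    (hβ' : MemLp β' 2 (volume.restrict Ω)) (hg : IsWeakGradient Ω β g)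
    (hg' : IsWeakGradient Ω β' g') :
    IsWeakGradient Ω (fun x => β x - β' x) (fun x => g x - g' x) := by
  refine ⟨hg.1.sub hg'.1, fun ψ hψ i => ?_⟩
  have hL : ∀ {G : Plane → Plane}, MemLp G 2 (volume.restrict Ω) →
      IntegrableOn (fun x => G x i * ψ x) Ω := fun hG =>
    integrableOn_mul_test hΩ ((EuclideanSpace.proj i : Plane →L[ℝ] ℝ).comp_memLp' hG) hψ
  simp only [sub_mul, PiLp.sub_apply]
  rw [integral_sub (integrableOn_mul_test hΩ hβ (gradient_mem_testFunctions hψ i))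
    (integrableOn_mul_test hΩ hβ' (gradient_mem_testFunctions hψ i)),
    integral_sub (hL hg.1) (hL hg'.1), hg.2 ψ hψ i,
    hg'.2 ψ hψ i]
  ring

/-- Functions in `Y` that are affine on each triangle are determined by their gradients. -/
theorem eqOn_of_mem_Y (hΩ : IsPolygonalLipschitzDomain Ω) (h𝒯 : IsRegularTriangulation 𝒯 Ω)
    {α α' : Plane → ℝ} (hα : α ∈ Y Ω) (hα' : α' ∈ Y Ω) {A : Affine.Triangle ℝ Plane → Plane}
    {c c' : Affine.Triangle ℝ Plane → ℝ}
    (h : ∀ T ∈ 𝒯, ∀ x ∈ interior (closedTriangle T), α x = ⟪A T, x⟫_ℝ + c T)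
    (h' : ∀ T ∈ 𝒯, ∀ x ∈ interior (closedTriangle T), α' x = ⟪A T, x⟫_ℝ + c' T) :
    EqOn α α' (openPieces 𝒯) := by
  have h0 : ∫ x in Ω, (α x - α' x) = 0 := by
    rw [integral_sub (integrableOn_of_memLp hΩ hα.1.1) (integrableOn_of_memLp hΩ hα'.1.1), hα.2,
      hα'.2, sub_zero]
  have key := eq_zero_of_piecewise_const hΩ h𝒯
    ((isWeakGradient_weakGradient hα.1).sub hΩ hα.1.1 hα'.1.1 (isWeakGradient_weakGradient hα'.1))
    h0 (c := fun T => c T - c' T) fun T hT x hx => by rw [h T hT x hx, h' T hT x hx]; ring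
  intro x hx
  obtain ⟨T, hT, hxT⟩ := mem_openPieces.1 hx
  rw [h T hT x hxT, h' T hT x hxT, sub_eq_zero.1 (key T hT)]

variable {φ : Plane → Plane} {φa : Affine.Triangle ℝ Plane → Plane}
  {φb : Affine.Triangle ℝ Plane → ℝ}

theorem inner_add_smul (u v x : Plane) (b : ℝ) : ⟪u + b • x, v⟫_ℝ = ⟪b • v, x⟫_ℝ + ⟪u, v⟫_ℝ := by
  rw [inner_add_left, inner_smul_left, inner_smul_left, real_inner_comm v x, add_comm]

/-- Against piecewise constants, a Raviart–Thomas field acts by its values at the barycentres. -/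
theorem integral_inner_RT (hΩ : IsPolygonalLipschitzDomain Ω) (h𝒯 : IsRegularTriangulation 𝒯 Ω)
    (hφ : ∀ T ∈ 𝒯, ∀ x ∈ interior (closedTriangle T), φ x = φa T + φb T • x) {q : Plane → Plane}
    {Q : Affine.Triangle ℝ Plane → Plane}
    (hq : ∀ T ∈ 𝒯, ∀ x ∈ interior (closedTriangle T), q x = Q T) :
    ∫ x in Ω, ⟪φ x, q x⟫_ℝ = ∑ T ∈ 𝒯, area T * ⟪φa T + φb T • bary T, Q T⟫_ℝ := by
  rw [integral_piecewise_affine hΩ h𝒯 _ (fun T => φb T • Q T) (fun T => ⟪φa T, Q T⟫_ℝ)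
    fun T hT x hx => by rw [hφ T hT x hx, hq T hT x hx, inner_add_smul]]
  exact Finset.sum_congr rfl fun T _ => by rw [inner_add_smul]

/-- The mixed problem in coefficients: `P + rot A` is the `L²` projection of `φ` onto piecewise
constants, which is its value at the barycentres, and `P` is orthogonal to all discrete curls. -/
theorem isMixedSolution_iff (hΩ : IsPolygonalLipschitzDomain Ω) (h𝒯 : IsRegularTriangulation 𝒯 Ω)
    (hφ : ∀ T ∈ 𝒯, ∀ x ∈ interior (closedTriangle T), φ x = φa T + φb T • x) {p : Plane → Plane}
    {α : Plane → ℝ} (hα : α ∈ Yh 0 𝒯 Ω) {P A : Affine.Triangle ℝ Plane → Plane}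
    {c : Affine.Triangle ℝ Plane → ℝ}
    (hp : ∀ T ∈ 𝒯, ∀ x ∈ interior (closedTriangle T), p x = P T)
    (hA : ∀ T ∈ 𝒯, ∀ x ∈ interior (closedTriangle T), α x = ⟪A T, x⟫_ℝ + c T) :
    IsMixedSolution 0 𝒯 Ω φ p α ↔ (∀ T ∈ 𝒯, P T + rot (A T) = φa T + φb T • bary T) ∧
      ∀ β ∈ Yh 0 𝒯 Ω, ∀ (B : Affine.Triangle ℝ Plane → Plane) (r : Affine.Triangle ℝ Plane → ℝ),
        (∀ T ∈ 𝒯, ∀ x ∈ interior (closedTriangle T), β x = ⟪B T, x⟫_ℝ + r T) →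
          ∑ T ∈ 𝒯, area T * ⟪P T, rot (B T)⟫_ℝ = 0 := by
  have hlhs : ∀ (q : Plane → Plane) (Q : Affine.Triangle ℝ Plane → Plane),
      (∀ T ∈ 𝒯, ∀ x ∈ interior (closedTriangle T), q x = Q T) →
      (∫ x in Ω, ⟪p x, q x⟫_ℝ) + (∫ x in Ω, ⟪q x, curl Ω α x⟫_ℝ) =
        ∑ T ∈ 𝒯, area T * ⟪P T + rot (A T), Q T⟫_ℝ := by
    intro q Q hq
    rw [integral_inner_curl hΩ h𝒯 hα.2.1 hA hq, integral_piecewise_const hΩ h𝒯 _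
      (fun T => ⟪P T, Q T⟫_ℝ) (fun T hT x hx => by rw [hp T hT x hx, hq T hT x hx]),
      ← Finset.sum_add_distrib]
    exact Finset.sum_congr rfl fun T _ => by
      rw [inner_add_left, real_inner_comm (Q T) (rot (A T))]; ring
  constructor
  · intro h
    refine ⟨?_, fun β hβ B r hB => ?_⟩
    · have hq : ∀ T ∈ 𝒯, ∀ x ∈ interior (closedTriangle T),
          piecewise 𝒯 (fun T _ => P T + rot (A T) - (φa T + φb T • bary T)) x =
            P T + rot (A T) - (φa T + φb T • bary T) :=
        fun T hT x hx => piecewise_eq h𝒯 _ hT hx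
      have h1 := h.eq_a _ (mem_piecewisePolyVec_zero.2 ⟨_, hq⟩)
      rw [hlhs _ _ hq, integral_inner_RT hΩ h𝒯 hφ hq, ← sub_eq_zero, ← Finset.sum_sub_distrib,
        Finset.sum_congr rfl fun T _ => by rw [← mul_sub, ← inner_sub_left]] at h1
      exact fun T hT => sub_eq_zero.1 (eq_zero_of_sum_area _ h1 T hT)
    · rw [← integral_inner_curl hΩ h𝒯 hβ.2.1 hB hp]
      exact h.eq_b β hβ
  · rintro ⟨h1, h2⟩
    refine ⟨mem_piecewisePolyVec_zero.2 ⟨P, hp⟩, hα, fun q hq => ?_, fun β hβ => ?_⟩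
    · obtain ⟨Q, hQ⟩ := mem_piecewisePolyVec_zero.1 hq
      rw [hlhs q Q hQ, integral_inner_RT hΩ h𝒯 hφ hQ]
      exact Finset.sum_congr rfl fun T hT => by rw [h1 T hT]
    · obtain ⟨B, r, hB⟩ := mem_piecewisePoly_one.1 hβ.1
      rw [integral_inner_curl hΩ h𝒯 hβ.2.1 hB hp]
      exact h2 β hβ B r hB

/-- Uniqueness for the mixed problem, on the open triangles. -/
theorem IsMixedSolution.eqOn (hΩ : IsPolygonalLipschitzDomain Ω) (h𝒯 : IsRegularTriangulation 𝒯 Ω)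
    (hφ : ∀ T ∈ 𝒯, ∀ x ∈ interior (closedTriangle T), φ x = φa T + φb T • x)
    {p p' : Plane → Plane} {α α' : Plane → ℝ} (h : IsMixedSolution 0 𝒯 Ω φ p α)
    (h' : IsMixedSolution 0 𝒯 Ω φ p' α') :
    EqOn p p' (openPieces 𝒯) ∧ EqOn α α' (openPieces 𝒯) := by
  obtain ⟨P, hP⟩ := mem_piecewisePolyVec_zero.1 h.p_mem
  obtain ⟨P', hP'⟩ := mem_piecewisePolyVec_zero.1 h'.p_mem
  obtain ⟨A, c, hA⟩ := mem_piecewisePoly_one.1 h.α_mem.1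
  obtain ⟨A', c', hA'⟩ := mem_piecewisePoly_one.1 h'.α_mem.1
  obtain ⟨h1, h2⟩ := (isMixedSolution_iff hΩ h𝒯 hφ h.α_mem hP hA).1 h
  obtain ⟨h1', h2'⟩ := (isMixedSolution_iff hΩ h𝒯 hφ h'.α_mem hP' hA').1 h'
  have hE : ∀ T ∈ 𝒯, P T - P' T = rot (A' T) - rot (A T) := fun T hT => by
    rw [sub_eq_sub_iff_add_eq_add, h1 T hT, add_comm (rot _), h1' T hT]
  -- The difference `P - P'` is a discrete curl and orthogonal to all discrete curls.
  have hz : ∀ T ∈ 𝒯, P T - P' T = 0 := by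
    refine eq_zero_of_sum_area (fun T => P T - P' T) ?_
    have e : ∀ T ∈ 𝒯, area T * ⟪P T - P' T, P T - P' T⟫_ℝ =
        (area T * ⟪P T, rot (A' T)⟫_ℝ - area T * ⟪P' T, rot (A' T)⟫_ℝ) -
          (area T * ⟪P T, rot (A T)⟫_ℝ - area T * ⟪P' T, rot (A T)⟫_ℝ) := by
      intro T hT
      nth_rewrite 2 [hE T hT]
      rw [inner_sub_right, inner_sub_left, inner_sub_left]
      ring
    rw [Finset.sum_congr rfl e]
    simp only [Finset.sum_sub_distrib]
    rw [h2 α' h'.α_mem A' c' hA', h2' α' h'.α_mem A' c' hA', h2 α h.α_mem A c hA,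
      h2' α h.α_mem A c hA]
    ring
  refine ⟨fun x hx => ?_, ?_⟩
  · obtain ⟨T, hT, hxT⟩ := mem_openPieces.1 hx
    rw [hP T hT x hxT, hP' T hT x hxT, sub_eq_zero.1 (hz T hT)]
  · refine eqOn_of_mem_Y hΩ h𝒯 h.α_mem.2 h'.α_mem.2 (A := A') (c := c) (fun T hT x hx => ?_) hA'
    have : A' T = A T := rot_injective (sub_eq_zero.1 ((hE T hT).symm.trans (hz T hT)))
    rw [hA T hT x hx, this]

/-- The Crouzeix–Raviart problem in coefficients. -/
theorem isCRSolution_iff (hΩ : IsPolygonalLipschitzDomain Ω) (h𝒯 : IsRegularTriangulation 𝒯 Ω)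
    {f u : Plane → ℝ} {F c : Affine.Triangle ℝ Plane → ℝ} {U : Affine.Triangle ℝ Plane → Plane}
    (hF : ∀ T ∈ 𝒯, ∀ x ∈ interior (closedTriangle T), f x = F T)
    (hU : ∀ T ∈ 𝒯, ∀ x ∈ interior (closedTriangle T), u x = ⟪U T, x⟫_ℝ + c T) :
    IsCRSolution 𝒯 Ω f u ↔ IsCRCoeff 𝒯 Ω U c ∧ ∀ V r, IsCRCoeff 𝒯 Ω V r →
      ∑ T ∈ 𝒯, area T * ⟪U T, V T⟫_ℝ =
        ∑ T ∈ 𝒯, area T * (F T * (⟪V T, bary T⟫_ℝ + r T)) := by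
  have hint : ∀ (v : Plane → ℝ) (V : Affine.Triangle ℝ Plane → Plane)
      (r : Affine.Triangle ℝ Plane → ℝ),
      (∀ T ∈ 𝒯, ∀ x ∈ interior (closedTriangle T), v x = ⟪V T, x⟫_ℝ + r T) →
      (∫ x in Ω, ⟪gradNC 𝒯 u x, gradNC 𝒯 v x⟫_ℝ = ∑ T ∈ 𝒯, area T * ⟪U T, V T⟫_ℝ) ∧
      ∫ x in Ω, f x * v x = ∑ T ∈ 𝒯, area T * (F T * (⟪V T, bary T⟫_ℝ + r T)) := by
    intro v V r hv
    refine ⟨integral_piecewise_const hΩ h𝒯 _ _ fun T hT x hx => ?_, ?_⟩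
    · rw [gradNC_eq hT (hU T hT) hx, gradNC_eq hT (hv T hT) hx]
    · rw [integral_piecewise_affine hΩ h𝒯 _ (fun T => F T • V T) (fun T => F T * r T)
        fun T hT x hx => by
          rw [hF T hT x hx, hv T hT x hx, inner_smul_left, conj_trivial, mul_add]]
      exact Finset.sum_congr rfl fun T _ => by rw [inner_smul_left, conj_trivial, mul_add (F T)]
  constructor
  · intro h
    refine ⟨(mem_CR10_iff hΩ h𝒯 hU).1 h.mem, fun V r hV => ?_⟩
    have hv : ∀ T ∈ 𝒯, ∀ x ∈ interior (closedTriangle T),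
        piecewise 𝒯 (fun T x => ⟪V T, x⟫_ℝ + r T) x = ⟪V T, x⟫_ℝ + r T :=
      fun T hT x hx => piecewise_eq h𝒯 _ hT hx
    rw [← (hint _ V r hv).1, ← (hint _ V r hv).2]
    exact h.eq _ ((mem_CR10_iff hΩ h𝒯 hv).2 hV)
  · rintro ⟨h1, h2⟩
    refine ⟨(mem_CR10_iff hΩ h𝒯 hU).2 h1, fun v hv => ?_⟩
    obtain ⟨V, r, hV, hCR⟩ := exists_coeff_of_mem_CR10 hΩ h𝒯 hv
    rw [(hint v V r hV).1, (hint v V r hV).2]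
    exact h2 V r hCR

/-- Uniqueness for the Crouzeix–Raviart problem, on the open triangles. -/
theorem IsCRSolution.eqOn (hΩ : IsPolygonalLipschitzDomain Ω) (h𝒯 : IsRegularTriangulation 𝒯 Ω)
    {f u u' : Plane → ℝ} (hf : f ∈ PiecewisePoly 0 𝒯) (h : IsCRSolution 𝒯 Ω f u)
    (h' : IsCRSolution 𝒯 Ω f u') : EqOn u u' (openPieces 𝒯) := by
  obtain ⟨F, hF⟩ := mem_piecewisePoly_zero.1 hf
  obtain ⟨U, c, hU, hc⟩ := exists_coeff_of_mem_CR10 hΩ h𝒯 h.mem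
  obtain ⟨U', c', hU', hc'⟩ := exists_coeff_of_mem_CR10 hΩ h𝒯 h'.mem
  have h1 := ((isCRSolution_iff hΩ h𝒯 hF hU).1 h).2 _ _ (hc.sub hc')
  have h1' := ((isCRSolution_iff hΩ h𝒯 hF hU').1 h').2 _ _ (hc.sub hc')
  have hz : ∀ T ∈ 𝒯, U T - U' T = 0 := by
    refine eq_zero_of_sum_area (fun T => U T - U' T) ?_
    rw [← sub_eq_zero.2 (h1.trans h1'.symm), ← Finset.sum_sub_distrib]
    exact Finset.sum_congr rfl fun T _ => by rw [inner_sub_left, mul_sub]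
  have hcz := (hc.sub hc').eq_zero hΩ h𝒯 hz
  intro x hx
  obtain ⟨T, hT, hxT⟩ := mem_openPieces.1 hx
  rw [hU T hT x hxT, hU' T hT x hxT, sub_eq_zero.1 (hz T hT), sub_eq_zero.1 (hcz T hT)]

theorem exists_isCRSolution (hΩ : IsPolygonalLipschitzDomain Ω)
    (h𝒯 : IsRegularTriangulation 𝒯 Ω) {f : Plane → ℝ} (hf : f ∈ PiecewisePoly 0 𝒯) :
    ∃ u, IsCRSolution 𝒯 Ω f u := by
  obtain ⟨F, hF⟩ := mem_piecewisePoly_zero.1 hf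
  obtain ⟨U, c, h⟩ := exists_CR_coeff hΩ h𝒯 F
  exact ⟨_, (isCRSolution_iff hΩ h𝒯 hF fun T hT x hx =>
    piecewise_eq h𝒯 (fun T x => ⟪U T, x⟫_ℝ + c T) hT hx).2 h⟩

/-- The piecewise gradient of the Crouzeix–Raviart solution is the first component of a solution
of the mixed problem: its difference to the projection of `φ` is orthogonal to all piecewise
gradients of Crouzeix–Raviart functions, hence a discrete curl. -/
theorem IsCRSolution.exists_isMixedSolution (hΩ : IsPolygonalLipschitzDomain Ω)
    (hsc : IsSimplyConnected Ω) (h𝒯 : IsRegularTriangulation 𝒯 Ω) {f u : Plane → ℝ}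
    (hf : f ∈ PiecewisePoly 0 𝒯)
    (hφ : ∀ T ∈ 𝒯, ∀ x ∈ interior (closedTriangle T), φ x = φa T + φb T • x)
    (hdiv : IsWeakDivergence Ω φ fun x => -f x) (h : IsCRSolution 𝒯 Ω f u) :
    ∃ α, IsMixedSolution 0 𝒯 Ω φ (gradNC 𝒯 u) α := by
  obtain ⟨F, hF⟩ := mem_piecewisePoly_zero.1 hf
  obtain ⟨U, c, hU, hCR⟩ := exists_coeff_of_mem_CR10 hΩ h𝒯 h.mem
  have hsol := ((isCRSolution_iff hΩ h𝒯 hF hU).1 h).2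
  have hφ' : ∀ T ∈ 𝒯, ∀ᵐ x, x ∈ interior (closedTriangle T) → φ x = φa T + φb T • x :=
    fun T hT => Eventually.of_forall (hφ T hT)
  have hb : ∀ T ∈ 𝒯, 2 * φb T = -F T := by
    intro T hT
    have hne : volume (interior (closedTriangle T)) ≠ 0 :=
      (isOpen_interior.measure_pos volume ⟨_, bary_mem T⟩).ne'
    obtain ⟨x, hx, hxd⟩ := ((frequently_ae_mem_iff.2 hne).and_eventually
      (hdiv.ae_eq hΩ h𝒯 hφ' hT)).exists
    rw [← hxd hx, hF T hT x hx]
  have horth : ∀ a r, IsCRCoeff 𝒯 Ω a r →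
      ∑ T ∈ 𝒯, area T * ⟪φa T + φb T • bary T - U T, a T⟫_ℝ = 0 := by
    intro a r ha
    have h1 := sum_inner_eq_neg_sum_div hΩ h𝒯 hdiv hφ' ha
    have h2 : ∑ T ∈ 𝒯, area T * (2 * φb T * (⟪a T, bary T⟫_ℝ + r T)) =
        - ∑ T ∈ 𝒯, area T * (F T * (⟪a T, bary T⟫_ℝ + r T)) := by
      rw [← Finset.sum_neg_distrib]
      exact Finset.sum_congr rfl fun T hT => by rw [hb T hT]; ring
    rw [h2, neg_neg, ← hsol a r ha] at h1
    simp only [inner_sub_left, mul_sub, Finset.sum_sub_distrib]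
    rw [h1, sub_self]
  obtain ⟨α, hα, r, hr⟩ := exists_mem_Yh hΩ hsc h𝒯
    (tangentiallyContinuous_of_orthogonal hΩ h𝒯 _ horth)
  refine ⟨α, (isMixedSolution_iff hΩ h𝒯 hφ hα (P := U)
    (fun T hT x hx => gradNC_eq hT (hU T hT) hx) hr).2 ⟨fun T _ => ?_, fun β hβ B s hB => ?_⟩⟩
  · rw [rot_rot_neg, add_sub_cancel]
  · exact sum_inner_rot_eq_zero hΩ h𝒯 hβ.2.1 hB hCR

end

end CRFEM

open CRFEM in
/-- Existence and uniqueness of the two discrete solutions, and their coincidence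
`p_h = ∇_NC u_CR`. Piecewise functions are identified when they agree on every open triangle. -/
theorem proposition3p3 (Ω : Set Plane) (hΩ : IsPolygonalLipschitzDomain Ω)
    (hsc : IsSimplyConnected Ω)
    (𝒯 : Finset (Affine.Triangle ℝ Plane)) (h𝒯 : IsRegularTriangulation 𝒯 Ω)
    (f : Plane → ℝ) (hf : f ∈ PiecewisePoly 0 𝒯)
    (φ : Plane → Plane) (hφ : φ ∈ RT0 𝒯 Ω)
    (hdiv : IsWeakDivergence Ω φ (fun x => - f x)) :
    (∃ (p : Plane → Plane) (α : Plane → ℝ), IsMixedSolution 0 𝒯 Ω φ p α) ∧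
    (∀ (p p' : Plane → Plane) (α α' : Plane → ℝ),
      IsMixedSolution 0 𝒯 Ω φ p α → IsMixedSolution 0 𝒯 Ω φ p' α' →
        EqOn p p' (openPieces 𝒯) ∧ EqOn α α' (openPieces 𝒯)) ∧
    (∃ u : Plane → ℝ, IsCRSolution 𝒯 Ω f u) ∧
    (∀ u u' : Plane → ℝ, IsCRSolution 𝒯 Ω f u → IsCRSolution 𝒯 Ω f u' →
      EqOn u u' (openPieces 𝒯)) ∧
    (∀ (p : Plane → Plane) (α u : Plane → ℝ),
      IsMixedSolution 0 𝒯 Ω φ p α → IsCRSolution 𝒯 Ω f u →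
        EqOn p (gradNC 𝒯 u) (openPieces 𝒯)) := by
  have hφc : ∀ T, ∃ (a : Plane) (b : ℝ), T ∈ 𝒯 →
      ∀ x ∈ interior (closedTriangle T), φ x = a + b • x := by
    intro T
    by_cases hT : T ∈ 𝒯
    · obtain ⟨a, b, h⟩ := hφ.2 T hT
      exact ⟨a, b, fun _ => h⟩
    · exact ⟨0, 0, fun h => absurd h hT⟩
  choose φa φb hφab using hφc
  obtain ⟨u, hu⟩ := exists_isCRSolution hΩ h𝒯 hf
  refine ⟨?_, fun p p' α α' h h' => h.eqOn hΩ h𝒯 hφab h', ⟨u, hu⟩,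
    fun u u' h h' => h.eqOn hΩ h𝒯 hf h', fun p α u h h' => ?_⟩
  · obtain ⟨α, hα⟩ := hu.exists_isMixedSolution hΩ hsc h𝒯 hf hφab hdiv
    exact ⟨_, α, hα⟩
  · obtain ⟨α', hα'⟩ := h'.exists_isMixedSolution hΩ hsc h𝒯 hf hφab hdiv
    exact (h.eqOn hΩ h𝒯 hφab hα').1
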